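/- Let $(M,g)$ be a nonempty compact smooth Riemannian manifold without boundary of dimension $6$; $\nabla$, $\Delta=\nabla\cdot\nabla$, $|\cdot|$ and integrals over $M$ refer to $g$ and its volume measure. Let $\alpha,\beta\in\mathbb R$, let $R,T$ be real functions on $M$ and let $F_1,F_3,F_5$ be differential forms on $M$ of degrees $1,3,5$. For functions $v,u>0$ on $M$ (conformal factor and warp factor) consider the system $$10uv\,\Delta v+6\nabla\cdot(v^2\nabla u)-2uv^2R+u\big(v^2|F_1|^2+|F_3|^2+v^{-2}|F_5|^2\big)-2uT=2\alpha v^3,$$ $$5\Delta(u^2v)+5u^2\Delta v-2u^2vR-6v|\nabla u|^2+u^2\big(v|F_1|^2-v^{-3}|F_5|^2\big)=6(\alpha uv^2+\beta v^2),\qquad (\ast)$$ and the effective potential (with $G_N$ a constant) $$V_{eff}(v,u)=\tfrac12\int_M\Big(-u^2v^2R-5\nabla v\cdot\nabla(u^2v)-3v^2|\nabla u|^2+\tfrac{u^2}{2}\big(v^2|F_1|^2+|F_3|^2+v^{-2}|F_5|^2\big)-u^2T\Big)+\alpha\Big(\tfrac1{G_N}-\int_M uv^3\Big)+\beta\Big(\mathrm{Vol}(M)-\int_M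 v^3\Big).$$ A solution $(v,u)$ of $(\ast)$ is called stable if $\frac{\partial^2V_{eff}}{\partial v^2}:=\frac{d^2}{dt^2}\big|_{t=0}V_{eff}(v+t,u)>0$. In $(\ast)$, $R,F_1,F_3,T$ enter only through $a=2R-|F_1|^2$ and $b=|F_3|^2-2T$, which are treated as unknown functions ($R$ is not required to be the scalar curvature of $g$). Then, for every sufficiently large real number $s$ the following holds. For every $\varepsilon>0$ there are $\alpha\in(0,\varepsilon)$ and $\beta\in(-\varepsilon,0)$ such that, for all $5$-forms $F_5$ in some neighbourhood of $0$ in $H^s$ and all pairs $(v,u)$ in some neighbourhood of $(1,1)$ in $H^s(M)\times H^s(M)$, there are functions $a,b\in H^{s-2}(M)$ with the following property: for all $R,T,F_1,F_3$, the pair $(v,u)$ is a classical ($C^2$, positive) solution of $(\ast)$ with the data $\alpha,\beta,F_5,R,T,F_1,F_3$ if and only if $2R-|F_1|^2=a$ and $|F_3|^2-2T=b$; and whenever this is the case, this solution is stable. -/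

import Mathlib

open Set Filter Topology MeasureTheory
open scoped Manifold ContDiff FourierTransform

noncomputable section

namespace Warped

/-- The model space of the six-dimensional internal manifold. -/
abbrev E6 : Type := EuclideanSpace ℝ (Fin 6)

/-! ### Sobolev spaces -/

/-- The `H^s(ℝ⁶)` norm `(∫ (1 + |ξ|²)^s |ĥ(ξ)|² dξ)^{1/2}` (possibly `∞`) of an integrable
function `h`. -/
def hsNorm (s : ℝ) (h : E6 → ℝ) : ENNReal :=
  (∫⁻ ξ : E6, ENNReal.ofReal ((1 + ‖ξ‖ ^ 2) ^ s) * ‖𝓕 (fun y : E6 => (h y : ℂ)) ξ‖ₑ ^ 2)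
    ^ (1 / 2 : ℝ)

section Manifold

variable {M : Type*} [TopologicalSpace M] [ChartedSpace E6 M]

/-- The smooth cutoff functions supported in the domain of the chart `φ`. -/
def Cutoff (φ : OpenPartialHomeomorph M E6) : Set (M → ℝ) :=
  {χ | ContMDiff (𝓡 6) 𝓘(ℝ, ℝ) ∞ χ ∧ tsupport χ ⊆ φ.source}

/-- The `H^s` norm of a function `h` given in the coordinates of the chart `φ` (so `h` matters
only on `φ.target`), localized by the cutoff `χ` and extended by zero to `ℝ⁶`. -/
def locNorm (s : ℝ) (φ : OpenPartialHomeomorph M E6) (χ : M → ℝ) (h : E6 → ℝ) : ENNReal :=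
  hsNorm s (φ.target.indicator fun y => χ (φ.symm y) * h y)

/-- `f ∈ H^s(M)`. This is used only for large `s` (larger than half the dimension), where every
class in `H^s` has exactly one continuous representative; `f` is that representative. -/
def MemHs (s : ℝ) (f : M → ℝ) : Prop :=
  Continuous f ∧ ∀ φ ∈ atlas E6 M, ∀ χ ∈ Cutoff φ, locNorm s φ χ (fun y => f (φ.symm y)) < ⊤

/-- The filter of neighbourhoods of `f₀` in `H^s(M)`: its basic members are cut out, within
`H^s(M)`, by finitely many conditions `‖χ (f - f₀)‖_{H^s} < ε`. -/
def hsNhds (s : ℝ) (f₀ : M → ℝ) : Filter (M → ℝ) :=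
  (⨅ φ ∈ atlas E6 M, ⨅ χ ∈ Cutoff φ, ⨅ ε ∈ {ε : ENNReal | 0 < ε},
    𝓟 {f | locNorm s φ χ (fun y => f (φ.symm y) - f₀ (φ.symm y)) < ε}) ⊓ 𝓟 {f | MemHs s f}

/-! ### Coordinates and differential forms -/

/-- The coordinate vector `∂_i` of the chart `φ`, at the point with coordinates `y`. -/
def coordVec (φ : OpenPartialHomeomorph M E6) (y : E6) (i : Fin 6) :
    TangentSpace (𝓡 6) (φ.symm y) :=
  mfderiv 𝓘(ℝ, E6) (𝓡 6) φ.symm y (EuclideanSpace.single i (1 : ℝ))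

variable (M) in
/-- Differential `p`-forms on `M` (no regularity). -/
abbrev Form (p : ℕ) : Type _ := ∀ x : M, (TangentSpace (𝓡 6) x) [⋀^Fin p]→ₗ[ℝ] ℝ

/-- The component `F_{i₁ … i_p}` of a form in the chart `φ`. -/
def Form.comp {p : ℕ} (F : Form M p) (φ : OpenPartialHomeomorph M E6) (i : Fin p → Fin 6)
    (y : E6) : ℝ :=
  F (φ.symm y) fun k => coordVec φ y (i k)

/-- `F` is a `p`-form of class `H^s` (continuous representative, as for functions). -/
def Form.MemHs {p : ℕ} (s : ℝ) (F : Form M p) : Prop :=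
  ∀ φ ∈ atlas E6 M, ∀ i : Fin p → Fin 6,
    ContinuousOn (F.comp φ i) φ.target ∧ ∀ χ ∈ Cutoff φ, locNorm s φ χ (F.comp φ i) < ⊤

variable (M) in
/-- The filter of neighbourhoods of `0` in the space of `p`-forms of class `H^s`. -/
def formNhdsZero (p : ℕ) (s : ℝ) : Filter (Form M p) :=
  (⨅ φ ∈ atlas E6 M, ⨅ χ ∈ Cutoff φ, ⨅ i : Fin p → Fin 6, ⨅ ε ∈ {ε : ENNReal | 0 < ε},
    𝓟 {F : Form M p | locNorm s φ χ (F.comp φ i) < ε}) ⊓ 𝓟 {F | F.MemHs s}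

/-! ### Riemannian geometry -/

variable [IsManifold (𝓡 6) ∞ M]

variable (M) in
/-- Smooth Riemannian metrics on `M`. -/
abbrev Metric6 : Type _ :=
  Bundle.ContMDiffRiemannianMetric (𝓡 6) ∞ E6 (fun x : M => TangentSpace (𝓡 6) x)

variable (g : Metric6 M)

/-- The matrix `g_{ij}` in the chart `φ`. -/
def gMat (φ : OpenPartialHomeomorph M E6) (y : E6) : Matrix (Fin 6) (Fin 6) ℝ :=
  Matrix.of fun i j => g.inner (φ.symm y) (coordVec φ y i) (coordVec φ y j)

/-- The Riemannian density `√(det g_{ij})` in the chart `φ`. -/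
def gDensity (φ : OpenPartialHomeomorph M E6) (y : E6) : ℝ := √(gMat g φ y).det

/-- The coordinate partial derivative `∂_i h`. -/
def pd (i : Fin 6) (h : E6 → ℝ) (y : E6) : ℝ := fderiv ℝ h y (EuclideanSpace.single i (1 : ℝ))

/-- `∇u · ∇w = g^{ij} ∂_i u ∂_j w`. -/
def gradDot (u w : M → ℝ) (x : M) : ℝ :=
  let φ := chartAt E6 x
  ∑ i, ∑ j, (gMat g φ (φ x))⁻¹ i j *
    pd i (fun y => u (φ.symm y)) (φ x) * pd j (fun y => w (φ.symm y)) (φ x)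

/-- `∇ · (w ∇u) = (det g)^{-1/2} ∂_i ((det g)^{1/2} w g^{ij} ∂_j u)`. -/
def divGrad (w u : M → ℝ) (x : M) : ℝ :=
  let φ := chartAt E6 x
  (gDensity g φ (φ x))⁻¹ * ∑ i, pd i (fun y => gDensity g φ y * w (φ.symm y) *
    ∑ j, (gMat g φ y)⁻¹ i j * pd j (fun z => u (φ.symm z)) y) (φ x)

/-- The Laplace–Beltrami operator `Δu = ∇ · ∇u`. -/
def laplace (u : M → ℝ) (x : M) : ℝ := divGrad g (fun _ => 1) u x

/-- `|F|² = (1/p!) g^{i₁j₁} ⋯ g^{i_pj_p} F_{i₁…i_p} F_{j₁…j_p}`. -/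
def Form.normSq {p : ℕ} (F : Form M p) (x : M) : ℝ :=
  let φ := chartAt E6 x
  (p.factorial : ℝ)⁻¹ * ∑ i : Fin p → Fin 6, ∑ j : Fin p → Fin 6,
    (∏ k, (gMat g φ (φ x))⁻¹ (i k) (j k)) * F.comp φ i (φ x) * F.comp φ j (φ x)

variable [T2Space M] [CompactSpace M]

variable (M) in
/-- A smooth partition of unity, indexed by the points of `M`, subordinate to the chart domains. -/
def chartPartition : SmoothPartitionOfUnity M (𝓡 6) M univ :=
  (SmoothPartitionOfUnity.exists_isSubordinate_chartAt_source (𝓡 6) M).choose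

variable [MeasurableSpace M] [BorelSpace M]

/-- The Riemannian volume measure: `∫ f = ∑_c ∫ (ρ_c f) √(det g_{ij}) dy`, each summand computed in
the chart at `c`, for the partition of unity `ρ`. -/
def vol : Measure M :=
  Measure.sum fun c : M =>
    (((volume : Measure E6).restrict (chartAt E6 c).target).withDensity fun y =>
      ENNReal.ofReal (chartPartition M c ((chartAt E6 c).symm y) *
        gDensity g (chartAt E6 c) y)).map (chartAt E6 c).symm

end Manifold

/-! ### The effective potential -/

section Potential

variable {M : Type*} [TopologicalSpace M] [ChartedSpace E6 M]

variable (M) in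
/-- The data entering the effective potential: the curvature term `R`, the field strengths `F_p`
(`p`-forms), the string term `T_string`, the Lagrange multipliers `α`, `β`, the integer `q`, and
Newton's constant. The manifold being six-dimensional, `F_p = 0` for `p > 6`. -/
structure FieldData where
  R : M → ℝ
  F : ∀ p : ℕ, Form M p
  T : M → ℝ
  α : ℝ
  β : ℝ
  q : ℤ
  GN : ℝ

variable [IsManifold (𝓡 6) ∞ M]

/-- The system of the equations of motion for the conformal factor `v = e^{2B}` and the warp factor
`u = e^{2A}`, in the classical sense. -/
structure IsSolution (g : Metric6 M) (D : FieldData M) (v u : M → ℝ) : Prop where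
  contDiff_v : ContMDiff (𝓡 6) 𝓘(ℝ, ℝ) 2 v
  contDiff_u : ContMDiff (𝓡 6) 𝓘(ℝ, ℝ) 2 u
  v_pos : ∀ x, 0 < v x
  u_pos : ∀ x, 0 < u x
  eq_u : ∀ x,
    10 * u x * v x * laplace g v x + 6 * divGrad g (fun z => v z ^ 2) u x
      - 2 * u x * v x ^ 2 * D.R x
      + u x * ∑ p ∈ Finset.range 7, v x ^ (3 - (p : ℤ)) * (D.F p).normSq g x
      - 2 * u x * v x ^ (((D.q : ℝ) - 3) / 2) * D.T x
    = 2 * D.α * v x ^ 3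
  eq_v : ∀ x,
    5 * laplace g (fun z => u z ^ 2 * v z) x + 5 * u x ^ 2 * laplace g v x
      - 2 * u x ^ 2 * v x * D.R x - 6 * v x * gradDot g u u x
      + u x ^ 2 / 2 * ∑ p ∈ Finset.range 7,
          (3 - (p : ℝ)) * v x ^ (2 - (p : ℤ)) * (D.F p).normSq g x
      - ((D.q : ℝ) - 3) / 2 * u x ^ 2 * v x ^ (((D.q : ℝ) - 5) / 2) * D.T x
    = 6 * (D.α * u x * v x ^ 2 + D.β * v x ^ 2)

variable [T2Space M] [CompactSpace M] [MeasurableSpace M] [BorelSpace M]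

/-- The effective potential `V_eff`. -/
def Veff (g : Metric6 M) (D : FieldData M) (v u : M → ℝ) : ℝ :=
  1 / 2 * ∫ x, (-(u x ^ 2 * v x ^ 2 * D.R x)
      - 5 * gradDot g v (fun z => u z ^ 2 * v z) x
      - 3 * v x ^ 2 * gradDot g u u x
      + u x ^ 2 / 2 * ∑ p ∈ Finset.range 7, v x ^ (3 - (p : ℤ)) * (D.F p).normSq g x
      - u x ^ 2 * v x ^ (((D.q : ℝ) - 3) / 2) * D.T x) ∂(vol g)
    + D.α * (1 / D.GN - ∫ x, u x * v x ^ 3 ∂(vol g))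
    + D.β * ((vol g).real univ - ∫ x, v x ^ 3 ∂(vol g))

/-- The second variation of `V_eff` with respect to `v`, in the direction `ψ`. -/
def secondVariation (g : Metric6 M) (D : FieldData M) (v u ψ : M → ℝ) : ℝ :=
  iteratedDeriv 2 (fun t : ℝ => Veff g D (fun x => v x + t * ψ x) u) 0

/-- The mass squared `∂²V_eff/∂v²` of the conformal factor. -/
def massSq (g : Metric6 M) (D : FieldData M) (v u : M → ℝ) : ℝ :=
  secondVariation g D v u fun _ => 1

/-- Stable solutions of the equations of motion. -/
def IsStable (g : Metric6 M) (D : FieldData M) (v u : M → ℝ) : Prop :=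
  IsSolution g D v u ∧ 0 < massSq g D v u

/-- The standing assumption of the Type IIB setting: `q = 3` and `F₀ = F₂ = F₄ = F₆ = 0`. -/
def FieldData.IsTypeIIB (D : FieldData M) : Prop :=
  D.q = 3 ∧ D.F 0 = 0 ∧ D.F 2 = 0 ∧ D.F 4 = 0 ∧ D.F 6 = 0

end Potential

end Warped

end

noncomputable section

namespace Warped

/-! ### Fourier analysis on `ℝ⁶` -/

/-! No differential equation has to be solved. With `v`, `u > 0`, `α`, `β`, `F₅` given, the system
is pointwise algebraic and triangular in `a = 2R - |F₁|²` and `b = |F₃|² - 2T`: the second equation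
contains `a` alone, with coefficient `-u²v`, and the first then contains `b` with coefficient `u`.
Dividing gives the unique candidates `curvatureTerm` and `stringTerm`, and `isSolution_iff` is this
division.

Regularity. The candidates are polynomials in `v`, `u`, `1/v`, `1/u`, `|F₅|²`, first derivatives and
Laplacians. They lie in `H^{s-2}` because `H^s` is an algebra for `s > 3` (`hsSq_mul_lt_top`), is
closed under reciprocals for large `s` (`HLoc.inv`), and loses one order per derivative (`HLoc.pd`).
The operators are defined at each point through that point's preferred chart, so their regularity
can be read off only after they are shown to be chart independent (`gradDot_symm`, `divGrad_symm`,
`Form.normSq_symm`); for the divergence this rests on the Piola identity.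

Stability. Differentiating `V_eff(v + t, u)` twice under the integral and inserting the forced value
of `a` cancels the `|∇u|²` terms and leaves the integrand `2u²v⁻⁴|F₅|² - 3v(αu + β) - (5/2)(Δ(u²v) +
u²Δv)/v` (`potentialDensity''_curvatureTerm`). The first term is nonnegative. At `v = u = 1` the
second is `-3(α + β)`, positive for `α = ε/4`, `β = -ε/2`, and the third vanishes. By the Sobolev
embedding `H^s ⊂ C²` and compactness (`eventually_closeAt`), pairs near `(1,1)` keep the last two
terms uniformly close to these values, so the integrand stays at least `ε/4`; the volume of `M` is
finite and positive, hence so is the integral. -/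

/-- The complexified Fourier transform of a real function. -/
abbrev fhat (h : E6 → ℝ) : E6 → ℂ := 𝓕 (fun y : E6 => (h y : ℂ))

/-- The square of the `H^s` norm. -/
def hsSq (s : ℝ) (h : E6 → ℝ) : ENNReal :=
  ∫⁻ ξ : E6, ENNReal.ofReal ((1 + ‖ξ‖ ^ 2) ^ s) * ‖fhat h ξ‖ₑ ^ 2

theorem hsNorm_eq (s : ℝ) (h : E6 → ℝ) : hsNorm s h = hsSq s h ^ (1 / 2 : ℝ) := rfl

theorem hsNorm_sq (s : ℝ) (h : E6 → ℝ) : hsNorm s h ^ 2 = hsSq s h := by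
  rw [hsNorm_eq, ← ENNReal.rpow_natCast, ← ENNReal.rpow_mul]
  norm_num

theorem hsNorm_lt_top_iff (s : ℝ) (h : E6 → ℝ) : hsNorm s h < ⊤ ↔ hsSq s h < ⊤ := by
  rw [hsNorm_eq, ENNReal.rpow_lt_top_iff_of_pos (by norm_num)]

theorem hsSq_mono {s t : ℝ} (hst : s ≤ t) (h : E6 → ℝ) : hsSq s h ≤ hsSq t h := by
  refine lintegral_mono fun ξ => ?_
  gcongr
  nlinarith [sq_nonneg ‖ξ‖]

theorem integrable_ofReal {h : E6 → ℝ} (hc : Continuous h) (hs : HasCompactSupport h) :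
    Integrable (fun y => (h y : ℂ)) :=
  (hc.integrable_of_hasCompactSupport hs).ofReal

theorem continuous_fhat {h : E6 → ℝ} (hc : Continuous h) (hs : HasCompactSupport h) :
    Continuous (fhat h) :=
  VectorFourier.fourierIntegral_continuous Real.continuous_fourierChar
    (by exact continuous_inner) (integrable_ofReal hc hs)

theorem fhat_add {h k : E6 → ℝ} (hc : Continuous h) (hs : HasCompactSupport h)
    (kc : Continuous k) (ks : HasCompactSupport k) (ξ : E6) :
    fhat (fun y => h y + k y) ξ = fhat h ξ + fhat k ξ := by
  have := congrFun (VectorFourier.fourierIntegral_add (μ := volume) (e := Real.fourierChar)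
    (L := innerₗ E6) Real.continuous_fourierChar
    (by exact continuous_inner) (integrable_ofReal hc hs) (integrable_ofReal kc ks)) ξ
  simp only [Pi.add_apply] at this
  rw [fhat, fhat, fhat, Real.fourier_eq, Real.fourier_eq, Real.fourier_eq]
  rw [← integral_add]
  · congr 1; ext v; push_cast; rw [smul_add]
  · exact (Real.fourierIntegral_convergent_iff ξ).2 (integrable_ofReal hc hs)
  · exact (Real.fourierIntegral_convergent_iff ξ).2 (integrable_ofReal kc ks)

theorem hsSq_add_lt_top {s : ℝ} {h k : E6 → ℝ} (hc : Continuous h) (hs : HasCompactSupport h)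
    (kc : Continuous k) (ks : HasCompactSupport k) (hh : hsSq s h < ⊤) (hk : hsSq s k < ⊤) :
    hsSq s (fun y => h y + k y) < ⊤ := by
  have hm : Measurable fun ξ : E6 => ENNReal.ofReal ((1 + ‖ξ‖ ^ 2) ^ s) * ‖fhat h ξ‖ₑ ^ 2 := by
    have := (continuous_fhat hc hs).measurable
    fun_prop
  refine (lintegral_mono fun ξ => ?_ : _ ≤ ∫⁻ ξ : E6,
    (2 * (ENNReal.ofReal ((1 + ‖ξ‖ ^ 2) ^ s) * ‖fhat h ξ‖ₑ ^ 2) +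
      2 * (ENNReal.ofReal ((1 + ‖ξ‖ ^ 2) ^ s) * ‖fhat k ξ‖ₑ ^ 2))).trans_lt ?_
  · have : ‖fhat (fun y => h y + k y) ξ‖ₑ ^ 2 ≤ 2 * ‖fhat h ξ‖ₑ ^ 2 + 2 * ‖fhat k ξ‖ₑ ^ 2 := by
      rw [fhat_add hc hs kc ks]
      simp only [← ofReal_norm]
      rw [← ENNReal.ofReal_pow (by positivity), ← ENNReal.ofReal_pow (by positivity),
        ← ENNReal.ofReal_pow (by positivity),
        show (2 : ENNReal) = ENNReal.ofReal 2 by simp, ← ENNReal.ofReal_mul (by positivity),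
        ← ENNReal.ofReal_mul (by positivity), ← ENNReal.ofReal_add (by positivity) (by positivity)]
      refine ENNReal.ofReal_le_ofReal ?_
      nlinarith [norm_add_le (fhat h ξ) (fhat k ξ), norm_nonneg (fhat h ξ + fhat k ξ),
        sq_nonneg (‖fhat h ξ‖ - ‖fhat k ξ‖), norm_nonneg (fhat h ξ), norm_nonneg (fhat k ξ)]
    refine (mul_le_mul_right this _).trans (le_of_eq ?_)
    ring
  · rw [lintegral_add_left (hm.const_mul 2), lintegral_const_mul' _ _ (by simp),
      lintegral_const_mul' _ _ (by simp)]
    exact ENNReal.add_lt_top.2 ⟨ENNReal.mul_lt_top (by simp) hh, ENNReal.mul_lt_top (by simp) hk⟩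

theorem hsSq_const_mul_lt_top {s : ℝ} {h : E6 → ℝ} (c : ℝ) (hh : hsSq s h < ⊤) :
    hsSq s (fun y => c * h y) < ⊤ := by
  have : ∀ ξ, fhat (fun y => c * h y) ξ = c * fhat h ξ := by
    intro ξ
    rw [fhat, fhat, Real.fourier_eq, Real.fourier_eq, ← integral_const_mul]
    congr 1; ext v; push_cast
    simp only [Circle.smul_def, smul_eq_mul]; ring
  have e : hsSq s (fun y => c * h y) = ‖(c : ℂ)‖ₑ ^ 2 * hsSq s h := by
    rw [hsSq, hsSq, ← lintegral_const_mul' _ _ (by simp)]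
    refine lintegral_congr fun ξ => ?_
    rw [this, enorm_mul]; ring
  rw [e]
  exact ENNReal.mul_lt_top (by simp) hh

/-! ### Cauchy–Schwarz and the Sobolev embeddings on `ℝ⁶`. -/

theorem lintegral_mul_sq_le {f g : E6 → ENNReal} (hf : Measurable f) (hg : Measurable g) :
    (∫⁻ x, f x * g x) ^ 2 ≤ (∫⁻ x, f x ^ 2) * ∫⁻ x, g x ^ 2 := by
  have h := ENNReal.lintegral_mul_le_Lp_mul_Lq (μ := (volume : Measure E6))
    Real.HolderConjugate.two_two hf.aemeasurable hg.aemeasurable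
  have h2 := pow_le_pow_left' h 2
  refine h2.trans (le_of_eq ?_)
  rw [mul_pow, ← ENNReal.rpow_natCast, ← ENNReal.rpow_natCast, ← ENNReal.rpow_mul,
    ← ENNReal.rpow_mul]
  norm_num

/-- The threshold is half the dimension: the integrand decays like `‖ξ‖^(-2r)`, integrable at
infinity in dimension `6` when `2r > 6`. -/
theorem lintegral_japanese_lt_top {r : ℝ} (hr : 3 < r) :
    ∫⁻ ξ : E6, ENNReal.ofReal ((1 + ‖ξ‖ ^ 2) ^ (-r)) < ⊤ := by
  have := (integrable_rpow_neg_one_add_norm_sq (E := E6) (μ := volume) (r := 2 * r)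
    (by simp; linarith)).lintegral_lt_top
  convert this using 5
  ring

/-- Weighted `L¹` bounds for the Fourier transform by the `H^s` norm. -/
theorem lintegral_weight_fhat_sq_le {s k : ℝ} {h : E6 → ℝ} (hc : Continuous h)
    (hs : HasCompactSupport h) :
    (∫⁻ ξ : E6, ENNReal.ofReal ((1 + ‖ξ‖ ^ 2) ^ (k / 2)) * ‖fhat h ξ‖ₑ) ^ 2 ≤
      (∫⁻ ξ : E6, ENNReal.ofReal ((1 + ‖ξ‖ ^ 2) ^ (-(s - k)))) * hsSq s h := by
  have hm := (continuous_fhat hc hs).measurable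
  -- Cauchy–Schwarz after splitting the weight exponent as `k/2 = -(s-k)/2 + s/2`.
  have := lintegral_mul_sq_le (f := fun ξ : E6 => ENNReal.ofReal ((1 + ‖ξ‖ ^ 2) ^ (-(s - k) / 2)))
    (g := fun ξ => ENNReal.ofReal ((1 + ‖ξ‖ ^ 2) ^ (s / 2)) * ‖fhat h ξ‖ₑ)
    (by fun_prop) (by fun_prop)
  refine le_trans (le_of_eq ?_) (this.trans (le_of_eq ?_))
  · congr 1
    refine lintegral_congr fun ξ => ?_
    rw [← mul_assoc, ← ENNReal.ofReal_mul (by positivity), ← Real.rpow_add (by positivity)]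
    congr 3; ring
  · congr 1
    · refine lintegral_congr fun ξ => ?_
      rw [← ENNReal.ofReal_pow (by positivity), ← Real.rpow_mul_natCast (by positivity)]
      congr 2; push_cast; ring
    · refine lintegral_congr fun ξ => ?_
      rw [mul_pow, ← ENNReal.ofReal_pow (by positivity), ← Real.rpow_mul_natCast (by positivity)]
      congr 3; push_cast; ring

theorem lintegral_fhat_sq_le {s : ℝ} {h : E6 → ℝ} (hc : Continuous h)
    (hs : HasCompactSupport h) :
    (∫⁻ ξ : E6, ‖fhat h ξ‖ₑ) ^ 2 ≤
      (∫⁻ ξ : E6, ENNReal.ofReal ((1 + ‖ξ‖ ^ 2) ^ (-s))) * hsSq s h := by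
  have := lintegral_weight_fhat_sq_le (s := s) (k := 0) hc hs
  simpa using this

theorem integrable_fhat {s : ℝ} (h3 : 3 < s) {h : E6 → ℝ} (hc : Continuous h)
    (hs : HasCompactSupport h) (hh : hsSq s h < ⊤) : Integrable (fhat h) := by
  refine ⟨(continuous_fhat hc hs).aestronglyMeasurable, ?_⟩
  have := (lintegral_fhat_sq_le (s := s) hc hs).trans_lt
    (ENNReal.mul_lt_top (lintegral_japanese_lt_top h3) hh)
  by_contra hcon
  simp only [HasFiniteIntegral, not_lt, top_le_iff] at hcon
  simp [hcon] at this

theorem enorm_le_lintegral_fhat {s : ℝ} (h3 : 3 < s) {h : E6 → ℝ} (hc : Continuous h)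
    (hs : HasCompactSupport h) (hh : hsSq s h < ⊤) (y : E6) :
    ‖h y‖ₑ ≤ ∫⁻ ξ : E6, ‖fhat h ξ‖ₑ := by
  have hi := Continuous.fourierInv_fourier_eq (f := fun y => (h y : ℂ)) (by fun_prop)
    (integrable_ofReal hc hs) (integrable_fhat h3 hc hs hh)
  have : ‖h y‖ₑ = ‖(h y : ℂ)‖ₑ := by
    simp [← ofReal_norm]
  rw [this, ← congrFun hi y, Real.fourierInv_eq]
  refine (enorm_integral_le_lintegral_enorm _).trans (le_of_eq ?_)
  refine lintegral_congr fun ξ => ?_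
  rw [← ofReal_norm, ← ofReal_norm, Circle.norm_smul]

/-- The Sobolev embedding `H^s ⊂ C⁰`. -/
theorem enorm_sq_le_hsSq {s : ℝ} (h3 : 3 < s) {h : E6 → ℝ} (hc : Continuous h)
    (hs : HasCompactSupport h) (y : E6) :
    ‖h y‖ₑ ^ 2 ≤ (1 + ∫⁻ ξ : E6, ENNReal.ofReal ((1 + ‖ξ‖ ^ 2) ^ (-s))) * hsSq s h := by
  by_cases hh : hsSq s h < ⊤
  · calc _ ≤ (∫⁻ ξ : E6, ‖fhat h ξ‖ₑ) ^ 2 :=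
        pow_le_pow_left' (enorm_le_lintegral_fhat h3 hc hs hh y) 2
      _ ≤ _ := lintegral_fhat_sq_le hc hs
      _ ≤ _ := by gcongr; exact le_add_self
  -- The summand `1` makes the constant nonzero, so the right side is `⊤` when the `H^s` norm is
  -- infinite.
  · rw [not_lt, top_le_iff] at hh
    rw [hh, ENNReal.mul_top (by simp)]
    exact le_top

/-- The Sobolev embedding `H^s ⊂ C^k`. -/
theorem contDiff_of_hsSq {s : ℝ} {k : ℕ} (h3 : 3 + k < s) {h : E6 → ℝ} (hc : Continuous h)
    (hs : HasCompactSupport h) (hh : hsSq s h < ⊤) : ContDiff ℝ k h := by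
  have hk0 : (0 : ℝ) ≤ k := Nat.cast_nonneg k
  have hi := Continuous.fourierInv_fourier_eq (f := fun y => (h y : ℂ)) (by fun_prop)
    (integrable_ofReal hc hs) (integrable_fhat (by linarith) hc hs hh)
  have hfin : ∫⁻ ξ : E6, ENNReal.ofReal ((1 + ‖ξ‖ ^ 2) ^ ((k : ℝ) / 2)) * ‖fhat h ξ‖ₑ < ⊤ := by
    have := (lintegral_weight_fhat_sq_le (s := s) (k := k) hc hs).trans_lt
      (ENNReal.mul_lt_top (lintegral_japanese_lt_top (by linarith)) hh)
    by_contra hcon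
    simp only [not_lt, top_le_iff] at hcon
    simp [hcon] at this
  -- Integrable moments of `ĥ` up to order `k` make its inverse transform, which is `h`, of class
  -- `C^k`.
  have key : ∀ n : ℕ, (n : ℕ∞) ≤ (k : ℕ∞) → Integrable (fun ξ => ‖ξ‖ ^ n * ‖fhat h ξ‖) := by
    intro n hn
    have hcf := continuous_fhat hc hs
    refine ⟨(by fun_prop : Continuous _).aestronglyMeasurable, ?_⟩
    refine (lintegral_mono fun ξ => ?_).trans_lt hfin
    rw [enorm_mul, enorm_norm]
    gcongr
    rw [← ofReal_norm]
    refine ENNReal.ofReal_le_ofReal ?_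
    rw [norm_pow, norm_norm]
    have hn' : n ≤ k := by exact_mod_cast hn
    calc ‖ξ‖ ^ n = (‖ξ‖ ^ 2) ^ ((n : ℝ) / 2) := by
          rw [← Real.rpow_natCast, ← Real.rpow_natCast, ← Real.rpow_mul (norm_nonneg _)]
          congr 1; push_cast; ring
      _ ≤ (1 + ‖ξ‖ ^ 2) ^ ((n : ℝ) / 2) := by
          refine Real.rpow_le_rpow (by positivity) (by linarith) (by positivity)
      _ ≤ _ := Real.rpow_le_rpow_of_exponent_le (by nlinarith [sq_nonneg ‖ξ‖]) (by gcongr)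
  have h1 : ContDiff ℝ k (𝓕 (fhat h)) := Real.contDiff_fourier (N := k) key
  have h2 : ContDiff ℝ k (fun y => (h y : ℂ)) := by
    rw [← hi]
    have : 𝓕⁻ (fhat h) = fun y => 𝓕 (fhat h) (-y) := by
      ext y; rw [Real.fourierInv_eq_fourier_neg]
    rw [this]
    exact h1.comp contDiff_neg
  exact Complex.reCLM.contDiff.comp h2

/-! ### Derivatives on the Fourier side and the shift of Sobolev order. -/

theorem pd_contDiff {k : ℕ∞ω} {h : E6 → ℝ} (hh : ContDiff ℝ (k + 1) h) (i : Fin 6) :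
    ContDiff ℝ k (pd i h) :=
  (hh.fderiv_right le_rfl).clm_apply contDiff_const

theorem hasCompactSupport_pd {h : E6 → ℝ} (hs : HasCompactSupport h) (i : Fin 6) :
    HasCompactSupport (pd i h) := by
  exact (hs.fderiv ℝ).comp_left (g := fun A : E6 →L[ℝ] ℝ => A (EuclideanSpace.single i 1)) rfl

theorem fhat_pd {h : E6 → ℝ} (hh : ContDiff ℝ 1 h) (hs : HasCompactSupport h) (i : Fin 6)
    (ξ : E6) : fhat (pd i h) ξ = 2 * Real.pi * Complex.I * ξ i * fhat h ξ := by
  have hd : Differentiable ℝ h := hh.differentiable one_ne_zero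
  have hcd : ContDiff ℝ 1 (fun y => (h y : ℂ)) := Complex.ofRealCLM.contDiff.comp hh
  have hcs : HasCompactSupport (fun y => (h y : ℂ)) := hs.comp_left (g := fun t : ℝ => (t : ℂ)) rfl
  have hint : Integrable (fderiv ℝ fun y => (h y : ℂ)) :=
    (hcd.continuous_fderiv one_ne_zero).integrable_of_hasCompactSupport (hcs.fderiv ℝ)
  have e := Real.fourier_fderiv (integrable_ofReal hh.continuous hs)
    (hcd.differentiable one_ne_zero) hint
  have e2 := congrArg (fun A : E6 →L[ℝ] ℂ => A (EuclideanSpace.single i (1 : ℝ))) (congrFun e ξ)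
  rw [Real.fourier_eq, ContinuousLinearMap.integral_apply] at e2
  · rw [fhat, Real.fourier_eq]
    have e3 : ∀ v, ((pd i h v : ℝ) : ℂ) =
        fderiv ℝ (fun y => (h y : ℂ)) v (EuclideanSpace.single i (1 : ℝ)) := by
      intro v
      have : HasFDerivAt (fun y => (h y : ℂ)) (Complex.ofRealCLM.comp (fderiv ℝ h v)) v :=
        Complex.ofRealCLM.hasFDerivAt.comp v (hd v).hasFDerivAt
      rw [this.fderiv]; rfl
    simp only [e3]
    refine Eq.trans ?_ (e2.trans ?_)
    · congr 1
    · have : innerSL ℝ ξ (EuclideanSpace.single i (1 : ℝ)) = ξ i := by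
        rw [innerSL_apply_apply, EuclideanSpace.inner_single_right]
        simp
      simp [VectorFourier.fourierSMulRight_apply, this]
      ring
  · exact (Real.fourierIntegral_convergent_iff ξ).2 hint

/-- An exact identity, from `(1 + ‖ξ‖²)^(s+1) = (1 + ‖ξ‖²)^s (1 + ∑ ξ_i²)` and `(∂_i h)^ = 2πi ξ_i
ĥ`. It lets the order be raised or lowered by one by looking at first derivatives only, also for
non-integral `s`. -/
theorem hsSq_succ (s : ℝ) {h : E6 → ℝ} (hh : ContDiff ℝ 1 h) (hs : HasCompactSupport h) :
    hsSq (s + 1) h = hsSq s h +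
      ∑ i, ENNReal.ofReal ((2 * Real.pi)⁻¹ ^ 2) * hsSq s (pd i h) := by
  have hm := (continuous_fhat hh.continuous hs).measurable
  have hmi := fun i => (continuous_fhat (pd_contDiff (k := 0) (by simpa using hh) i).continuous
    (hasCompactSupport_pd hs i)).measurable
  simp only [hsSq]
  simp_rw [← lintegral_const_mul' _ _ (ENNReal.ofReal_ne_top)]
  rw [← lintegral_finsetSum' _ (fun i _ => by have := hmi i; fun_prop), ← lintegral_add_left (by fun_prop)]
  refine lintegral_congr fun ξ => ?_
  simp only [fhat_pd hh hs, ← ofReal_norm]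
  simp only [← ENNReal.ofReal_pow (norm_nonneg _)]
  simp only [← ENNReal.ofReal_mul (show 0 ≤ (1 + ‖ξ‖ ^ 2) ^ s by positivity),
    ← ENNReal.ofReal_mul (show 0 ≤ (1 + ‖ξ‖ ^ 2) ^ (s + 1) by positivity),
    ← ENNReal.ofReal_mul (show 0 ≤ (2 * Real.pi)⁻¹ ^ 2 by positivity)]
  rw [← ENNReal.ofReal_sum_of_nonneg (fun _ _ => by positivity), ← ENNReal.ofReal_add (by positivity)
    (Finset.sum_nonneg fun _ _ => by positivity)]
  congr 1
  rw [Real.rpow_add_one (by positivity)]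
  simp only [norm_mul, Complex.norm_I, Complex.norm_real, Complex.norm_ofNat, mul_one]
  have : ‖ξ‖ ^ 2 = ∑ i, ‖ξ i‖ ^ 2 := EuclideanSpace.norm_sq_eq ξ
  have e : ∀ i : Fin 6, (2 * Real.pi)⁻¹ ^ 2 * ((1 + ‖ξ‖ ^ 2) ^ s *
      (2 * ‖Real.pi‖ * ‖ξ i‖ * ‖fhat h ξ‖) ^ 2) =
      ((1 + ‖ξ‖ ^ 2) ^ s * ‖fhat h ξ‖ ^ 2) * ‖ξ i‖ ^ 2 := by
    intro i
    rw [Real.norm_of_nonneg Real.pi_pos.le]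
    field_simp
  simp only [e]
  rw [← Finset.mul_sum, ← this]
  ring

theorem hsSq_pd_lt_top {s : ℝ} {h : E6 → ℝ} (hh : ContDiff ℝ 1 h) (hs : HasCompactSupport h)
    (hf : hsSq (s + 1) h < ⊤) (i : Fin 6) : hsSq s (pd i h) < ⊤ := by
  rw [hsSq_succ s hh hs, ENNReal.add_lt_top, ENNReal.sum_lt_top] at hf
  have := hf.2 i (Finset.mem_univ i)
  by_contra hcon
  rw [not_lt, top_le_iff] at hcon
  rw [hcon, ENNReal.mul_top (by rw [Ne, ENNReal.ofReal_eq_zero, not_le]; positivity)] at this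
  exact lt_irrefl _ this

theorem hsSq_pd_le {s : ℝ} {h : E6 → ℝ} (hh : ContDiff ℝ 1 h) (hs : HasCompactSupport h)
    (i : Fin 6) : hsSq s (pd i h) ≤ ENNReal.ofReal ((2 * Real.pi) ^ 2) * hsSq (s + 1) h := by
  rw [hsSq_succ s hh hs]
  calc hsSq s (pd i h) = ENNReal.ofReal ((2 * Real.pi) ^ 2) *
        (ENNReal.ofReal ((2 * Real.pi)⁻¹ ^ 2) * hsSq s (pd i h)) := by
        rw [← mul_assoc, ← ENNReal.ofReal_mul (by positivity), ← mul_pow, mul_inv_cancel₀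
          (by positivity)]
        simp
    _ ≤ _ := by
        gcongr
        refine le_trans ?_ le_add_self
        exact Finset.single_le_sum (f := fun i => ENNReal.ofReal ((2 * Real.pi)⁻¹ ^ 2) *
          hsSq s (pd i h)) (fun _ _ => zero_le) (Finset.mem_univ i)

theorem hsSq_succ_lt_top {s : ℝ} {h : E6 → ℝ} (hh : ContDiff ℝ 1 h) (hs : HasCompactSupport h)
    (hf : hsSq s h < ⊤) (hd : ∀ i, hsSq s (pd i h) < ⊤) : hsSq (s + 1) h < ⊤ := by
  rw [hsSq_succ s hh hs]
  exact ENNReal.add_lt_top.2 ⟨hf, ENNReal.sum_lt_top.2 fun i _ =>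
    ENNReal.mul_lt_top ENNReal.ofReal_lt_top (hd i)⟩

/-- The transform is bounded by the `L¹` norm, and `(1 + ‖ξ‖²)^(-4)` is integrable because `4 > 3`.
This starts the induction below. -/
theorem hsSq_neg_four_lt_top (h : E6 → ℝ) :
    hsSq (-4) h < ⊤ := by
  set C := ∫ y, ‖(h y : ℂ)‖
  refine (lintegral_mono fun ξ => ?_ : _ ≤ ∫⁻ ξ : E6,
    ENNReal.ofReal ((1 + ‖ξ‖ ^ 2) ^ (-4 : ℝ)) * ENNReal.ofReal C ^ 2).trans_lt ?_
  · gcongr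
    rw [← ofReal_norm]
    exact ENNReal.ofReal_le_ofReal (VectorFourier.norm_fourierIntegral_le_integral_norm _ _ _ _ _)
  · rw [lintegral_mul_const' _ _ (by simp)]
    exact ENNReal.mul_lt_top (lintegral_japanese_lt_top (by norm_num)) (by simp)

/-- Each derivative gains one order over the starting value `-4`. The loss of four orders is
harmless: it is applied to smooth functions and to the start of a bootstrap. -/
theorem hsSq_lt_top_of_contDiff {k : ℕ} {h : E6 → ℝ} (hh : ContDiff ℝ k h)
    (hs : HasCompactSupport h) : hsSq (-4 + k) h < ⊤ := by
  induction k generalizing h with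
  | zero => simpa using hsSq_neg_four_lt_top h
  | succ k ih =>
    have h1 : ContDiff ℝ 1 h := hh.of_le (by norm_cast; omega)
    push_cast
    rw [← add_assoc]
    refine hsSq_succ_lt_top h1 hs (ih (hh.of_le (by norm_cast; omega)) hs) fun i => ?_
    exact ih (pd_contDiff (by exact_mod_cast hh) i) (hasCompactSupport_pd hs i)

/-! ### Products in `H^s`. -/

/-- The Fourier transform of a product is dominated by the convolution of the transforms. -/
theorem enorm_fhat_mul_le {s : ℝ} (h3 : 3 < s) {h k : E6 → ℝ} (hc : Continuous h)
    (hs : HasCompactSupport h) (kc : Continuous k) (ks : HasCompactSupport k)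
    (hh : hsSq s h < ⊤) (ξ : E6) :
    ‖fhat (fun y => h y * k y) ξ‖ₑ ≤ ∫⁻ η, ‖fhat h η‖ₑ * ‖fhat k (ξ - η)‖ₑ := by
  have hI := integrable_fhat h3 hc hs hh
  have kI := integrable_ofReal kc ks
  have hi := Continuous.fourierInv_fourier_eq (f := fun y => (h y : ℂ)) (by fun_prop)
    (integrable_ofReal hc hs) hI
  have hc' := continuous_fhat hc hs
  have e : fhat (fun y => h y * k y) ξ = ∫ η, fhat h η * fhat k (ξ - η) := by
    -- Fourier inversion writes `h v` as an integral over `η`; the character then combines to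
    -- frequency `ξ - η`, and Fubini finishes.
    have e1 : ∀ v : E6, Real.fourierChar (-inner ℝ v ξ) • ((h v * k v : ℝ) : ℂ) =
        ∫ η, Real.fourierChar (-inner ℝ v (ξ - η)) • (fhat h η * (k v : ℂ)) := by
      intro v
      have := congrFun hi v
      rw [Real.fourierInv_eq] at this
      rw [Complex.ofReal_mul, ← this, ← integral_mul_const, Circle.smul_def, smul_eq_mul,
        ← integral_const_mul]
      refine integral_congr_ae (Eventually.of_forall fun η => ?_)
      have hχ : Real.fourierChar (-inner ℝ v (ξ - η)) =
          Real.fourierChar (-inner ℝ v ξ) * Real.fourierChar (inner ℝ η v) := by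
        rw [← AddChar.map_add_eq_mul, inner_sub_right, real_inner_comm v η]
        congr 1; ring
      simp only [hχ, Circle.smul_def, Circle.coe_mul, smul_eq_mul]
      ring
    rw [fhat, Real.fourier_eq]
    simp only [e1]
    rw [integral_integral_swap]
    · refine integral_congr_ae (Eventually.of_forall fun η => ?_)
      simp only
      rw [fhat, fhat, Real.fourier_eq _ (ξ - η), ← integral_const_mul]
      refine integral_congr_ae (Eventually.of_forall fun v => ?_)
      simp only [Circle.smul_def, smul_eq_mul]
      ring
    · refine (kI.mul_prod hI).mono ?_ (Eventually.of_forall fun p => ?_)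
      · have : Continuous fun p : E6 × E6 =>
            Real.fourierChar (-inner ℝ p.1 (ξ - p.2)) • (fhat h p.2 * (k p.1 : ℂ)) := by
          have := Real.continuous_fourierChar
          fun_prop
        exact this.aestronglyMeasurable
      · simp only [Function.uncurry, Circle.norm_smul]
        rw [mul_comm]
  rw [e]
  refine (enorm_integral_le_lintegral_enorm _).trans (le_of_eq ?_)
  simp only [enorm_mul]

/-- Young's inequality `‖F * G‖₂ ≤ ‖F‖₁ ‖G‖₂`. -/
theorem lintegral_conv_sq_le {F G : E6 → ENNReal} (hF : Measurable F) (hG : Measurable G) :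
    ∫⁻ ξ, (∫⁻ η, F η * G (ξ - η)) ^ 2 ≤ (∫⁻ η, F η) ^ 2 * ∫⁻ η, G η ^ 2 := by
  -- Cauchy–Schwarz with `F G = F^(1/2) · (F^(1/2) G)`.
  have key : ∀ ξ, (∫⁻ η, F η * G (ξ - η)) ^ 2 ≤ (∫⁻ η, F η) * ∫⁻ η, F η * G (ξ - η) ^ 2 := by
    intro ξ
    have sq : ∀ x : ENNReal, x ^ (1 / 2 : ℝ) * x ^ (1 / 2 : ℝ) = x := by
      intro x
      rw [← ENNReal.rpow_add_of_nonneg _ _ (by norm_num) (by norm_num)]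
      norm_num
    have := lintegral_mul_sq_le (f := fun η => F η ^ (1 / 2 : ℝ))
      (g := fun η => F η ^ (1 / 2 : ℝ) * G (ξ - η)) (by fun_prop) (by fun_prop)
    simp only [← mul_assoc, mul_pow, pow_two (_ ^ (1 / 2 : ℝ)), sq] at this
    exact this
  calc _ ≤ ∫⁻ ξ, (∫⁻ η, F η) * ∫⁻ η, F η * G (ξ - η) ^ 2 := lintegral_mono key
    _ = (∫⁻ η, F η) * ∫⁻ ξ, ∫⁻ η, F η * G (ξ - η) ^ 2 :=
        lintegral_const_mul _ (by fun_prop)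
    _ = (∫⁻ η, F η) * ∫⁻ η, ∫⁻ ξ, F η * G (ξ - η) ^ 2 := by
        rw [lintegral_lintegral_swap]
        exact Measurable.aemeasurable (by unfold Function.uncurry; fun_prop)
    _ = (∫⁻ η, F η) * ∫⁻ η, F η * ∫⁻ ξ, G ξ ^ 2 := by
        congr 1
        refine lintegral_congr fun η => ?_
        rw [lintegral_const_mul _ (by fun_prop),
          lintegral_sub_right_eq_self (fun ξ => G ξ ^ 2) η]
    _ = _ := by rw [lintegral_mul_const _ hF]; ring

/-- The larger of `‖η‖` and `‖ξ - η‖` is at least `‖ξ‖ / 2`, so its weight alone, up to the factor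
`4^(s/2)`, dominates. This distributes the weight over the two factors of a convolution. -/
theorem japanese_le {s : ℝ} (h0 : 0 ≤ s) (ξ η : E6) :
    (1 + ‖ξ‖ ^ 2) ^ (s / 2) ≤
      4 ^ (s / 2) * ((1 + ‖η‖ ^ 2) ^ (s / 2) + (1 + ‖ξ - η‖ ^ 2) ^ (s / 2)) := by
  have h1 : ‖ξ‖ ≤ ‖η‖ + ‖ξ - η‖ := by simpa using norm_add_le η (ξ - η)
  have h2 : ‖ξ‖ ^ 2 ≤ 2 * ‖η‖ ^ 2 + 2 * ‖ξ - η‖ ^ 2 := by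
    nlinarith [norm_nonneg ξ, norm_nonneg η, norm_nonneg (ξ - η), sq_nonneg (‖η‖ - ‖ξ - η‖)]
  have hs : 0 ≤ s / 2 := by positivity
  have pa : 0 ≤ (1 + ‖η‖ ^ 2) ^ (s / 2) := by positivity
  have pb : 0 ≤ (1 + ‖ξ - η‖ ^ 2) ^ (s / 2) := by positivity
  rcases le_total ‖η‖ ‖ξ - η‖ with hle | hle
  · have : ‖η‖ ^ 2 ≤ ‖ξ - η‖ ^ 2 := by gcongr
    calc (1 + ‖ξ‖ ^ 2) ^ (s / 2) ≤ (4 * (1 + ‖ξ - η‖ ^ 2)) ^ (s / 2) :=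
          Real.rpow_le_rpow (by positivity) (by linarith) hs
      _ = 4 ^ (s / 2) * (1 + ‖ξ - η‖ ^ 2) ^ (s / 2) := Real.mul_rpow (by norm_num) (by positivity)
      _ ≤ _ := by gcongr; linarith
  · have : ‖ξ - η‖ ^ 2 ≤ ‖η‖ ^ 2 := by gcongr
    calc (1 + ‖ξ‖ ^ 2) ^ (s / 2) ≤ (4 * (1 + ‖η‖ ^ 2)) ^ (s / 2) :=
          Real.rpow_le_rpow (by positivity) (by linarith) hs
      _ = 4 ^ (s / 2) * (1 + ‖η‖ ^ 2) ^ (s / 2) := Real.mul_rpow (by norm_num) (by positivity)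
      _ ≤ _ := by gcongr; linarith

theorem ENNReal_add_sq_le (a b : ENNReal) : (a + b) ^ 2 ≤ 2 * a ^ 2 + 2 * b ^ 2 := by
  have := ENNReal.rpow_add_le_mul_rpow_add_rpow a b (p := 2) (by norm_num)
  norm_num [mul_add] at this
  exact this

/-- `H^s` is closed under products for `s > 3`. -/
theorem hsSq_mul_lt_top {s : ℝ} (h3 : 3 < s) {h k : E6 → ℝ} (hc : Continuous h)
    (hs : HasCompactSupport h) (kc : Continuous k) (ks : HasCompactSupport k)
    (hh : hsSq s h < ⊤) (hk : hsSq s k < ⊤) : hsSq s (fun y => h y * k y) < ⊤ := by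
  have hm := (continuous_fhat hc hs).measurable
  have km := (continuous_fhat kc ks).measurable
  set w : E6 → ENNReal := fun ξ => ENNReal.ofReal ((1 + ‖ξ‖ ^ 2) ^ (s / 2)) with hw
  have wm : Measurable w := by fun_prop
  set C : ENNReal := ENNReal.ofReal (4 ^ (s / 2))
  have wsq : ∀ (f : E6 → ℝ), ∫⁻ ξ, (w ξ * ‖fhat f ξ‖ₑ) ^ 2 = hsSq s f := by
    intro f
    refine lintegral_congr fun ξ => ?_
    rw [mul_pow, hw, ← ENNReal.ofReal_pow (by positivity), ← Real.rpow_mul_natCast (by positivity)]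
    congr 3; push_cast; ring
  have L1 : ∀ f : E6 → ℝ, Continuous f → HasCompactSupport f → hsSq s f < ⊤ →
      (∫⁻ ξ, ‖fhat f ξ‖ₑ) ^ 2 < ⊤ := fun f fc fs ff =>
    (lintegral_fhat_sq_le (s := s) fc fs).trans_lt
      (ENNReal.mul_lt_top (lintegral_japanese_lt_top h3) ff)
  -- The weighted transform of the product is bounded by two convolutions, each of an unweighted
  -- transform (in `L¹`, as `s > 3`) with a weighted one (in `L²`); Young's inequality applies to
  -- both.
  have pt : ∀ ξ, w ξ * ‖fhat (fun y => h y * k y) ξ‖ₑ ≤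
      C * ((∫⁻ η, ‖fhat k η‖ₑ * (w (ξ - η) * ‖fhat h (ξ - η)‖ₑ)) +
        ∫⁻ η, ‖fhat h η‖ₑ * (w (ξ - η) * ‖fhat k (ξ - η)‖ₑ)) := by
    intro ξ
    have sw : (∫⁻ η, ‖fhat k η‖ₑ * (w (ξ - η) * ‖fhat h (ξ - η)‖ₑ)) =
        ∫⁻ η, ‖fhat k (ξ - η)‖ₑ * (w η * ‖fhat h η‖ₑ) := by
      rw [← lintegral_sub_left_eq_self _ ξ]
      simp
    rw [sw, ← lintegral_add_left (by fun_prop), ← lintegral_const_mul _ (by fun_prop)]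
    refine (mul_le_mul_right (enorm_fhat_mul_le h3 hc hs kc ks hh ξ) _).trans ?_
    rw [← lintegral_const_mul _ (by fun_prop)]
    refine lintegral_mono fun η => ?_
    have : w ξ ≤ C * (w η + w (ξ - η)) := by
      simp only [hw, C]
      rw [← ENNReal.ofReal_add (by positivity) (by positivity), ← ENNReal.ofReal_mul (by positivity)]
      exact ENNReal.ofReal_le_ofReal (japanese_le (by linarith) ξ η)
    refine (mul_le_mul_left this _).trans (le_of_eq ?_)
    ring
  rw [← wsq]
  calc _ ≤ ∫⁻ ξ, C ^ 2 * (2 * (∫⁻ η, ‖fhat k η‖ₑ * (w (ξ - η) * ‖fhat h (ξ - η)‖ₑ)) ^ 2 +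
        2 * (∫⁻ η, ‖fhat h η‖ₑ * (w (ξ - η) * ‖fhat k (ξ - η)‖ₑ)) ^ 2) := by
        refine lintegral_mono fun ξ => (pow_le_pow_left' (pt ξ) 2).trans ?_
        rw [mul_pow]
        gcongr
        exact ENNReal_add_sq_le _ _
    _ = C ^ 2 * (2 * (∫⁻ ξ, (∫⁻ η, ‖fhat k η‖ₑ * (w (ξ - η) * ‖fhat h (ξ - η)‖ₑ)) ^ 2) +
        2 * ∫⁻ ξ, (∫⁻ η, ‖fhat h η‖ₑ * (w (ξ - η) * ‖fhat k (ξ - η)‖ₑ)) ^ 2) := by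
        rw [lintegral_const_mul _ (by fun_prop), lintegral_add_left (by fun_prop),
          lintegral_const_mul _ (by fun_prop), lintegral_const_mul _ (by fun_prop)]
    _ ≤ C ^ 2 * (2 * ((∫⁻ η, ‖fhat k η‖ₑ) ^ 2 * hsSq s h) +
        2 * ((∫⁻ η, ‖fhat h η‖ₑ) ^ 2 * hsSq s k)) := by
        rw [← wsq h, ← wsq k]
        gcongr
        · exact lintegral_conv_sq_le (by fun_prop) (by fun_prop)
        · exact lintegral_conv_sq_le (by fun_prop) (by fun_prop)
    _ < ⊤ := by
        have a1 := L1 k kc ks hk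
        have a2 := L1 h hc hs hh
        refine ENNReal.mul_lt_top (by simp [C]) (ENNReal.add_lt_top.2 ⟨?_, ?_⟩)
        · exact ENNReal.mul_lt_top (by simp) (ENNReal.mul_lt_top a1 hh)
        · exact ENNReal.mul_lt_top (by simp) (ENNReal.mul_lt_top a2 hk)

/-! ### Local Sobolev spaces on open subsets of `ℝ⁶` -/

/-- Test functions on the open set `U`. -/
structure IsTest (U : Set E6) (η : E6 → ℝ) : Prop where
  smooth : ContDiff ℝ ∞ η
  compact : HasCompactSupport η
  subset : tsupport η ⊆ U

theorem IsTest.continuous_mul {U : Set E6} (hU : IsOpen U) {η h : E6 → ℝ} (hη : IsTest U η)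
    (hh : ContinuousOn h U) : Continuous fun y => η y * h y := by
  refine continuous_of_tsupport fun x hx => ?_
  have hxU : x ∈ U := hη.subset (closure_mono (Function.support_mul_subset_left η h) hx)
  exact hη.smooth.continuous.continuousAt.mul (hh.continuousAt (hU.mem_nhds hxU))

theorem IsTest.contDiff_mul {U : Set E6} (hU : IsOpen U) {η h : E6 → ℝ} (hη : IsTest U η)
    {k : ℕ} (hh : ContDiffOn ℝ k h U) : ContDiff ℝ k fun y => η y * h y := by
  refine contDiff_iff_contDiffAt.2 fun x => ?_
  by_cases hx : x ∈ tsupport fun y => η y * h y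
  swap
  · exact contDiffAt_const.congr_of_eventuallyEq (notMem_tsupport_iff_eventuallyEq.1 hx)
  have hxU : x ∈ U := hη.subset (closure_mono (Function.support_mul_subset_left η h) hx)
  exact (hη.smooth.contDiffAt.of_le (mod_cast le_top)).mul (hh.contDiffAt (hU.mem_nhds hxU))

theorem IsTest.compact_mul {U : Set E6} {η : E6 → ℝ} (hη : IsTest U η) (h : E6 → ℝ) :
    HasCompactSupport fun y => η y * h y :=
  hη.compact.mul_right

theorem exists_isTest {U K : Set E6} (hU : IsOpen U) (hK : IsCompact K) (hKU : K ⊆ U) :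
    ∃ η, IsTest U η ∧ ∀ᶠ y in 𝓝ˢ K, η y = 1 := by
  obtain ⟨L, hL, hKL, hLU⟩ := exists_compact_between hK hU hKU
  obtain ⟨f, h1, h0, -⟩ := exists_contMDiffMap_one_nhds_of_subset_interior (n := (⊤ : ℕ∞)) 𝓘(ℝ, E6)
    hK.isClosed hKL
  have hsub : tsupport f ⊆ L :=
    closure_minimal (fun x hx => by_contra fun hxL => hx (h0 x hxL)) hL.isClosed
  exact ⟨f, ⟨f.contMDiff.contDiff, HasCompactSupport.of_support_subset_isCompact hL
    (subset_closure.trans hsub), hsub.trans hLU⟩, h1⟩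

theorem IsTest.pd {U : Set E6} {η : E6 → ℝ} (hη : IsTest U η) (i : Fin 6) :
    IsTest U (pd i η) where
  smooth := pd_contDiff (by simpa using hη.smooth) i
  compact := hasCompactSupport_pd hη.compact i
  subset := by
    refine (closure_mono fun x hx => ?_).trans ((tsupport_fderiv_subset ℝ (f := η)).trans hη.subset)
    intro h0
    exact hx (by simp [Warped.pd, h0])

/-- `h ∈ H^s_loc(U)`, with its continuous representative. -/
structure HLoc (s : ℝ) (U : Set E6) (h : E6 → ℝ) : Prop where
  cont : ContinuousOn h U
  fin : ∀ η, IsTest U η → hsSq s (fun y => η y * h y) < ⊤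

namespace HLoc

variable {s t : ℝ} {U V : Set E6} {h k : E6 → ℝ}

theorem mono (hh : HLoc t U h) (hst : s ≤ t) : HLoc s U h :=
  ⟨hh.cont, fun η hη => (hsSq_mono hst _).trans_lt (hh.fin η hη)⟩

theorem congr (hh : HLoc s U h) (e : EqOn k h U) : HLoc s U k := by
  refine ⟨hh.cont.congr e, fun η hη => ?_⟩
  have : (fun y => η y * k y) = fun y => η y * h y := by
    ext y
    by_cases hy : y ∈ U
    · rw [e hy]
    · rw [image_eq_zero_of_notMem_tsupport fun h => hy (hη.subset h)]; simp
  rw [this]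
  exact hh.fin η hη

theorem of_contDiffOn (hU : IsOpen U) {k : ℕ} (hh : ContDiffOn ℝ k h U) (hs : s ≤ -4 + k) :
    HLoc s U h :=
  ⟨hh.continuousOn, fun _ hη => (hsSq_mono hs _).trans_lt
    (hsSq_lt_top_of_contDiff (hη.contDiff_mul hU hh) (hη.compact_mul _))⟩

theorem of_smooth (hU : IsOpen U) (hh : ContDiffOn ℝ ∞ h U) : HLoc s U h := by
  obtain ⟨k, hk⟩ := exists_nat_ge (s + 4)
  exact of_contDiffOn hU (k := k) (hh.of_le (mod_cast le_top)) (by linarith)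

theorem const (hU : IsOpen U) (c : ℝ) : HLoc s U fun _ => c :=
  of_smooth hU contDiffOn_const

theorem add (hU : IsOpen U) (hh : HLoc s U h) (hk : HLoc s U k) :
    HLoc s U fun y => h y + k y := by
  refine ⟨hh.cont.add hk.cont, fun η hη => ?_⟩
  simp only [mul_add]
  exact hsSq_add_lt_top (hη.continuous_mul hU hh.cont) (hη.compact_mul _)
    (hη.continuous_mul hU hk.cont) (hη.compact_mul _) (hh.fin η hη) (hk.fin η hη)

theorem const_mul (c : ℝ) (hh : HLoc s U h) : HLoc s U fun y => c * h y := by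
  refine ⟨continuousOn_const.mul hh.cont, fun η hη => ?_⟩
  simp only [mul_left_comm _ c]
  exact hsSq_const_mul_lt_top c (hh.fin η hη)

theorem sum (hU : IsOpen U) {ι : Type*} (S : Finset ι) {f : ι → E6 → ℝ}
    (hf : ∀ i ∈ S, HLoc s U (f i)) : HLoc s U fun y => ∑ i ∈ S, f i y := by
  classical
  induction S using Finset.induction_on with
  | empty => simpa using const hU 0
  | insert a S ha ih =>
    simp only [Finset.sum_insert ha]
    exact add hU (hf a (by simp)) (ih fun i hi => hf i (by simp [hi]))

theorem mul (hU : IsOpen U) (h3 : 3 < s) (hh : HLoc s U h) (hk : HLoc s U k) :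
    HLoc s U fun y => h y * k y := by
  refine ⟨hh.cont.mul hk.cont, fun η hη => ?_⟩
  -- A second cutoff `θ`, equal to `1` on the support of `η`, localizes the other factor: `η h k =
  -- (η h)(θ k)`.
  obtain ⟨θ, hθ, hθ1⟩ := exists_isTest hU hη.compact hη.subset
  have e : (fun y => η y * (h y * k y)) = fun y => (η y * h y) * (θ y * k y) := by
    ext y
    by_cases hy : y ∈ tsupport η
    · rw [hθ1.self_of_nhdsSet y hy]; ring
    · rw [image_eq_zero_of_notMem_tsupport hy]; ring
  rw [e]
  exact hsSq_mul_lt_top h3 (hη.continuous_mul hU hh.cont) (hη.compact_mul _)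
    (hθ.continuous_mul hU hk.cont) (hθ.compact_mul _) (hh.fin η hη) (hk.fin θ hθ)

theorem prod (hU : IsOpen U) (h3 : 3 < s) {ι : Type*} (S : Finset ι) {f : ι → E6 → ℝ}
    (hf : ∀ i ∈ S, HLoc s U (f i)) : HLoc s U fun y => ∏ i ∈ S, f i y := by
  classical
  induction S using Finset.induction_on with
  | empty => simpa using const hU 1
  | insert a S ha ih =>
    simp only [Finset.prod_insert ha]
    exact mul hU h3 (hf a (by simp)) (ih fun i hi => hf i (by simp [hi]))

theorem contDiffOn (hU : IsOpen U) {n : ℕ} (hn : 3 + n < s) (hh : HLoc s U h) :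
    ContDiffOn ℝ n h U := by
  intro x hx
  obtain ⟨η, hη, hη1⟩ := exists_isTest hU (isCompact_singleton (x := x)) (by simpa using hx)
  rw [nhdsSet_singleton] at hη1
  have : ContDiff ℝ n fun y => η y * h y := contDiff_of_hsSq hn (hη.continuous_mul hU hh.cont)
    (hη.compact_mul _) (hh.fin η hη)
  refine (this.contDiffAt.congr_of_eventuallyEq ?_).contDiffWithinAt
  filter_upwards [hη1] with y hy
  rw [hy, one_mul]

end HLoc

/-! ### Calculus rules for coordinate derivatives, and derivatives and reciprocals in `H^s_loc`. -/

theorem pd_mul {f g : E6 → ℝ} {x : E6} (hf : DifferentiableAt ℝ f x)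
    (hg : DifferentiableAt ℝ g x) (i : Fin 6) :
    pd i (fun y => f y * g y) x = pd i f x * g x + f x * pd i g x := by
  have := (hf.hasFDerivAt.mul hg.hasFDerivAt).fderiv
  simp only [pd]
  rw [show (fun y => f y * g y) = f * g from rfl, this]
  simp; ring

theorem pd_add {f g : E6 → ℝ} {x : E6} (hf : DifferentiableAt ℝ f x)
    (hg : DifferentiableAt ℝ g x) (i : Fin 6) :
    pd i (fun y => f y + g y) x = pd i f x + pd i g x := by
  simp only [pd, fderiv_fun_add hf hg]
  rfl

theorem pd_congr {f g : E6 → ℝ} {x : E6} (e : f =ᶠ[𝓝 x] g) (i : Fin 6) : pd i f x = pd i g x := by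
  simp only [pd, e.fderiv_eq]

theorem pd_sum {ι : Type*} (S : Finset ι) {f : ι → E6 → ℝ} {x : E6}
    (hf : ∀ j ∈ S, DifferentiableAt ℝ (f j) x) (i : Fin 6) :
    pd i (fun y => ∑ j ∈ S, f j y) x = ∑ j ∈ S, pd i (f j) x := by
  simp only [pd, fderiv_fun_sum hf]
  simp

theorem pd_const (c : ℝ) (x : E6) (i : Fin 6) : pd i (fun _ => c) x = 0 := by
  simp [pd]

namespace HLoc

variable {s t : ℝ} {U V : Set E6} {h k : E6 → ℝ}

theorem pd (hU : IsOpen U) (hs : 4 < s) (hh : HLoc s U h) (i : Fin 6) :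
    HLoc (s - 1) U (pd i h) := by
  have hC : ContDiffOn ℝ (1 : ℕ) h U := hh.contDiffOn hU (by norm_num; linarith)
  have hcpd : ContinuousOn (Warped.pd i h) U :=
    (hC.continuousOn_fderiv_of_isOpen hU (by simp)).clm_apply continuousOn_const
  refine ⟨hcpd, fun η hη => ?_⟩
  -- Moving the cutoff inside the derivative costs only `(∂_i η) h`, and `∂_i η` is again a test
  -- function.
  have e : (fun y => η y * Warped.pd i h y) =
      fun y => Warped.pd i (fun z => η z * h z) y + (-1) * (Warped.pd i η y * h y) := by
    ext y
    by_cases hy : y ∈ U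
    · rw [pd_mul (hη.smooth.differentiable (by simp) y)
        ((hC.contDiffAt (hU.mem_nhds hy)).differentiableAt (by simp))]
      ring
    · have h0 : ∀ {θ}, IsTest U θ → θ =ᶠ[𝓝 y] 0 := fun hθ =>
        notMem_tsupport_iff_eventuallyEq.1 fun h => hy (hθ.subset h)
      have hz : Warped.pd i (fun z => η z * h z) y = 0 :=
        (pd_congr (g := fun _ => 0) ((h0 hη).mono fun z hz => by simp_all) i).trans
          (pd_const 0 y i)
      rw [hz, (h0 hη).self_of_nhds, (h0 (hη.pd i)).self_of_nhds]
      simp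
  rw [e]
  have c1 := hη.contDiff_mul hU hC
  refine hsSq_add_lt_top (pd_contDiff (k := 0) (by simpa using c1) i).continuous
    (hasCompactSupport_pd (hη.compact_mul _) i)
    (continuous_const.mul ((hη.pd i).continuous_mul hU hh.cont))
    ((hη.pd i).compact_mul _).mul_left ?_ ?_
  · exact hsSq_pd_lt_top (by simpa using c1) (hη.compact_mul _) (by simpa using hh.fin η hη) i
  · exact hsSq_const_mul_lt_top _ (((hh.mono (by linarith : s - 1 ≤ s)).fin _ (hη.pd i)))

theorem succ (hU : IsOpen U) (hC : ContDiffOn ℝ (1 : ℕ) h U) (hh : HLoc s U h)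
    (hd : ∀ i, HLoc s U (Warped.pd i h)) : HLoc (s + 1) U h := by
  refine ⟨hh.cont, fun η hη => ?_⟩
  have c1 := hη.contDiff_mul hU hC
  refine hsSq_succ_lt_top (by simpa using c1) (hη.compact_mul _) (hh.fin η hη) fun i => ?_
  have e : Warped.pd i (fun z => η z * h z) =
      fun y => Warped.pd i η y * h y + η y * Warped.pd i h y := by
    ext y
    by_cases hy : y ∈ U
    · rw [pd_mul (hη.smooth.differentiable (by simp) y)
        ((hC.contDiffAt (hU.mem_nhds hy)).differentiableAt (by simp))]
    · have h0 : ∀ {θ}, IsTest U θ → θ =ᶠ[𝓝 y] 0 := fun hθ =>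
        notMem_tsupport_iff_eventuallyEq.1 fun h => hy (hθ.subset h)
      have hz : Warped.pd i (fun z => η z * h z) y = 0 :=
        (pd_congr (g := fun _ => 0) ((h0 hη).mono fun z hz => by simp_all) i).trans
          (pd_const 0 y i)
      rw [hz, (h0 hη).self_of_nhds, (h0 (hη.pd i)).self_of_nhds]
      simp
  rw [e]
  exact hsSq_add_lt_top ((hη.pd i).continuous_mul hU hh.cont) ((hη.pd i).compact_mul _)
    (hη.continuous_mul hU (hd i).cont) (hη.compact_mul _) (hh.fin _ (hη.pd i)) ((hd i).fin η hη)

/-- `1 / h ∈ H^s_loc` if `h ∈ H^s_loc` has no zeros, by bootstrapping `∂(1/h) = -(1/h)² ∂h`. -/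
theorem inv (hU : IsOpen U) (hs : 11 < s) (hh : HLoc s U h) (h0 : ∀ y ∈ U, h y ≠ 0) :
    HLoc s U fun y => (h y)⁻¹ := by
  -- Since `s > 3 + 8`, `h` is `C⁸`; so is `1/h`, which therefore lies in `H^(8-4) = H⁴`, above the
  -- algebra threshold `3`.
  have hC : ContDiffOn ℝ (8 : ℕ) h U := hh.contDiffOn hU (by norm_num; linarith)
  have hC' : ContDiffOn ℝ (8 : ℕ) (fun y => (h y)⁻¹) U := hC.inv h0
  set n : ℕ := ⌈s - 4⌉₊
  have hn1 : s - 4 ≤ n := Nat.le_ceil _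
  have hn2 : (n : ℝ) < s - 4 + 1 := Nat.ceil_lt_add_one (by linarith)
  have base : HLoc 4 U fun y => (h y)⁻¹ := of_contDiffOn hU hC' (by norm_num)
  -- With `n = ⌈s - 4⌉` the starting order `s - n` lies in `(3, 4]`, so every stage is an algebra
  -- and `n` unit steps end exactly at `s`.
  have step : ∀ j : ℕ, j ≤ n → HLoc (s - n + j) U fun y => (h y)⁻¹ := by
    intro j
    induction j with
    | zero => exact fun _ => base.mono (by push_cast; linarith)
    | succ j ih =>
      intro hj
      have ihj := ih (by omega)
      have hjn : (j : ℝ) + 1 ≤ n := by exact_mod_cast hj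
      have hj0 : (0 : ℝ) ≤ j := Nat.cast_nonneg j
      have h3 : 3 < s - n + j := by linarith
      push_cast
      rw [← add_assoc]
      refine succ hU (hC'.of_le (by norm_num)) ihj fun i => ?_
      refine HLoc.congr (h := fun y => (-1) * (((h y)⁻¹ * (h y)⁻¹) * Warped.pd i h y)) ?_ ?_
      · refine const_mul _ (mul hU h3 (mul hU h3 ihj ihj) ?_)
        exact (hh.pd hU (by linarith) i).mono (by linarith)
      · intro y hy
        have hd := ((hC.contDiffAt (hU.mem_nhds hy)).differentiableAt (by simp)).hasFDerivAt
        have : HasFDerivAt (fun y => (h y)⁻¹) (-(h y ^ 2)⁻¹ • fderiv ℝ h y) y :=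
          (hasDerivAt_inv (h0 y hy)).comp_hasFDerivAt y hd
        simp only [Warped.pd, this.fderiv, smul_apply, smul_eq_mul]
        ring
  have := step n le_rfl
  simpa using this

end HLoc

/-! ### Sobolev functions on the manifold in coordinates -/

section Coordinates

variable {M : Type*} [TopologicalSpace M]

theorem locNorm_eq (s : ℝ) (φ : OpenPartialHomeomorph M E6) (χ : M → ℝ) (h : E6 → ℝ) :
    locNorm s φ χ h =
      hsNorm s fun y => φ.target.indicator (fun y => χ (φ.symm y)) y * h y := by
  rw [locNorm]
  congr 1
  ext y
  by_cases hy : y ∈ φ.target <;> simp [hy]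

variable [ChartedSpace E6 M]

theorem continuous_iff_charts {f : M → ℝ} :
    Continuous f ↔ ∀ φ ∈ atlas E6 M, ContinuousOn (fun y => f (φ.symm y)) φ.target := by
  refine ⟨fun h φ _ => h.comp_continuousOn φ.continuousOn_symm, fun h => ?_⟩
  refine continuous_iff_continuousAt.2 fun x => ?_
  have hx := mem_chart_source E6 x
  have h1 : ContinuousAt (fun y => f ((chartAt E6 x).symm y)) (chartAt E6 x x) :=
    (h _ (chart_mem_atlas E6 x)).continuousAt
      ((chartAt E6 x).open_target.mem_nhds ((chartAt E6 x).map_source hx))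
  have h2 : ContinuousAt (fun z => f ((chartAt E6 x).symm (chartAt E6 x z))) x :=
    ContinuousAt.comp (f := chartAt E6 x) (g := fun y => f ((chartAt E6 x).symm y)) h1
      ((chartAt E6 x).continuousAt hx)
  refine h2.congr ?_
  filter_upwards [(chartAt E6 x).open_source.mem_nhds hx] with z hz
  rw [(chartAt E6 x).left_inv hz]

variable [IsManifold (𝓡 6) ∞ M]

theorem contMDiffOn_chart {φ : OpenPartialHomeomorph M E6} (hφ : φ ∈ atlas E6 M) :
    ContMDiffOn (𝓡 6) 𝓘(ℝ, E6) ∞ φ φ.source :=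
  contMDiffOn_of_mem_maximalAtlas (IsManifold.subset_maximalAtlas hφ)

theorem contMDiffOn_chart_symm {φ : OpenPartialHomeomorph M E6} (hφ : φ ∈ atlas E6 M) :
    ContMDiffOn 𝓘(ℝ, E6) (𝓡 6) ∞ φ.symm φ.target :=
  contMDiffOn_symm_of_mem_maximalAtlas (IsManifold.subset_maximalAtlas hφ)

/-- Together with `IsTest.exists_cutoff` this identifies cutoffs on `M` supported in a chart with
test functions on the chart's image, so that `H^s(M)` becomes `H^s_loc` in every chart of the atlas
(`memHs_iff`). -/
theorem Cutoff.isTest [CompactSpace M] {φ : OpenPartialHomeomorph M E6} (hφ : φ ∈ atlas E6 M)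
    {χ : M → ℝ} (hχ : χ ∈ Cutoff φ) :
    IsTest φ.target (φ.target.indicator fun y => χ (φ.symm y)) := by
  have hK : IsCompact (φ '' tsupport χ) :=
    (isClosed_tsupport χ).isCompact.image_of_continuousOn (φ.continuousOn.mono hχ.2)
  have hKt : φ '' tsupport χ ⊆ φ.target := by
    rintro _ ⟨x, hx, rfl⟩
    exact φ.map_source (hχ.2 hx)
  have hsub : tsupport (φ.target.indicator fun y => χ (φ.symm y)) ⊆ φ '' tsupport χ := by
    refine closure_minimal (fun y hy => ?_) hK.isClosed
    rw [Function.mem_support, indicator_apply_ne_zero] at hy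
    exact ⟨φ.symm y, subset_tsupport _ hy.2, φ.right_inv hy.1⟩
  refine ⟨contDiff_iff_contDiffAt.2 fun y => ?_, HasCompactSupport.of_support_subset_isCompact hK
    (subset_closure.trans hsub), hsub.trans hKt⟩
  by_cases hy : y ∈ tsupport (φ.target.indicator fun y => χ (φ.symm y))
  · have hyt := φ.open_target.mem_nhds (hKt (hsub hy))
    have : ContMDiffAt 𝓘(ℝ, E6) 𝓘(ℝ, ℝ) ∞ (fun y => χ (φ.symm y)) y :=
      hχ.1.contMDiffAt.comp y ((contMDiffOn_chart_symm hφ).contMDiffAt hyt)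
    refine this.contDiffAt.congr_of_eventuallyEq ?_
    filter_upwards [hyt] with z hz
    simp [hz]
  · exact contDiffAt_const.congr_of_eventuallyEq (notMem_tsupport_iff_eventuallyEq.1 hy)

theorem IsTest.exists_cutoff [T2Space M] {φ : OpenPartialHomeomorph M E6} (hφ : φ ∈ atlas E6 M)
    {η : E6 → ℝ} (hη : IsTest φ.target η) :
    ∃ χ ∈ Cutoff φ, φ.target.indicator (fun y => χ (φ.symm y)) = η := by
  have hK : IsCompact (φ.symm '' tsupport η) :=
    hη.compact.isCompact.image_of_continuousOn (φ.continuousOn_symm.mono hη.subset)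
  have hKs : φ.symm '' tsupport η ⊆ φ.source := by
    rintro _ ⟨x, hx, rfl⟩
    exact φ.map_target (hη.subset hx)
  have hsub : tsupport (φ.source.indicator fun x => η (φ x)) ⊆ φ.symm '' tsupport η := by
    refine closure_minimal (fun y hy => ?_) hK.isClosed
    rw [Function.mem_support, indicator_apply_ne_zero] at hy
    exact ⟨φ y, subset_tsupport _ hy.2, φ.left_inv hy.1⟩
  refine ⟨φ.source.indicator fun x => η (φ x), ⟨fun x => ?_, hsub.trans hKs⟩, ?_⟩
  · by_cases hx : x ∈ tsupport (φ.source.indicator fun x => η (φ x))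
    · have hxs := φ.open_source.mem_nhds (hKs (hsub hx))
      have : ContMDiffAt (𝓡 6) 𝓘(ℝ, ℝ) ∞ (fun x => η (φ x)) x :=
        hη.smooth.contMDiff.contMDiffAt.comp x ((contMDiffOn_chart hφ).contMDiffAt hxs)
      refine this.congr_of_eventuallyEq ?_
      filter_upwards [hxs] with z hz
      simp [hz]
    · exact contMDiffAt_const.congr_of_eventuallyEq (notMem_tsupport_iff_eventuallyEq.1 hx)
  · ext y
    by_cases hy : y ∈ φ.target
    · simp [hy, φ.map_target hy, φ.right_inv hy]
    · rw [indicator_of_notMem hy, image_eq_zero_of_notMem_tsupport fun h => hy (hη.subset h)]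

theorem hLoc_chart_iff [T2Space M] [CompactSpace M] {φ : OpenPartialHomeomorph M E6}
    (hφ : φ ∈ atlas E6 M) (s : ℝ) (h : E6 → ℝ) :
    HLoc s φ.target h ↔
      ContinuousOn h φ.target ∧ ∀ χ ∈ Cutoff φ, locNorm s φ χ h < ⊤ := by
  refine ⟨fun H => ⟨H.cont, fun χ hχ => ?_⟩, fun H => ⟨H.1, fun η hη => ?_⟩⟩
  · rw [locNorm_eq, hsNorm_lt_top_iff]
    exact H.fin _ (Cutoff.isTest hφ hχ)
  · obtain ⟨χ, hχ, rfl⟩ := hη.exists_cutoff hφ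
    have := H.2 χ hχ
    rwa [locNorm_eq, hsNorm_lt_top_iff] at this

theorem memHs_iff [T2Space M] [CompactSpace M] {s : ℝ} {f : M → ℝ} :
    MemHs s f ↔ ∀ φ ∈ atlas E6 M, HLoc s φ.target fun y => f (φ.symm y) := by
  rw [MemHs, continuous_iff_charts]
  constructor
  · exact fun h φ hφ => (hLoc_chart_iff hφ _ _).2 ⟨h.1 φ hφ, h.2 φ hφ⟩
  · exact fun h => ⟨fun φ hφ => (h φ hφ).cont, fun φ hφ => ((hLoc_chart_iff hφ _ _).1 (h φ hφ)).2⟩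

theorem Form.memHs_iff [T2Space M] [CompactSpace M] {s : ℝ} {p : ℕ} {F : Form M p} :
    F.MemHs s ↔ ∀ φ ∈ atlas E6 M, ∀ i, HLoc s φ.target (F.comp φ i) :=
  forall₂_congr fun _ hφ => forall_congr' fun _ => (hLoc_chart_iff hφ _ _).symm

end Coordinates

section

/-! ### Change of variables: Jacobi's formula and the Piola identity -/

open Matrix

/-- The Jacobian matrix `∂_i τ_k`. -/
def jac (τ : E6 → E6) (y : E6) : Matrix (Fin 6) (Fin 6) ℝ :=
  Matrix.of fun k i => pd i (fun z => τ z k) y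

theorem fderiv_single_eq {τ : E6 → E6} {y : E6} (hτ : DifferentiableAt ℝ τ y) (i : Fin 6) :
    fderiv ℝ τ y (EuclideanSpace.single i 1) =
      ∑ k, jac τ y k i • EuclideanSpace.single k (1 : ℝ) := by
  ext l
  have : HasFDerivAt (fun z => τ z l)
      ((EuclideanSpace.proj l : E6 →L[ℝ] ℝ).comp (fderiv ℝ τ y)) y :=
    (EuclideanSpace.proj l : E6 →L[ℝ] ℝ).hasFDerivAt.comp y hτ.hasFDerivAt
  have e : jac τ y l i = (fderiv ℝ τ y (EuclideanSpace.single i 1)) l := by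
    simp only [jac, of_apply, pd, this.fderiv]
    rfl
  simp [← e, Pi.single_apply]

theorem pd_comp {f : E6 → ℝ} {τ : E6 → E6} {y : E6} (hf : DifferentiableAt ℝ f (τ y))
    (hτ : DifferentiableAt ℝ τ y) (i : Fin 6) :
    pd i (fun z => f (τ z)) y = ∑ k, jac τ y k i * pd k f (τ y) := by
  have h1 : HasFDerivAt (fun z => f (τ z)) ((fderiv ℝ f (τ y)).comp (fderiv ℝ τ y)) y :=
    hf.hasFDerivAt.comp y hτ.hasFDerivAt
  simp only [pd, h1.fderiv, ContinuousLinearMap.comp_apply]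
  rw [fderiv_single_eq hτ, map_sum]
  simp

theorem pd_pd_comm {f : E6 → ℝ} {y : E6} (hf : ContDiffAt ℝ 2 f y) (i j : Fin 6) :
    pd i (pd j f) y = pd j (pd i f) y := by
  have hd : DifferentiableAt ℝ (fderiv ℝ f) y :=
    (hf.fderiv_right (m := 1) (by norm_num)).differentiableAt one_ne_zero
  have e : ∀ i j, pd i (pd j f) y = fderiv ℝ (fderiv ℝ f) y (EuclideanSpace.single i 1)
      (EuclideanSpace.single j 1) := by
    intro i j
    have := (hd.hasFDerivAt.clm_apply (hasFDerivAt_const (EuclideanSpace.single j (1 : ℝ)) y)).fderiv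
    have h2 : pd j f = fun z => fderiv ℝ f z (EuclideanSpace.single j 1) := rfl
    rw [h2, pd, this]
    simp
  rw [e, e]
  exact (hf.isSymmSndFDerivAt (by simp)) _ _

/-- Jacobi's formula: in the Leibniz expansion the derivative hits one column at a time, and the
determinant with that column replaced is a row of the adjugate applied to the new column, by
Cramer's rule. -/
theorem pd_det {A : E6 → Matrix (Fin 6) (Fin 6) ℝ} {y : E6}
    (hA : ∀ k l, DifferentiableAt ℝ (fun z => A z k l) y) (i : Fin 6) :
    pd i (fun z => (A z).det) y =
      ∑ l, ∑ m, (A y).adjugate l m * pd i (fun z => A z m l) y := by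
  have h1 : pd i (fun z => (A z).det) y = ∑ σ : Equiv.Perm (Fin 6), ∑ l,
      (Equiv.Perm.sign σ : ℤ) * ((∏ j ∈ Finset.univ.erase l, A y (σ j) j) *
        pd i (fun z => A z (σ l) l) y) := by
    have hd : HasFDerivAt (fun z => (A z).det) (∑ σ : Equiv.Perm (Fin 6),
        ((Equiv.Perm.sign σ : ℤ) : ℝ) • ∑ l, (∏ j ∈ Finset.univ.erase l, A y (σ j) j) •
          fderiv ℝ (fun z => A z (σ l) l) y) y := by
      simp only [Matrix.det_apply']
      refine HasFDerivAt.fun_sum fun σ _ => ?_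
      exact (HasFDerivAt.finsetProd fun l _ => (hA (σ l) l).hasFDerivAt).const_mul _
    rw [pd, hd.fderiv]
    simp [pd, Finset.mul_sum]
  rw [h1, Finset.sum_comm]
  refine Finset.sum_congr rfl fun l _ => ?_
  have h2 : ∑ m, (A y).adjugate l m * pd i (fun z => A z m l) y =
      ((A y).updateCol l fun m => pd i (fun z => A z m l) y).det := by
    rw [← Matrix.cramer_apply, Matrix.cramer_eq_adjugate_mulVec]
    rfl
  rw [h2, Matrix.det_apply']
  refine Finset.sum_congr rfl fun σ _ => ?_
  congr 1
  rw [← Finset.mul_prod_erase Finset.univ _ (Finset.mem_univ l), mul_comm]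
  congr 1
  · simp
  · refine Finset.prod_congr rfl fun j hj => ?_
    simp [Matrix.updateCol_ne (Finset.ne_of_mem_erase hj)]

theorem differentiableAt_det {A : E6 → Matrix (Fin 6) (Fin 6) ℝ} {y : E6}
    (hA : ∀ k l, DifferentiableAt ℝ (fun z => A z k l) y) :
    DifferentiableAt ℝ (fun z => (A z).det) y := by
  simp only [Matrix.det_apply']
  refine DifferentiableAt.fun_sum fun σ _ => ?_
  exact (HasFDerivAt.finsetProd fun l _ => (hA (σ l) l).hasFDerivAt).differentiableAt.const_mul _

theorem differentiableAt_adjugate {A : E6 → Matrix (Fin 6) (Fin 6) ℝ} {y : E6}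
    (hA : ∀ k l, DifferentiableAt ℝ (fun z => A z k l) y) (k l : Fin 6) :
    DifferentiableAt ℝ (fun z => (A z).adjugate k l) y := by
  simp only [Matrix.adjugate_apply]
  refine differentiableAt_det fun a b => ?_
  by_cases h : a = l
  · subst h; simp
  · simpa [Matrix.updateRow_ne h] using hA a b

/-- The Piola identity: the rows of the cofactor matrix of a Jacobian are divergence free. -/
theorem sum_pd_adjugate_jac {τ : E6 → E6} {y : E6} (hτ : ContDiffAt ℝ 2 τ y)
    (hdet : (jac τ y).det ≠ 0) (k : Fin 6) :
    ∑ i, pd i (fun z => (jac τ z).adjugate i k) y = 0 := by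
  have hcomp : ∀ m, ContDiffAt ℝ 2 (fun z => τ z m) y := fun m =>
    (EuclideanSpace.proj m : E6 →L[ℝ] ℝ).contDiff.contDiffAt.comp y hτ
  have hA : ∀ m l, DifferentiableAt ℝ (fun z => jac τ z m l) y := by
    intro m l
    have : ContDiffAt ℝ 1 (pd l fun z => τ z m) y :=
      ((hcomp m).fderiv_right (m := 1) (by norm_num)).clm_apply contDiffAt_const
    exact this.differentiableAt one_ne_zero
  have hadj := differentiableAt_adjugate hA
  set A := jac τ y with hAdef
  set T : Fin 6 → Matrix (Fin 6) (Fin 6) ℝ :=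
    fun i => Matrix.of fun m l => pd i (fun z => jac τ z m l) y with hT
  set P : Fin 6 → Matrix (Fin 6) (Fin 6) ℝ :=
    fun i => Matrix.of fun m l => pd i (fun z => (jac τ z).adjugate m l) y with hP
  -- Equality of mixed second derivatives of `τ`; the whole identity rests on it.
  have hsymm : ∀ i m l, T i m l = T l m i := fun i m l => pd_pd_comm (hcomp m) i l
  have hdt : ∀ i, pd i (fun z => (jac τ z).det) y = ∑ l, ∑ m, A.adjugate l m * T i m l :=
    fun i => pd_det hA i
  -- Derivative of `A · adj A = det A · 1`, with Jacobi's formula on the right.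
  have hprod : ∀ i, T i * A.adjugate + A * P i =
      (∑ l, ∑ m, A.adjugate l m * T i m l) • (1 : Matrix (Fin 6) (Fin 6) ℝ) := by
    intro i
    ext a b
    have e : (fun z => ∑ c, jac τ z a c * (jac τ z).adjugate c b) =
        fun z => (jac τ z).det * (1 : Matrix (Fin 6) (Fin 6) ℝ) a b := by
      ext z
      have := congrFun (congrFun (Matrix.mul_adjugate (jac τ z)) a) b
      simpa [Matrix.mul_apply] using this
    have e2 := congrArg (fun f => pd i f y) e
    rw [pd_sum _ (f := fun c z => jac τ z a c * (jac τ z).adjugate c b)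
        (fun c _ => (hA a c).mul (hadj c b)),
      pd_mul (differentiableAt_det hA) (differentiableAt_const _), pd_const, hdt] at e2
    simp only [pd_mul (hA _ _) (hadj _ _)] at e2
    simp only [Matrix.add_apply, Matrix.mul_apply, Matrix.smul_apply, smul_eq_mul, hT, hP, of_apply]
    simp only [hT, of_apply, mul_zero, add_zero] at e2
    rw [← e2, Finset.sum_add_distrib]
  have hP2 : ∀ i, A.det * P i i k = (∑ l, ∑ m, A.adjugate l m * T i m l) * A.adjugate i k -
      (A.adjugate * (T i * A.adjugate)) i k := by
    intro i
    have := congrArg (fun B => (A.adjugate * B) i k) (hprod i)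
    simp only [Matrix.mul_add, ← Matrix.mul_assoc A.adjugate A, Matrix.adjugate_mul] at this
    simp only [Matrix.add_apply, Matrix.smul_mul, Matrix.one_mul, Matrix.mul_smul, Matrix.mul_one,
      Matrix.smul_apply, smul_eq_mul] at this
    linarith
  -- After summation over `i` the two terms of `hP2` differ only by exchanging the derivative
  -- indices in `T`, so they cancel; `det A ≠ 0` is then divided out.
  have hsum : A.det * ∑ i, P i i k = 0 := by
    rw [Finset.mul_sum]
    simp only [hP2, Finset.sum_sub_distrib, Matrix.mul_apply, Finset.sum_mul, Finset.mul_sum]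
    rw [sub_eq_zero]
    have e : ∀ i l m, A.adjugate l m * T i m l * A.adjugate i k =
        A.adjugate l m * (T l m i * A.adjugate i k) := fun i l m => by rw [hsymm i m l, mul_assoc]
    simp only [e]
    rw [Finset.sum_comm]
    refine Finset.sum_congr rfl fun l _ => ?_
    rw [Finset.sum_comm]
  exact (mul_eq_zero.1 hsum).resolve_left hdet

/-- The divergence of the Piola transform of a vector field. -/
theorem sum_pd_piola {τ : E6 → E6} {y : E6} (hτ : ContDiffAt ℝ 2 τ y)
    (hdet : (jac τ y).det ≠ 0) {Y : Fin 6 → E6 → ℝ} (hY : ∀ k, DifferentiableAt ℝ (Y k) (τ y)) :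
    ∑ i, pd i (fun z => ∑ k, (jac τ z).adjugate i k * Y k (τ z)) y =
      (jac τ y).det * ∑ k, pd k (Y k) (τ y) := by
  have hcomp : ∀ m, ContDiffAt ℝ 2 (fun z => τ z m) y := fun m =>
    (EuclideanSpace.proj m : E6 →L[ℝ] ℝ).contDiff.contDiffAt.comp y hτ
  have hA : ∀ m l, DifferentiableAt ℝ (fun z => jac τ z m l) y := by
    intro m l
    have : ContDiffAt ℝ 1 (pd l fun z => τ z m) y :=
      ((hcomp m).fderiv_right (m := 1) (by norm_num)).clm_apply contDiffAt_const
    exact this.differentiableAt one_ne_zero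
  have hadj := differentiableAt_adjugate hA
  have hτd : DifferentiableAt ℝ τ y := hτ.differentiableAt (by norm_num)
  have hYτ : ∀ k, DifferentiableAt ℝ (fun z => Y k (τ z)) y := fun k => (hY k).comp y hτd
  have e : ∀ i, pd i (fun z => ∑ k, (jac τ z).adjugate i k * Y k (τ z)) y =
      ∑ k, (pd i (fun z => (jac τ z).adjugate i k) y * Y k (τ y) +
        (jac τ y).adjugate i k * ∑ m, jac τ y m i * pd m (Y k) (τ y)) := by
    intro i
    rw [pd_sum _ (f := fun k z => (jac τ z).adjugate i k * Y k (τ z))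
      (fun k _ => (hadj i k).mul (hYτ k))]
    refine Finset.sum_congr rfl fun k _ => ?_
    rw [pd_mul (hadj i k) (hYτ k), pd_comp (hY k) hτd]
  -- The terms with a derivative on the adjugate vanish by the Piola identity; the rest collapses
  -- through `A · adj A = det A · 1`.
  simp only [e]
  rw [Finset.sum_comm]
  simp only [Finset.sum_add_distrib, ← Finset.sum_mul, sum_pd_adjugate_jac hτ hdet, zero_mul,
    zero_add, Finset.mul_sum]
  refine Finset.sum_congr rfl fun k _ => ?_
  rw [Finset.sum_comm]
  have : ∀ m, ∑ i, (jac τ y).adjugate i k * (jac τ y m i * pd m (Y k) (τ y)) =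
      ((jac τ y).det * (1 : Matrix (Fin 6) (Fin 6) ℝ) m k) * pd m (Y k) (τ y) := by
    intro m
    have := congrFun (congrFun (Matrix.mul_adjugate (jac τ y)) m) k
    simp only [Matrix.mul_apply, Matrix.smul_apply, smul_eq_mul] at this
    rw [← this, Finset.sum_mul]
    exact Finset.sum_congr rfl fun i _ => by ring
  simp [this, Matrix.one_apply]

end

section

open Matrix

/-! ### Tensor norms -/

/-- The quadratic form `∑ H^{i₁j₁} ⋯ H^{i_pj_p} F_{i₁…i_p} F_{j₁…j_p}`. -/
def tensorForm {p : ℕ} (H : Matrix (Fin 6) (Fin 6) ℝ) (F : (Fin p → Fin 6) → ℝ) : ℝ :=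
  ∑ i : Fin p → Fin 6, ∑ j : Fin p → Fin 6, (∏ k, H (i k) (j k)) * F i * F j

/-- The pull-back of a covariant tensor by a matrix. -/
def tensorPull {p : ℕ} (A : Matrix (Fin 6) (Fin 6) ℝ) (F : (Fin p → Fin 6) → ℝ)
    (i : Fin p → Fin 6) : ℝ :=
  ∑ m : Fin p → Fin 6, (∏ k, A (m k) (i k)) * F m

theorem sum_prod_mul_prod {p : ℕ} (A H : Matrix (Fin 6) (Fin 6) ℝ) (m n : Fin p → Fin 6) :
    ∑ i : Fin p → Fin 6, (∏ k, A (m k) (i k)) * ∏ k, H (i k) (n k) =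
      ∏ k, (A * H) (m k) (n k) := by
  simp only [Matrix.mul_apply, Finset.prod_univ_sum, Fintype.piFinset_univ,
    Finset.prod_mul_distrib]

/-- Sums over multi-indices of products over slots factor slot by slot (`sum_prod_mul_prod`), so
pulling back every slot by `A` amounts to replacing `H` by `A H Aᵀ`. -/
theorem tensorForm_pull {p : ℕ} (A H : Matrix (Fin 6) (Fin 6) ℝ) (F : (Fin p → Fin 6) → ℝ) :
    tensorForm H (tensorPull A F) = tensorForm (A * H * Aᵀ) F := by
  have h1 : ∀ m n : Fin p → Fin 6, ∏ k, (A * H * Aᵀ) (m k) (n k) =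
      ∑ j : Fin p → Fin 6, ∑ i : Fin p → Fin 6,
        (∏ k, A (m k) (i k)) * (∏ k, H (i k) (j k)) * ∏ k, A (n k) (j k) := by
    intro m n
    rw [← sum_prod_mul_prod]
    refine Finset.sum_congr rfl fun j _ => ?_
    rw [← sum_prod_mul_prod, Finset.sum_mul]
    rfl
  simp only [tensorForm, tensorPull, h1, Finset.sum_mul, Finset.mul_sum]
  calc _ = ∑ i : Fin p → Fin 6, ∑ j : Fin p → Fin 6, ∑ n : Fin p → Fin 6, ∑ m : Fin p → Fin 6,
        (∏ k, A (m k) (i k)) * (∏ k, H (i k) (j k)) * (∏ k, A (n k) (j k)) * F m * F n := by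
        refine Finset.sum_congr rfl fun i _ => Finset.sum_congr rfl fun j _ =>
          Finset.sum_congr rfl fun n _ => Finset.sum_congr rfl fun m _ => by ring
    _ = ∑ m : Fin p → Fin 6, ∑ n : Fin p → Fin 6, ∑ j : Fin p → Fin 6, ∑ i : Fin p → Fin 6,
        (∏ k, A (m k) (i k)) * (∏ k, H (i k) (j k)) * (∏ k, A (n k) (j k)) * F m * F n := by
        have e1 : ∀ i : Fin p → Fin 6, (∑ j : Fin p → Fin 6, ∑ n : Fin p → Fin 6,
            ∑ m : Fin p → Fin 6, (∏ k, A (m k) (i k)) * (∏ k, H (i k) (j k)) *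
              (∏ k, A (n k) (j k)) * F m * F n) =
            ∑ m : Fin p → Fin 6, ∑ n : Fin p → Fin 6, ∑ j : Fin p → Fin 6,
              (∏ k, A (m k) (i k)) * (∏ k, H (i k) (j k)) *
              (∏ k, A (n k) (j k)) * F m * F n := by
          intro i
          rw [Finset.sum_comm]
          simp_rw [Finset.sum_comm (s := (Finset.univ : Finset (Fin p → Fin 6)))
            (t := (Finset.univ : Finset (Fin p → Fin 6)))
            (f := fun j m => (∏ k, A (m k) (i k)) * (∏ k, H (i k) (j k)) * _ * F m * _)]
          rw [Finset.sum_comm]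
        simp_rw [e1]
        rw [Finset.sum_comm]
        refine Finset.sum_congr rfl fun m _ => ?_
        rw [Finset.sum_comm]
        refine Finset.sum_congr rfl fun n _ => ?_
        rw [Finset.sum_comm]

/-- Writing `H` as a sum of rank-one matrices `v_r v_rᵀ` turns the form into a sum of squares
indexed by multi-indices `r`. It yields `|F|² ≥ 0`, a sign needed for stability. -/
theorem tensorForm_nonneg {p : ℕ} {H : Matrix (Fin 6) (Fin 6) ℝ} (hH : H.PosSemidef)
    (F : (Fin p → Fin 6) → ℝ) : 0 ≤ tensorForm H F := by
  obtain ⟨N, v, rfl⟩ := Matrix.posSemidef_iff_eq_sum_vecMulVec.1 hH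
  have h1 : ∀ i j : Fin p → Fin 6, ∏ k, (∑ r, vecMulVec (v r) (star (v r))) (i k) (j k) =
      ∑ r : Fin p → Fin N, (∏ k, v (r k) (i k)) * ∏ k, v (r k) (j k) := by
    intro i j
    simp only [Matrix.sum_apply, vecMulVec_apply, star_trivial,
      Finset.prod_univ_sum, Fintype.piFinset_univ, Finset.prod_mul_distrib]
  have h2 : tensorForm (∑ r, vecMulVec (v r) (star (v r))) F =
      ∑ r : Fin p → Fin N, (∑ i : Fin p → Fin 6, (∏ k, v (r k) (i k)) * F i) ^ 2 := by
    simp only [tensorForm, h1, Finset.sum_mul, pow_two, Finset.mul_sum]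
    have e : ∀ i : Fin p → Fin 6, (∑ j : Fin p → Fin 6, ∑ r : Fin p → Fin N,
        (∏ k, v (r k) (i k)) * (∏ k, v (r k) (j k)) * F i * F j) =
        ∑ r : Fin p → Fin N, ∑ j : Fin p → Fin 6,
        (∏ k, v (r k) (i k)) * (∏ k, v (r k) (j k)) * F i * F j := fun i => Finset.sum_comm
    simp only [e]
    rw [Finset.sum_comm]
    refine Finset.sum_congr rfl fun r _ => ?_
    rw [Finset.sum_comm]
    exact Finset.sum_congr rfl fun i _ => Finset.sum_congr rfl fun j _ => by ring
  rw [h2]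
  exact Finset.sum_nonneg fun _ _ => sq_nonneg _

end

section

open Matrix

/-! ### The metric in coordinates and transition maps -/

section Metric

variable {M : Type*} [TopologicalSpace M]

theorem eventually_mem_overlap {φ ψ : OpenPartialHomeomorph M E6} {y : E6}
    (hy : y ∈ φ.target) (hy' : φ.symm y ∈ ψ.source) :
    ∀ᶠ z in 𝓝 y, z ∈ φ.target ∧ φ.symm z ∈ ψ.source := by
  filter_upwards [φ.open_target.mem_nhds hy,
    (φ.continuousAt_symm hy).eventually_mem (ψ.open_source.mem_nhds hy')] with z h1 h2
  exact ⟨h1, h2⟩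

/-- The transition map `ψ ∘ φ⁻¹`. -/
def transition (φ ψ : OpenPartialHomeomorph M E6) (y : E6) : E6 := ψ (φ.symm y)

theorem comp_symm_eventuallyEq {φ ψ : OpenPartialHomeomorph M E6} {y : E6}
    (hy : y ∈ φ.target) (hy' : φ.symm y ∈ ψ.source) (u : M → ℝ) :
    (fun z => u (φ.symm z)) =ᶠ[𝓝 y] fun z => u (ψ.symm (transition φ ψ z)) := by
  filter_upwards [eventually_mem_overlap hy hy'] with z hz
  rw [transition, ψ.left_inv hz.2]

variable [ChartedSpace E6 M]

/-- The coordinate vector `∂_i`, as an element of the model space. -/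
def coordVecE (φ : OpenPartialHomeomorph M E6) (y : E6) (i : Fin 6) : E6 := coordVec φ y i

variable [IsManifold (𝓡 6) ∞ M]

variable {φ ψ : OpenPartialHomeomorph M E6}

theorem contDiffAt_transition (hφ : φ ∈ atlas E6 M) (hψ : ψ ∈ atlas E6 M) {y : E6}
    (hy : y ∈ φ.target) (hy' : φ.symm y ∈ ψ.source) : ContDiffAt ℝ ∞ (transition φ ψ) y :=
  (((contMDiffOn_chart hψ).contMDiffAt (ψ.open_source.mem_nhds hy')).comp y
    ((contMDiffOn_chart_symm hφ).contMDiffAt (φ.open_target.mem_nhds hy))).contDiffAt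

theorem coordVecE_transition (hφ : φ ∈ atlas E6 M) (hψ : ψ ∈ atlas E6 M) {y : E6}
    (hy : y ∈ φ.target) (hy' : φ.symm y ∈ ψ.source) (i : Fin 6) :
    coordVecE φ y i = ∑ k, jac (transition φ ψ) y k i • coordVecE ψ (transition φ ψ y) k := by
  have hτ := (contDiffAt_transition hφ hψ hy hy').differentiableAt (by simp)
  have hz : transition φ ψ y ∈ ψ.target := ψ.map_source hy'
  have hm : MDifferentiableAt 𝓘(ℝ, E6) (𝓡 6) ψ.symm (transition φ ψ y) :=
    ((contMDiffOn_chart_symm hψ).contMDiffAt (ψ.open_target.mem_nhds hz)).mdifferentiableAt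
      (by simp)
  have e : φ.symm =ᶠ[𝓝 y] ψ.symm ∘ transition φ ψ := by
    filter_upwards [eventually_mem_overlap hy hy'] with z hz
    exact (ψ.left_inv hz.2).symm
  have h1 : HasMFDerivAt 𝓘(ℝ, E6) (𝓡 6) φ.symm y
      ((mfderiv 𝓘(ℝ, E6) (𝓡 6) ψ.symm (transition φ ψ y)).comp (fderiv ℝ (transition φ ψ) y)) :=
    (hm.hasMFDerivAt.comp y hτ.hasFDerivAt.hasMFDerivAt).congr_of_eventuallyEq e
  let D : E6 →L[ℝ] E6 := mfderiv 𝓘(ℝ, E6) (𝓡 6) ψ.symm (transition φ ψ y)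
  have h2 : coordVecE φ y i = D (fderiv ℝ (transition φ ψ) y (EuclideanSpace.single i 1)) := by
    rw [coordVecE, coordVec, h1.mfderiv]
    rfl
  rw [h2, fderiv_single_eq hτ, map_sum]
  refine Finset.sum_congr rfl fun k _ => ?_
  rw [map_smul]
  rfl

variable (g : Metric6 M)

/-- The metric, as a bilinear form on the model space. -/
def metricE (x : M) : E6 →L[ℝ] E6 →L[ℝ] ℝ := g.inner x

theorem gMat_eq (φ : OpenPartialHomeomorph M E6) (y : E6) (x : M) (hx : φ.symm y = x)
    (i j : Fin 6) :
    gMat g φ y i j = metricE g x (coordVecE φ y i) (coordVecE φ y j) := by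
  subst hx; rfl

theorem gMat_transition (hφ : φ ∈ atlas E6 M) (hψ : ψ ∈ atlas E6 M) {y : E6}
    (hy : y ∈ φ.target) (hy' : φ.symm y ∈ ψ.source) :
    gMat g φ y = (jac (transition φ ψ) y)ᵀ * gMat g ψ (transition φ ψ y) *
      jac (transition φ ψ) y := by
  ext i j
  rw [gMat_eq g φ y _ rfl, coordVecE_transition hφ hψ hy hy' i,
    coordVecE_transition hφ hψ hy hy' j]
  simp only [map_sum, map_smul, _root_.sum_apply, _root_.smul_apply,
    smul_eq_mul, Matrix.mul_apply, Matrix.transpose_apply,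
    gMat_eq g ψ (transition φ ψ y) (φ.symm y) (ψ.left_inv hy'), Finset.sum_mul, Finset.mul_sum]
  exact Finset.sum_congr rfl fun k _ => Finset.sum_congr rfl fun l _ => by ring

theorem gMat_posDef (hφ : φ ∈ atlas E6 M) {y : E6} (hy : y ∈ φ.target) : (gMat g φ y).PosDef := by
  refine PosDef.of_dotProduct_mulVec_pos ?_ fun c hc => ?_
  · ext i j
    simp only [conjTranspose_apply, star_trivial]
    exact g.symm _ _ _
  · set B : E6 →L[ℝ] E6 →L[ℝ] ℝ := metricE g (φ.symm y)
    set D : E6 →L[ℝ] E6 := mfderiv 𝓘(ℝ, E6) (𝓡 6) φ.symm y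
    have e : star c ⬝ᵥ (gMat g φ y *ᵥ c) = B (D (WithLp.toLp 2 c)) (D (WithLp.toLp 2 c)) := by
      have hcs : WithLp.toLp 2 c = ∑ i, c i • EuclideanSpace.single i (1 : ℝ) := by
        ext l
        simp [Pi.single_apply]
      have hv : D (WithLp.toLp 2 c) = ∑ i, c i • coordVecE φ y i := by
        rw [hcs, map_sum]
        exact Finset.sum_congr rfl fun i _ => by rw [map_smul]; rfl
      rw [hv]
      simp only [map_sum, map_smul, _root_.sum_apply, _root_.smul_apply,
        smul_eq_mul, dotProduct, mulVec, Pi.star_apply, star_trivial, Finset.mul_sum]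
      rw [Finset.sum_comm]
      refine Finset.sum_congr rfl fun i _ => Finset.sum_congr rfl fun j _ => ?_
      rw [gMat_eq g φ y _ rfl]
      ring
    rw [e]
    refine g.pos (φ.symm y) _ fun h0 => hc ?_
    have hinj := ((mdifferentiable_of_mem_atlas (I := 𝓡 6) hφ).symm).mfderiv_injective hy
    have : WithLp.toLp 2 c = (0 : E6) := hinj (h0.trans (map_zero D).symm)
    simpa using this

theorem gMat_det_pos (hφ : φ ∈ atlas E6 M) {y : E6} (hy : y ∈ φ.target) :
    0 < (gMat g φ y).det := (gMat_posDef g hφ hy).det_pos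

theorem gDensity_pos (hφ : φ ∈ atlas E6 M) {y : E6} (hy : y ∈ φ.target) :
    0 < gDensity g φ y := Real.sqrt_pos.2 (gMat_det_pos g hφ hy)

/-- Both coordinate metrics have positive determinant and they differ by the factor `(det J)²`. -/
theorem jac_transition_det_ne_zero (hφ : φ ∈ atlas E6 M) (hψ : ψ ∈ atlas E6 M) {y : E6}
    (hy : y ∈ φ.target) (hy' : φ.symm y ∈ ψ.source) (g : Metric6 M) :
    (jac (transition φ ψ) y).det ≠ 0 := by
  intro h0
  have := gMat_det_pos g hφ hy
  rw [gMat_transition g hφ hψ hy hy'] at this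
  simp [h0] at this

theorem gDensity_transition (hφ : φ ∈ atlas E6 M) (hψ : ψ ∈ atlas E6 M) {y : E6}
    (hy : y ∈ φ.target) (hy' : φ.symm y ∈ ψ.source) :
    gDensity g φ y = |(jac (transition φ ψ) y).det| * gDensity g ψ (transition φ ψ y) := by
  rw [gDensity, gDensity, gMat_transition g hφ hψ hy hy', det_mul, det_mul, det_transpose,
    ← Real.sqrt_sq_eq_abs, ← Real.sqrt_mul (sq_nonneg _)]
  congr 1; ring

theorem gMat_inv_transition (hφ : φ ∈ atlas E6 M) (hψ : ψ ∈ atlas E6 M) {y : E6}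
    (hy : y ∈ φ.target) (hy' : φ.symm y ∈ ψ.source) :
    jac (transition φ ψ) y * (gMat g φ y)⁻¹ * (jac (transition φ ψ) y)ᵀ =
      (gMat g ψ (transition φ ψ y))⁻¹ := by
  have hA : IsUnit (jac (transition φ ψ) y).det :=
    (jac_transition_det_ne_zero hφ hψ hy hy' g).isUnit
  have hAt : IsUnit (jac (transition φ ψ) y)ᵀ.det := by rwa [det_transpose]
  rw [gMat_transition g hφ hψ hy hy', Matrix.mul_inv_rev, Matrix.mul_inv_rev,
    ← Matrix.mul_assoc, Matrix.mul_nonsing_inv _ hA, Matrix.one_mul, Matrix.mul_assoc,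
    Matrix.nonsing_inv_mul _ hAt, Matrix.mul_one]

theorem contDiffOn_gMat (hφ : φ ∈ atlas E6 M) (i j : Fin 6) :
    ContDiffOn ℝ ∞ (fun y => gMat g φ y i j) φ.target := by
  have hs := contMDiffOn_chart_symm hφ
  have hu : UniqueMDiffOn 𝓘(ℝ, E6) φ.target := φ.open_target.uniqueMDiffOn
  -- A coordinate vector field is the image of a constant field under the tangent map of the inverse
  -- chart, hence a smooth section along it.
  have hv : ∀ i, ContMDiffOn 𝓘(ℝ, E6) (𝓡 6).tangent ∞
      (fun y => (⟨φ.symm y, coordVec φ y i⟩ : TangentBundle (𝓡 6) M)) φ.target := by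
    intro i
    have h1 := hs.contMDiffOn_tangentMapWithin (m := ∞) (by simp) hu
    have h2 : ContMDiff 𝓘(ℝ, E6) 𝓘(ℝ, E6).tangent ∞
        (fun y : E6 => (⟨y, EuclideanSpace.single i (1 : ℝ)⟩ : TangentBundle 𝓘(ℝ, E6) E6)) := by
      intro y
      exact contMDiffAt_vectorSpace_iff_contDiffAt.2 contDiffAt_const
    refine (h1.comp h2.contMDiffOn (fun y hy => hy)).congr fun y hy => ?_
    simp only [Function.comp, tangentMapWithin, coordVec]
    rw [mfderivWithin_of_isOpen φ.open_target hy]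
  intro y hy
  have : ContMDiffWithinAt 𝓘(ℝ, E6) ((𝓡 6).prod 𝓘(ℝ)) ∞
      (fun y => Bundle.TotalSpace.mk' ℝ (E := Bundle.Trivial M ℝ) (φ.symm y)
        (g.inner (φ.symm y) (coordVec φ y i) (coordVec φ y j))) φ.target y := by
    apply ContMDiffWithinAt.clm_bundle_apply₂ (F₁ := E6) (F₂ := E6)
    · exact ContMDiffAt.comp_contMDiffWithinAt y g.contMDiff.contMDiffAt (hs y hy)
    · exact hv i y hy
    · exact hv j y hy
  simp only [Bundle.contMDiffWithinAt_totalSpace] at this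
  exact this.2.contDiffWithinAt

theorem contDiffOn_det {A : E6 → Matrix (Fin 6) (Fin 6) ℝ} {U : Set E6} {n : ℕ∞ω}
    (hA : ∀ i j, ContDiffOn ℝ n (fun y => A y i j) U) : ContDiffOn ℝ n (fun y => (A y).det) U := by
  simp only [Matrix.det_apply']
  refine ContDiffOn.sum fun σ _ => contDiffOn_const.mul (contDiffOn_prod fun i _ => hA _ _)

theorem contDiffOn_gMat_inv (hφ : φ ∈ atlas E6 M) (i j : Fin 6) :
    ContDiffOn ℝ ∞ (fun y => (gMat g φ y)⁻¹ i j) φ.target := by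
  have h1 : ContDiffOn ℝ ∞ (fun y => (gMat g φ y).adjugate i j) φ.target := by
    simp only [Matrix.adjugate_apply]
    refine contDiffOn_det fun a b => ?_
    by_cases h : a = j
    · subst h; simpa using contDiffOn_const
    · simpa [Matrix.updateRow_ne h] using contDiffOn_gMat g hφ a b
  have h2 : ContDiffOn ℝ ∞ (fun y => ((gMat g φ y).det)⁻¹) φ.target :=
    (contDiffOn_det fun i j => contDiffOn_gMat g hφ i j).inv fun y hy => (gMat_det_pos g hφ hy).ne'
  refine (h2.mul h1).congr fun y _ => ?_
  rw [Matrix.inv_def, Ring.inverse_eq_inv']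
  rfl

theorem contDiffOn_gDensity (hφ : φ ∈ atlas E6 M) :
    ContDiffOn ℝ ∞ (gDensity g φ) φ.target :=
  (contDiffOn_det fun i j => contDiffOn_gMat g hφ i j).sqrt fun _ hy => (gMat_det_pos g hφ hy).ne'

end Metric

end

section

open Matrix

theorem pd_const_mul (c : ℝ) (f : E6 → ℝ) (y : E6) (i : Fin 6) :
    pd i (fun z => c * f z) y = c * pd i f y := by
  have := congrFun (fderiv_const_smul_field (𝕜 := ℝ) (f := f) c) y
  rw [pd, show (fun z => c * f z) = c • f from rfl, this]
  rfl

/-! ### Coordinate expressions and their invariance -/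

section Invariance

variable {M : Type*} [TopologicalSpace M] [ChartedSpace E6 M] [IsManifold (𝓡 6) ∞ M]
variable (g : Metric6 M)

/-- `g^{ij} ∂_i u ∂_j w` in the chart `φ`. -/
def gradIn (φ : OpenPartialHomeomorph M E6) (u w : E6 → ℝ) (y : E6) : ℝ :=
  ∑ i, ∑ j, (gMat g φ y)⁻¹ i j * pd i u y * pd j w y

/-- The densitized vector field `(det g)^{1/2} w g^{ij} ∂_j u` in the chart `φ`. -/
def fluxIn (φ : OpenPartialHomeomorph M E6) (w u : E6 → ℝ) (i : Fin 6) (y : E6) : ℝ :=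
  gDensity g φ y * w y * ∑ j, (gMat g φ y)⁻¹ i j * pd j u y

/-- `(det g)^{-1/2} ∂_i ((det g)^{1/2} w g^{ij} ∂_j u)` in the chart `φ`. -/
def divIn (φ : OpenPartialHomeomorph M E6) (w u : E6 → ℝ) (y : E6) : ℝ :=
  (gDensity g φ y)⁻¹ * ∑ i, pd i (fluxIn g φ w u i) y

theorem Form.normSq_eq_tensorForm {p : ℕ} (F : Form M p) (x : M) :
    F.normSq g x = (p.factorial : ℝ)⁻¹ * tensorForm (gMat g (chartAt E6 x) (chartAt E6 x x))⁻¹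
      (fun i => F.comp (chartAt E6 x) i (chartAt E6 x x)) := rfl

variable {φ ψ : OpenPartialHomeomorph M E6}

theorem pd_comp_symm (hφ : φ ∈ atlas E6 M) (hψ : ψ ∈ atlas E6 M) {y : E6}
    (hy : y ∈ φ.target) (hy' : φ.symm y ∈ ψ.source) {u : M → ℝ}
    (hu : DifferentiableAt ℝ (fun z => u (ψ.symm z)) (transition φ ψ y)) (i : Fin 6) :
    pd i (fun z => u (φ.symm z)) y =
      ∑ k, jac (transition φ ψ) y k i * pd k (fun z => u (ψ.symm z)) (transition φ ψ y) := by
  rw [pd_congr (comp_symm_eventuallyEq hy hy' u), pd_comp hu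
    ((contDiffAt_transition hφ hψ hy hy').differentiableAt (by simp))]

theorem gradIn_eq_dotProduct (φ : OpenPartialHomeomorph M E6) (u w : E6 → ℝ) (y : E6) :
    gradIn g φ u w y = (fun i => pd i u y) ⬝ᵥ ((gMat g φ y)⁻¹ *ᵥ fun i => pd i w y) := by
  simp only [gradIn, dotProduct, mulVec, Finset.mul_sum]
  exact Finset.sum_congr rfl fun i _ => Finset.sum_congr rfl fun j _ => by ring

theorem gradIn_transition (hφ : φ ∈ atlas E6 M) (hψ : ψ ∈ atlas E6 M) {y : E6}
    (hy : y ∈ φ.target) (hy' : φ.symm y ∈ ψ.source) {u w : M → ℝ}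
    (hu : DifferentiableAt ℝ (fun z => u (ψ.symm z)) (transition φ ψ y))
    (hw : DifferentiableAt ℝ (fun z => w (ψ.symm z)) (transition φ ψ y)) :
    gradIn g φ (fun z => u (φ.symm z)) (fun z => w (φ.symm z)) y =
      gradIn g ψ (fun z => u (ψ.symm z)) (fun z => w (ψ.symm z)) (transition φ ψ y) := by
  have h : ∀ {u : M → ℝ}, DifferentiableAt ℝ (fun z => u (ψ.symm z)) (transition φ ψ y) →
      (fun i => pd i (fun z => u (φ.symm z)) y) = (jac (transition φ ψ) y)ᵀ *ᵥ
        fun k => pd k (fun z => u (ψ.symm z)) (transition φ ψ y) := fun hu =>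
    funext fun i => pd_comp_symm hφ hψ hy hy' hu i
  rw [gradIn_eq_dotProduct, gradIn_eq_dotProduct, h hu, h hw,
    ← gMat_inv_transition g hφ hψ hy hy', Matrix.mulVec_transpose, ← dotProduct_mulVec,
    Matrix.mulVec_mulVec, Matrix.mulVec_mulVec]

/-- The flux is a vector density, so up to the sign of the Jacobian determinant it is a Piola
transform. Both sides carry a determinant factor so that no inverse of the Jacobian appears. -/
theorem fluxIn_transition (hφ : φ ∈ atlas E6 M) (hψ : ψ ∈ atlas E6 M) {y : E6}
    (hy : y ∈ φ.target) (hy' : φ.symm y ∈ ψ.source) {u w : M → ℝ}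
    (hu : DifferentiableAt ℝ (fun z => u (ψ.symm z)) (transition φ ψ y)) (i : Fin 6) :
    (jac (transition φ ψ) y).det *
        fluxIn g φ (fun z => w (φ.symm z)) (fun z => u (φ.symm z)) i y =
      |(jac (transition φ ψ) y).det| * ∑ k, (jac (transition φ ψ) y).adjugate i k *
        fluxIn g ψ (fun z => w (ψ.symm z)) (fun z => u (ψ.symm z)) k (transition φ ψ y) := by
  set A := jac (transition φ ψ) y
  set p : Fin 6 → ℝ := fun k => pd k (fun z => u (ψ.symm z)) (transition φ ψ y)
  have hp : (fun i => pd i (fun z => u (φ.symm z)) y) = Aᵀ *ᵥ p :=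
    funext fun i => pd_comp_symm hφ hψ hy hy' hu i
  have hw : w (φ.symm y) = w (ψ.symm (transition φ ψ y)) := by
    rw [transition, ψ.left_inv hy']
  have key : A.adjugate *ᵥ ((gMat g ψ (transition φ ψ y))⁻¹ *ᵥ p) =
      A.det • ((gMat g φ y)⁻¹ *ᵥ (Aᵀ *ᵥ p)) := by
    rw [← gMat_inv_transition g hφ hψ hy hy', Matrix.mulVec_mulVec, ← Matrix.mul_assoc,
      ← Matrix.mul_assoc, Matrix.adjugate_mul, Matrix.smul_mul, Matrix.one_mul, Matrix.smul_mul,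
      Matrix.smul_mulVec, Matrix.mulVec_mulVec]
  have key2 := congrFun key i
  rw [← hp] at key2
  simp only [Pi.smul_apply, smul_eq_mul] at key2
  simp only [fluxIn]
  change A.det * (gDensity g φ y * w (φ.symm y) * 
    ((gMat g φ y)⁻¹ *ᵥ fun i => pd i (fun z => u (φ.symm z)) y) i) = _
  rw [gDensity_transition g hφ hψ hy hy', hw]
  calc _ = |A.det| * (gDensity g ψ (transition φ ψ y) * w (ψ.symm (transition φ ψ y)) *
        (A.det * ((gMat g φ y)⁻¹ *ᵥ fun i => pd i (fun z => u (φ.symm z)) y) i)) := by ring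
    _ = _ := by
      rw [← key2]
      congr 1
      rw [mulVec, dotProduct, Finset.mul_sum]
      refine Finset.sum_congr rfl fun k _ => ?_
      rw [mulVec, dotProduct]
      ring

theorem differentiableAt_fluxIn (hφ : φ ∈ atlas E6 M) {y : E6} (hy : y ∈ φ.target)
    {w u : E6 → ℝ} (hw : DifferentiableAt ℝ w y) (hu : ContDiffAt ℝ 2 u y) (i : Fin 6) :
    DifferentiableAt ℝ (fluxIn g φ w u i) y := by
  have hn := φ.open_target.mem_nhds hy
  have h1 : DifferentiableAt ℝ (gDensity g φ) y :=
    ((contDiffOn_gDensity g hφ).contDiffAt hn).differentiableAt (by simp)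
  refine (h1.mul hw).mul (DifferentiableAt.fun_sum fun j _ => ?_)
  have h2 : DifferentiableAt ℝ (fun y => (gMat g φ y)⁻¹ i j) y :=
    ((contDiffOn_gMat_inv g hφ i j).contDiffAt hn).differentiableAt (by simp)
  have h3 : ContDiffAt ℝ 1 (pd j u) y :=
    (hu.fderiv_right (m := 1) (by norm_num)).clm_apply contDiffAt_const
  exact h2.mul (h3.differentiableAt one_ne_zero)

theorem divIn_transition (hφ : φ ∈ atlas E6 M) (hψ : ψ ∈ atlas E6 M) {y : E6}
    (hy : y ∈ φ.target) (hy' : φ.symm y ∈ ψ.source) {u w : M → ℝ}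
    (hw : DifferentiableAt ℝ (fun z => w (ψ.symm z)) (transition φ ψ y))
    (hu : ContDiffAt ℝ 2 (fun z => u (ψ.symm z)) (transition φ ψ y)) :
    divIn g φ (fun z => w (φ.symm z)) (fun z => u (φ.symm z)) y =
      divIn g ψ (fun z => w (ψ.symm z)) (fun z => u (ψ.symm z)) (transition φ ψ y) := by
  have hτ : ContDiffAt ℝ 2 (transition φ ψ) y :=
    (contDiffAt_transition hφ hψ hy hy').of_le
      (WithTop.coe_le_coe.2 le_top)
  have hdet := jac_transition_det_ne_zero hφ hψ hy hy' g
  have hz : transition φ ψ y ∈ ψ.target := ψ.map_source hy'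
  have hcont : ContinuousAt (fun z => (jac (transition φ ψ) z).det) y := by
    refine (differentiableAt_det fun m l => ?_).continuousAt
    have h1 : ContDiffAt ℝ 2 (fun z => transition φ ψ z m) y :=
      (EuclideanSpace.proj m : E6 →L[ℝ] ℝ).contDiff.contDiffAt.comp y hτ
    have h2 : ContDiffAt ℝ 1 (pd l fun z => transition φ ψ z m) y :=
      (h1.fderiv_right (m := 1) (by norm_num)).clm_apply contDiffAt_const
    exact h2.differentiableAt one_ne_zero
  -- The sign of the Jacobian determinant is locally constant, so it passes through the derivatives
  -- as a constant `ε`.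
  obtain ⟨ε, hε⟩ : ∃ ε : ℝ, ∀ᶠ z in 𝓝 y, |(jac (transition φ ψ) z).det| =
      ε * (jac (transition φ ψ) z).det := by
    rcases lt_or_gt_of_ne hdet with h | h
    · refine ⟨-1, ?_⟩
      filter_upwards [hcont.eventually_lt_const h] with z hz
      rw [abs_of_neg hz]; ring
    · refine ⟨1, ?_⟩
      filter_upwards [hcont.eventually_const_lt h] with z hz
      rw [abs_of_pos hz]; ring
  have hdiff : ∀ᶠ z in 𝓝 y, DifferentiableAt ℝ (fun z => u (ψ.symm z)) (transition φ ψ z) := by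
    refine hτ.continuousAt.eventually ?_
    filter_upwards [hu.eventually (by simp)] with z hz
    exact hz.differentiableAt (by norm_num)
  have hflux : ∀ i, fluxIn g φ (fun z => w (φ.symm z)) (fun z => u (φ.symm z)) i =ᶠ[𝓝 y]
      fun z => ε * ∑ k, (jac (transition φ ψ) z).adjugate i k *
        fluxIn g ψ (fun z => w (ψ.symm z)) (fun z => u (ψ.symm z)) k (transition φ ψ z) := by
    intro i
    filter_upwards [hε, hdiff, eventually_mem_overlap hy hy'] with z h1 h2 h3
    have h4 := fluxIn_transition g hφ hψ h3.1 h3.2 (w := w) h2 i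
    rw [h1, mul_comm ε, mul_assoc] at h4
    exact mul_left_cancel₀ (jac_transition_det_ne_zero hφ hψ h3.1 h3.2 g) h4
  have hfd := fun k => differentiableAt_fluxIn g hψ hz hw hu k
  -- The divergence picks up `ε det J = |det J|`, which the transformation of the density cancels.
  have hsum : ∑ i, pd i (fluxIn g φ (fun z => w (φ.symm z)) (fun z => u (φ.symm z)) i) y =
      |(jac (transition φ ψ) y).det| * ∑ k, pd k (fluxIn g ψ (fun z => w (ψ.symm z))
        (fun z => u (ψ.symm z)) k) (transition φ ψ y) := by
    rw [hε.self_of_nhds, mul_assoc, ← sum_pd_piola hτ hdet hfd, Finset.mul_sum]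
    refine Finset.sum_congr rfl fun i _ => ?_
    rw [pd_congr (hflux i)]
    rw [pd_const_mul]
  rw [divIn, divIn, hsum, gDensity_transition g hφ hψ hy hy', mul_inv, ← mul_assoc]
  have := abs_ne_zero.2 hdet
  field_simp

/-- The value of a form at `x`, as a form on the model space. -/
def Form.atE {p : ℕ} (F : Form M p) (x : M) : E6 [⋀^Fin p]→ₗ[ℝ] ℝ := F x

theorem Form.comp_transition {p : ℕ} (F : Form M p) (hφ : φ ∈ atlas E6 M) (hψ : ψ ∈ atlas E6 M)
    {y : E6} (hy : y ∈ φ.target) (hy' : φ.symm y ∈ ψ.source) :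
    (fun i => F.comp φ i y) =
      tensorPull (jac (transition φ ψ) y) fun i => F.comp ψ i (transition φ ψ y) := by
  have e : ∀ (φ : OpenPartialHomeomorph M E6) (y : E6) (x : M) (_ : φ.symm y = x)
      (i : Fin p → Fin 6), F.comp φ i y =
      F.atE x fun k => coordVecE φ y (i k) := by
    intro φ y x hx i
    subst hx; rfl
  ext i
  rw [e φ y _ rfl i]
  simp only [tensorPull, e ψ (transition φ ψ y) (φ.symm y) (ψ.left_inv hy'),
    coordVecE_transition hφ hψ hy hy']
  generalize F.atE (φ.symm y) = L
  have h1 := L.toMultilinearMap.map_sum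
    (fun (k : Fin p) (l : Fin 6) => jac (transition φ ψ) y l (i k) •
      coordVecE ψ (transition φ ψ y) l)
  refine h1.trans (Finset.sum_congr rfl fun m _ => ?_)
  exact L.toMultilinearMap.map_smul_univ _ _

theorem tensorForm_transition {p : ℕ} (F : Form M p) (hφ : φ ∈ atlas E6 M)
    (hψ : ψ ∈ atlas E6 M) {y : E6} (hy : y ∈ φ.target) (hy' : φ.symm y ∈ ψ.source) :
    tensorForm (gMat g φ y)⁻¹ (fun i => F.comp φ i y) =
      tensorForm (gMat g ψ (transition φ ψ y))⁻¹ (fun i => F.comp ψ i (transition φ ψ y)) := by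
  rw [F.comp_transition hφ hψ hy hy', tensorForm_pull, gMat_inv_transition g hφ hψ hy hy']

/-! The invariant operators, computed in an arbitrary chart of the atlas. -/

/-- The definition uses the preferred chart of each point, which may jump from point to point. Being
able to compute in one fixed chart over its whole domain is what gives access to regularity and
uniform bounds. -/
theorem gradDot_symm (hφ : φ ∈ atlas E6 M) {u w : M → ℝ} {y : E6} (hy : y ∈ φ.target)
    (hu : DifferentiableAt ℝ (fun z => u (φ.symm z)) y)
    (hw : DifferentiableAt ℝ (fun z => w (φ.symm z)) y) :
    gradDot g u w (φ.symm y) = gradIn g φ (fun z => u (φ.symm z)) (fun z => w (φ.symm z)) y := by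
  set ψ := chartAt E6 (φ.symm y) with hψ
  have hs : φ.symm y ∈ ψ.source := mem_chart_source E6 _
  have e : transition ψ φ (ψ (φ.symm y)) = y := by
    rw [transition, ψ.left_inv hs, φ.right_inv hy]
  have hs' : ψ.symm (ψ (φ.symm y)) ∈ φ.source := by
    rw [ψ.left_inv hs]; exact φ.map_target hy
  have := gradIn_transition g (chart_mem_atlas E6 (φ.symm y)) hφ (ψ.map_source hs) hs'
    (u := u) (w := w) (by rwa [e]) (by rwa [e])
  rw [e] at this
  exact this

theorem divGrad_symm (hφ : φ ∈ atlas E6 M) {u w : M → ℝ} {y : E6} (hy : y ∈ φ.target)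
    (hw : DifferentiableAt ℝ (fun z => w (φ.symm z)) y)
    (hu : ContDiffAt ℝ 2 (fun z => u (φ.symm z)) y) :
    divGrad g w u (φ.symm y) = divIn g φ (fun z => w (φ.symm z)) (fun z => u (φ.symm z)) y := by
  set ψ := chartAt E6 (φ.symm y) with hψ
  have hs : φ.symm y ∈ ψ.source := mem_chart_source E6 _
  have e : transition ψ φ (ψ (φ.symm y)) = y := by
    rw [transition, ψ.left_inv hs, φ.right_inv hy]
  have hs' : ψ.symm (ψ (φ.symm y)) ∈ φ.source := by
    rw [ψ.left_inv hs]; exact φ.map_target hy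
  have := divIn_transition g (chart_mem_atlas E6 (φ.symm y)) hφ (ψ.map_source hs) hs'
    (u := u) (w := w) (by rwa [e]) (by rwa [e])
  rw [e] at this
  exact this

theorem Form.normSq_symm {p : ℕ} (F : Form M p) (hφ : φ ∈ atlas E6 M) {y : E6}
    (hy : y ∈ φ.target) :
    F.normSq g (φ.symm y) =
      (p.factorial : ℝ)⁻¹ * tensorForm (gMat g φ y)⁻¹ (fun i => F.comp φ i y) := by
  set ψ := chartAt E6 (φ.symm y) with hψ
  have hs : φ.symm y ∈ ψ.source := mem_chart_source E6 _
  have e : transition ψ φ (ψ (φ.symm y)) = y := by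
    rw [transition, ψ.left_inv hs, φ.right_inv hy]
  have hs' : ψ.symm (ψ (φ.symm y)) ∈ φ.source := by
    rw [ψ.left_inv hs]; exact φ.map_target hy
  have := tensorForm_transition g F (chart_mem_atlas E6 (φ.symm y)) hφ (ψ.map_source hs) hs'
  rw [e] at this
  rw [F.normSq_eq_tensorForm, ← hψ, this]

theorem Form.normSq_nonneg {p : ℕ} (F : Form M p) (x : M) : 0 ≤ F.normSq g x := by
  rw [F.normSq_eq_tensorForm]
  refine mul_nonneg (by positivity) (tensorForm_nonneg ?_ _)
  exact (gMat_posDef g (chart_mem_atlas E6 x)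
    ((chartAt E6 x).map_source (mem_chart_source E6 x))).inv.posSemidef

end Invariance

end

/-! ### Sobolev functions on the manifold -/

section SobolevManifold

variable {M : Type*} [TopologicalSpace M] [ChartedSpace E6 M] [IsManifold (𝓡 6) ∞ M]
  [T2Space M] [CompactSpace M]

namespace MemHs

variable {s t : ℝ} {f h : M → ℝ}

theorem const (c : ℝ) : MemHs s fun _ : M => c :=
  memHs_iff.2 fun φ _ => HLoc.const φ.open_target c

theorem mono (hf : MemHs t f) (hst : s ≤ t) : MemHs s f :=
  memHs_iff.2 fun φ hφ => (memHs_iff.1 hf φ hφ).mono hst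

theorem add (hf : MemHs s f) (hh : MemHs s h) : MemHs s fun x => f x + h x :=
  memHs_iff.2 fun φ hφ => (memHs_iff.1 hf φ hφ).add φ.open_target (memHs_iff.1 hh φ hφ)

theorem const_mul (c : ℝ) (hf : MemHs s f) : MemHs s fun x => c * f x :=
  memHs_iff.2 fun φ hφ => (memHs_iff.1 hf φ hφ).const_mul c

theorem sub (hf : MemHs s f) (hh : MemHs s h) : MemHs s fun x => f x - h x := by
  have := hf.add (hh.const_mul (-1))
  simpa [sub_eq_add_neg] using this

theorem mul (h3 : 3 < s) (hf : MemHs s f) (hh : MemHs s h) : MemHs s fun x => f x * h x :=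
  memHs_iff.2 fun φ hφ => (memHs_iff.1 hf φ hφ).mul φ.open_target h3 (memHs_iff.1 hh φ hφ)

theorem pow (h3 : 3 < s) (hf : MemHs s f) (n : ℕ) : MemHs s fun x => f x ^ n := by
  induction n with
  | zero => simpa using const 1
  | succ n ih => simpa only [pow_succ] using ih.mul h3 hf

theorem inv (hs : 11 < s) (hf : MemHs s f) (h0 : ∀ x, f x ≠ 0) : MemHs s fun x => (f x)⁻¹ :=
  memHs_iff.2 fun φ hφ => (memHs_iff.1 hf φ hφ).inv φ.open_target hs fun y _ => h0 (φ.symm y)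

theorem contDiffOn {n : ℕ} (hn : 3 + n < s) (hf : MemHs s f) {φ : OpenPartialHomeomorph M E6}
    (hφ : φ ∈ atlas E6 M) : ContDiffOn ℝ n (fun y => f (φ.symm y)) φ.target :=
  (memHs_iff.1 hf φ hφ).contDiffOn φ.open_target hn

theorem contDiffAt_two (hs : 5 < s) (hf : MemHs s f) {φ : OpenPartialHomeomorph M E6}
    (hφ : φ ∈ atlas E6 M) {y : E6} (hy : y ∈ φ.target) :
    ContDiffAt ℝ 2 (fun y => f (φ.symm y)) y :=
  (hf.contDiffOn (n := 2) (by norm_num; linarith) hφ).contDiffAt (φ.open_target.mem_nhds hy)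

theorem contMDiff {n : ℕ} (hn : 3 + n < s) (hf : MemHs s f) :
    ContMDiff (𝓡 6) 𝓘(ℝ, ℝ) n f := by
  intro x
  have hx := mem_chart_source E6 x
  set φ := chartAt E6 x
  have h1 : ContMDiffAt 𝓘(ℝ, E6) 𝓘(ℝ, ℝ) n (fun y => f (φ.symm y)) (φ x) :=
    ((hf.contDiffOn hn (chart_mem_atlas E6 x)).contDiffAt
      (φ.open_target.mem_nhds (φ.map_source hx))).contMDiffAt
  have h2 : ContMDiffAt (𝓡 6) 𝓘(ℝ, E6) n φ x :=
    ((contMDiffOn_chart (chart_mem_atlas E6 x)).contMDiffAt (φ.open_source.mem_nhds hx)).of_le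
      (mod_cast le_top)
  refine (ContMDiffAt.comp x h1 h2).congr_of_eventuallyEq ?_
  filter_upwards [φ.open_source.mem_nhds hx] with z hz
  simp [φ.left_inv hz]

variable (g : Metric6 M)

theorem gradDot (hs : 5 < s) (hf : MemHs s f) (hh : MemHs s h) :
    MemHs (s - 1) (gradDot g f h) := by
  refine memHs_iff.2 fun φ hφ => ?_
  have hU := φ.open_target
  have e : EqOn (fun y => Warped.gradDot g f h (φ.symm y))
      (gradIn g φ (fun z => f (φ.symm z)) (fun z => h (φ.symm z))) φ.target := fun y hy =>
    gradDot_symm g hφ hy ((hf.contDiffAt_two hs hφ hy).differentiableAt (by norm_num))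
      ((hh.contDiffAt_two hs hφ hy).differentiableAt (by norm_num))
  refine HLoc.congr ?_ e
  have h3 : 3 < s - 1 := by linarith
  refine HLoc.sum hU _ fun i _ => HLoc.sum hU _ fun j _ => ?_
  exact ((HLoc.of_smooth hU (contDiffOn_gMat_inv g hφ i j)).mul hU h3
    ((memHs_iff.1 hf φ hφ).pd hU (by linarith) i)).mul hU h3
    ((memHs_iff.1 hh φ hφ).pd hU (by linarith) j)

theorem divGrad (hs : 6 < s) (hf : MemHs s f) (hh : MemHs s h) :
    MemHs (s - 2) (divGrad g f h) := by
  refine memHs_iff.2 fun φ hφ => ?_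
  have hU := φ.open_target
  have e : EqOn (fun y => Warped.divGrad g f h (φ.symm y))
      (divIn g φ (fun z => f (φ.symm z)) (fun z => h (φ.symm z))) φ.target := fun y hy =>
    divGrad_symm g hφ hy ((hf.contDiffAt_two (by linarith) hφ hy).differentiableAt (by norm_num))
      (hh.contDiffAt_two (by linarith) hφ hy)
  refine HLoc.congr ?_ e
  have h3 : 3 < s - 1 := by linarith
  have hflux : ∀ i, HLoc (s - 1) φ.target
      (fluxIn g φ (fun z => f (φ.symm z)) (fun z => h (φ.symm z)) i) := by
    intro i
    refine (((HLoc.of_smooth hU (contDiffOn_gDensity g hφ)).mul hU h3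
      ((memHs_iff.1 hf φ hφ).mono (by linarith))).mul hU h3 (HLoc.sum hU _ fun j _ => ?_))
    exact (HLoc.of_smooth hU (contDiffOn_gMat_inv g hφ i j)).mul hU h3
      ((memHs_iff.1 hh φ hφ).pd hU (by linarith) j)
  refine (HLoc.of_smooth hU ((contDiffOn_gDensity g hφ).inv fun y hy =>
    (gDensity_pos g hφ hy).ne')).mul hU (by linarith) (HLoc.sum hU _ fun i _ => ?_)
  have := (hflux i).pd hU (by linarith) i
  rwa [show s - 1 - 1 = s - 2 by ring] at this

theorem laplace (hs : 6 < s) (hf : MemHs s f) : MemHs (s - 2) (laplace g f) :=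
  MemHs.divGrad g hs (MemHs.const (M := M) 1) hf

end MemHs

theorem Form.MemHs.normSq {s : ℝ} (g : Metric6 M) (hs : 3 < s) {p : ℕ} {F : Form M p}
    (hF : F.MemHs s) : Warped.MemHs s (F.normSq g) := by
  refine Warped.memHs_iff.2 fun φ hφ => ?_
  have hU := φ.open_target
  have e : EqOn (fun y => F.normSq g (φ.symm y)) (fun y => (p.factorial : ℝ)⁻¹ *
      tensorForm (gMat g φ y)⁻¹ (fun i => F.comp φ i y)) φ.target :=
    fun y hy => F.normSq_symm g hφ hy
  refine HLoc.congr ?_ e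
  refine HLoc.const_mul _ (HLoc.sum hU _ fun i _ => HLoc.sum hU _ fun j _ => ?_)
  refine ((HLoc.prod hU hs _ fun k _ => ?_).mul hU hs (Form.memHs_iff.1 hF φ hφ i)).mul hU hs
    (Form.memHs_iff.1 hF φ hφ j)
  exact HLoc.of_smooth hU (contDiffOn_gMat_inv g hφ _ _)

end SobolevManifold

/-! ### Leibniz rules -/

section Leibniz

variable {M : Type*} [TopologicalSpace M] [ChartedSpace E6 M] [IsManifold (𝓡 6) ∞ M]
variable (g : Metric6 M)

theorem gradDot_comm (f h : M → ℝ) (x : M) : gradDot g f h x = gradDot g h f x := by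
  simp only [gradDot]
  rw [Finset.sum_comm]
  refine Finset.sum_congr rfl fun i _ => Finset.sum_congr rfl fun j _ => ?_
  have hs := (gMat_posDef g (chart_mem_atlas E6 x)
    ((chartAt E6 x).map_source (mem_chart_source E6 x))).inv.isHermitian
  have : ((gMat g (chartAt E6 x) (chartAt E6 x x))⁻¹) j i =
      ((gMat g (chartAt E6 x) (chartAt E6 x x))⁻¹) i j := by
    conv_lhs => rw [← hs]
    simp
  rw [this]
  ring

theorem gradDot_mul_right {f h k : M → ℝ} {x : M}
    (hh : DifferentiableAt ℝ (fun y => h ((chartAt E6 x).symm y)) (chartAt E6 x x))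
    (hk : DifferentiableAt ℝ (fun y => k ((chartAt E6 x).symm y)) (chartAt E6 x x)) :
    gradDot g f (fun z => h z * k z) x = h x * gradDot g f k x + k x * gradDot g f h x := by
  have e := (chartAt E6 x).left_inv (mem_chart_source E6 x)
  simp only [gradDot, pd_mul hh hk, e, Finset.mul_sum, ← Finset.sum_add_distrib]
  refine Finset.sum_congr rfl fun i _ => Finset.sum_congr rfl fun j _ => ?_
  ring

/-- The flux of a product is `f · flux h + h · flux f`; differentiating leaves two cross terms,
which agree because the inverse metric is symmetric. -/
theorem laplace_mul {f h : M → ℝ} {x : M}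
    (hf : ContDiffAt ℝ 2 (fun y => f ((chartAt E6 x).symm y)) (chartAt E6 x x))
    (hh : ContDiffAt ℝ 2 (fun y => h ((chartAt E6 x).symm y)) (chartAt E6 x x)) :
    laplace g (fun z => f z * h z) x =
      f x * laplace g h x + h x * laplace g f x + 2 * gradDot g f h x := by
  have hc := chart_mem_atlas E6 x
  have hx := mem_chart_source E6 x
  have hy : chartAt E6 x x ∈ (chartAt E6 x).target := (chartAt E6 x).map_source hx
  have ex := (chartAt E6 x).left_inv hx
  have hgc := gradDot_comm g f h x
  rw [two_mul]
  nth_rw 2 [hgc]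
  simp only [laplace]
  set φ := chartAt E6 x
  set y := φ x
  set F := fun y => f (φ.symm y) with hF
  set H := fun y => h (φ.symm y) with hH
  have fx : f x = F y := by simp only [hF]; rw [ex]
  have hx' : h x = H y := by simp only [hH]; rw [ex]
  have hFd := hf.differentiableAt (by norm_num)
  have hHd := hh.differentiableAt (by norm_num)
  have d1 := fun i => differentiableAt_fluxIn g hc hy (differentiableAt_const (1 : ℝ)) hf i
  have d2 := fun i => differentiableAt_fluxIn g hc hy (differentiableAt_const (1 : ℝ)) hh i
  have key : ∀ i, fluxIn g φ (fun _ => 1) (fun z => F z * H z) i =ᶠ[𝓝 y]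
      fun z => F z * fluxIn g φ (fun _ => 1) H i z + H z * fluxIn g φ (fun _ => 1) F i z := by
    intro i
    filter_upwards [hf.eventually (by simp), hh.eventually (by simp)] with z h1 h2
    simp only [fluxIn, pd_mul (h1.differentiableAt (by norm_num)) (h2.differentiableAt
      (by norm_num)), Finset.mul_sum, ← Finset.sum_add_distrib]
    exact Finset.sum_congr rfl fun j _ => by ring
  have key2 : ∀ i, pd i (fluxIn g φ (fun _ => 1) (fun z => F z * H z) i) y =
      pd i F y * fluxIn g φ (fun _ => 1) H i y + F y * pd i (fluxIn g φ (fun _ => 1) H i) y +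
      (pd i H y * fluxIn g φ (fun _ => 1) F i y + H y * pd i (fluxIn g φ (fun _ => 1) F i) y) := by
    intro i
    rw [pd_congr (key i), pd_add (hFd.fun_mul (d2 i)) (hHd.fun_mul (d1 i)), pd_mul hFd (d2 i),
      pd_mul hHd (d1 i)]
  have key3 : ∀ A B : E6 → ℝ, (gDensity g φ y)⁻¹ * ∑ i, pd i A y * fluxIn g φ (fun _ => 1) B i y =
      gradIn g φ A B y := by
    intro A B
    have h0 := (gDensity_pos g hc hy).ne'
    simp only [fluxIn, gradIn, Finset.mul_sum]
    refine Finset.sum_congr rfl fun i _ => Finset.sum_congr rfl fun j _ => ?_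
    field_simp
  rw [fx, hx']
  change (gDensity g φ y)⁻¹ * ∑ i, pd i (fluxIn g φ (fun _ => 1) (fun z => F z * H z) i) y =
    F y * ((gDensity g φ y)⁻¹ * ∑ i, pd i (fluxIn g φ (fun _ => 1) H i) y) +
    H y * ((gDensity g φ y)⁻¹ * ∑ i, pd i (fluxIn g φ (fun _ => 1) F i) y) +
    (gradIn g φ F H y + gradIn g φ H F y)
  simp only [key2, Finset.sum_add_distrib, mul_add, key3, ← Finset.mul_sum]
  ring

end Leibniz

/-! ### The volume measure -/

section Volume

variable {M : Type*} [TopologicalSpace M] [ChartedSpace E6 M] [IsManifold (𝓡 6) ∞ M]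
  (g : Metric6 M) [T2Space M] [CompactSpace M]

/-- The density in the chart at `c` of the part of the volume measure cut out by `ρ_c`. -/
def volDensity (c : M) (y : E6) : ℝ :=
  chartPartition M c ((chartAt E6 c).symm y) * gDensity g (chartAt E6 c) y

theorem tsupport_chartPartition (c : M) :
    tsupport (chartPartition M c) ⊆ (chartAt E6 c).source :=
  (SmoothPartitionOfUnity.exists_isSubordinate_chartAt_source (𝓡 6) M).choose_spec c

variable [MeasurableSpace M]

/-- The summand of the volume measure belonging to the chart at `c`. -/
def volPiece (c : M) : Measure M :=
  (((volume : Measure E6).restrict (chartAt E6 c).target).withDensity fun y =>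
    ENNReal.ofReal (volDensity g c y)).map (chartAt E6 c).symm

theorem vol_eq_sum : vol g = Measure.sum (volPiece g) := rfl

variable [BorelSpace M]

theorem volPiece_univ (c : M) :
    volPiece g c univ = ∫⁻ y in (chartAt E6 c).target, ENNReal.ofReal (volDensity g c y) := by
  have hm : AEMeasurable (chartAt E6 c).symm
      (((volume : Measure E6).restrict (chartAt E6 c).target).withDensity fun y =>
        ENNReal.ofReal (volDensity g c y)) :=
    ((chartAt E6 c).continuousOn_symm.aemeasurable
      (chartAt E6 c).open_target.measurableSet).mono_ac (withDensity_absolutelyContinuous _ _)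
  rw [volPiece, Measure.map_apply_of_aemeasurable hm MeasurableSet.univ, preimage_univ,
    withDensity_apply _ MeasurableSet.univ, Measure.restrict_univ]

theorem volPiece_univ_lt_top (c : M) : volPiece g c univ < ⊤ := by
  rw [volPiece_univ]
  set φ := chartAt E6 c with hφ
  have hK : IsCompact (φ '' tsupport (chartPartition M c)) :=
    (isClosed_tsupport _).isCompact.image_of_continuousOn
      (φ.continuousOn.mono (tsupport_chartPartition c))
  have hKt : φ '' tsupport (chartPartition M c) ⊆ φ.target := by
    rintro _ ⟨x, hx, rfl⟩
    exact φ.map_source (tsupport_chartPartition c hx)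
  -- The density is supported over the compact image of the support of `ρ_c`, where it is bounded.
  obtain ⟨B, hB⟩ := hK.exists_bound_of_continuousOn
    ((contDiffOn_gDensity g (chart_mem_atlas E6 c)).continuousOn.mono hKt)
  refine (setLIntegral_mono' φ.open_target.measurableSet (fun y hy => ?_) :
    _ ≤ ∫⁻ y in φ.target, (φ '' tsupport (chartPartition M c)).indicator
      (fun _ => ENNReal.ofReal B) y).trans_lt ?_
  · by_cases hyK : y ∈ φ '' tsupport (chartPartition M c)
    · rw [indicator_of_mem hyK]
      refine ENNReal.ofReal_le_ofReal ?_
      have h1 := (chartPartition M).le_one c (φ.symm y)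
      have h0 := (chartPartition M).nonneg c (φ.symm y)
      have h2 := gDensity_pos g (chart_mem_atlas E6 c) hy
      have h3 := (le_abs_self _).trans (hB y hyK)
      rw [volDensity]
      nlinarith
    · have : chartPartition M c (φ.symm y) = 0 := by
        by_contra hne
        exact hyK ⟨φ.symm y, subset_tsupport _ hne, φ.right_inv hy⟩
      rw [volDensity, ← hφ, this]
      simp
  · rw [lintegral_indicator hK.measurableSet, setLIntegral_const]
    exact ENNReal.mul_lt_top ENNReal.ofReal_lt_top
      ((Measure.restrict_apply_le _ _).trans_lt hK.measure_lt_top)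

instance isFiniteMeasure_vol : IsFiniteMeasure (vol g) := by
  refine ⟨?_⟩
  rw [vol_eq_sum, Measure.sum_apply _ MeasurableSet.univ]
  -- By local finiteness and compactness only finitely many `ρ_c` are not identically zero, so the
  -- sum of measures is finite.
  have hfin : {c : M | (Function.support (chartPartition M c)).Nonempty}.Finite :=
    (chartPartition M).locallyFinite.finite_nonempty_of_compact
  rw [tsum_eq_sum (s := hfin.toFinset)]
  · exact ENNReal.sum_lt_top.2 fun c _ => volPiece_univ_lt_top g c
  · intro c hc
    have h0 : ∀ x, chartPartition M c x = 0 := by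
      intro x
      by_contra hx
      exact hc (hfin.mem_toFinset.2 ⟨x, hx⟩)
    rw [volPiece_univ]
    simp [volDensity, h0]

/-- Some `ρ_c` is positive at a given point, so the density of that piece is bounded below on an
open set. -/
theorem vol_univ_pos [Nonempty M] : 0 < vol g univ := by
  obtain ⟨x⟩ := ‹Nonempty M›
  obtain ⟨c, hc⟩ := (chartPartition M).exists_pos_of_mem (mem_univ x)
  set φ := chartAt E6 c with hφ
  have hx : x ∈ φ.source := tsupport_chartPartition c (subset_tsupport _ hc.ne')
  have hy : φ x ∈ φ.target := φ.map_source hx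
  have hpos : 0 < volDensity g c (φ x) := by
    rw [volDensity, ← hφ, φ.left_inv hx]
    exact mul_pos hc (gDensity_pos g (chart_mem_atlas E6 c) hy)
  have hcont : ContinuousAt (volDensity g c) (φ x) := by
    have h1 : ContinuousAt (fun y => chartPartition M c (φ.symm y)) (φ x) :=
      (chartPartition M c).contMDiff.continuous.continuousAt.comp (φ.continuousAt_symm hy)
    exact h1.mul ((contDiffOn_gDensity g (chart_mem_atlas E6 c)).continuousOn.continuousAt
      (φ.open_target.mem_nhds hy))
  have hev := (hcont.eventually_const_lt (half_lt_self hpos)).and (φ.open_target.mem_nhds hy)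
  obtain ⟨O, hO, hOo, hxO⟩ := eventually_nhds_iff.1 hev
  have h1 : 0 < volPiece g c univ := by
    rw [volPiece_univ]
    calc 0 < ENNReal.ofReal (volDensity g c (φ x) / 2) * volume O :=
          ENNReal.mul_pos (by simpa using hpos) (hOo.measure_pos _ ⟨_, hxO⟩).ne'
      _ = ∫⁻ _ in O, ENNReal.ofReal (volDensity g c (φ x) / 2) := by rw [setLIntegral_const]
      _ ≤ ∫⁻ y in O, ENNReal.ofReal (volDensity g c y) :=
          setLIntegral_mono' hOo.measurableSet fun y hy => ENNReal.ofReal_le_ofReal (hO y hy).1.le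
      _ ≤ _ := lintegral_mono_set fun y hy => (hO y hy).2
  refine h1.trans_le ?_
  rw [vol_eq_sum]
  exact Measure.le_sum_apply _ _ |>.trans' (by
    rw [← Measure.sum_apply _ MeasurableSet.univ]
    exact Measure.le_iff'.1 (Measure.le_sum _ c) univ)

theorem integrable_of_continuous {f : M → ℝ} (hf : Continuous f) : Integrable f (vol g) :=
  hf.integrable_of_hasCompactSupport (HasCompactSupport.of_compactSpace f)

end Volume

/-! ### Sobolev neighbourhoods are `C²` small -/

/-- The Sobolev embedding `H^s ⊂ C²` for `s > 5`, with bounds. -/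
theorem exists_sobolev_const {s : ℝ} (hs : 5 < s) : ∃ C : ENNReal, C < ⊤ ∧ ∀ k : E6 → ℝ,
    ContDiff ℝ 2 k → HasCompactSupport k → ∀ y i j, ‖k y‖ₑ ^ 2 ≤ C * hsSq s k ∧
      ‖pd i k y‖ₑ ^ 2 ≤ C * hsSq s k ∧ ‖pd i (pd j k) y‖ₑ ^ 2 ≤ C * hsSq s k := by
  set J : ENNReal := 1 + ∫⁻ ξ : E6, ENNReal.ofReal ((1 + ‖ξ‖ ^ 2) ^ (-(s - 2))) with hJ
  set P : ENNReal := ENNReal.ofReal ((2 * Real.pi) ^ 2)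
  -- Each derivative costs a factor `P`; as `P ≥ 1`, the single constant `J P²` serves orders zero,
  -- one and two.
  have hP : 1 ≤ P := by
    rw [← ENNReal.ofReal_one]
    refine ENNReal.ofReal_le_ofReal ?_
    nlinarith [Real.pi_gt_three]
  refine ⟨J * (P * P), ENNReal.mul_lt_top ?_ (by simp [P, ENNReal.mul_lt_top]), ?_⟩
  · exact ENNReal.add_lt_top.2 ⟨by simp, lintegral_japanese_lt_top (by linarith)⟩
  intro k hk hc y i j
  have hk1 : ContDiff ℝ 1 k := hk.of_le (by norm_num)
  have hpd : ∀ i, ContDiff ℝ 1 (pd i k) := fun i => pd_contDiff (k := 1) (by exact_mod_cast hk) i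
  have sob : ∀ {h : E6 → ℝ}, Continuous h → HasCompactSupport h → ∀ y,
      ‖h y‖ₑ ^ 2 ≤ J * hsSq (s - 2) h := fun hc hs y => enorm_sq_le_hsSq (by linarith) hc hs y
  have b1 : ∀ i, hsSq (s - 1) (pd i k) ≤ P * hsSq s k := fun i => by
    simpa using hsSq_pd_le (s := s - 1) hk1 hc i
  have b2 : hsSq (s - 2) (pd i (pd j k)) ≤ P * hsSq (s - 1) (pd j k) := by
    have := hsSq_pd_le (s := s - 2) (hpd j) (hasCompactSupport_pd hc j) i
    rwa [show s - 2 + 1 = s - 1 by ring] at this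
  refine ⟨?_, ?_, ?_⟩
  · calc _ ≤ J * hsSq (s - 2) k := sob hk.continuous hc y
      _ ≤ J * hsSq s k := by gcongr; exact hsSq_mono (by linarith) k
      _ ≤ J * (P * P) * hsSq s k := by
        gcongr
        exact le_mul_of_one_le_right' (one_le_mul hP hP)
  · calc _ ≤ J * hsSq (s - 2) (pd i k) := sob (hpd i).continuous (hasCompactSupport_pd hc i) y
      _ ≤ J * hsSq (s - 1) (pd i k) := by gcongr; exact hsSq_mono (by linarith) _
      _ ≤ J * (P * hsSq s k) := by gcongr; exact b1 i
      _ ≤ J * (P * P) * hsSq s k := by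
        rw [mul_assoc]
        gcongr
        exact le_mul_of_one_le_right' hP
  · calc _ ≤ J * hsSq (s - 2) (pd i (pd j k)) :=
        sob (pd_contDiff (k := 0) (by simpa using hpd j) i).continuous
          (hasCompactSupport_pd (hasCompactSupport_pd hc j) i) y
      _ ≤ J * (P * (P * hsSq s k)) := by gcongr; exact b2.trans (by gcongr; exact b1 j)
      _ = _ := by ring

/-- Uniform `C²` bounds for local Sobolev functions where the cutoff equals one. -/
theorem exists_local_bound {s : ℝ} (hs : 5 < s) {δ : ℝ} (hδ : 0 < δ) : ∃ ε : ENNReal, 0 < ε ∧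
    ∀ (U : Set E6) (η h : E6 → ℝ), IsOpen U → IsTest U η → HLoc s U h →
      hsNorm s (fun y => η y * h y) < ε → ∀ y, (∀ᶠ z in 𝓝 y, η z = 1) → ∀ i j,
        |h y| ≤ δ ∧ |pd i h y| ≤ δ ∧ |pd i (pd j h) y| ≤ δ := by
  obtain ⟨C, hC, hb⟩ := exists_sobolev_const hs
  have hex : ∃ ε : ENNReal, 0 < ε ∧ C * ε ^ 2 ≤ ENNReal.ofReal (δ ^ 2) := by
    refine ⟨ENNReal.ofReal (δ / (C.toReal + 1)), by simp; positivity, ?_⟩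
    rw [← ENNReal.ofReal_toReal hC.ne, ← ENNReal.ofReal_pow (by positivity),
      ← ENNReal.ofReal_mul (by positivity)]
    refine ENNReal.ofReal_le_ofReal ?_
    have hc0 : 0 ≤ C.toReal := ENNReal.toReal_nonneg
    rw [ENNReal.toReal_ofReal hc0, div_pow, mul_div_assoc', div_le_iff₀ (by positivity)]
    have : 0 ≤ δ ^ 2 := by positivity
    nlinarith [mul_nonneg this hc0, mul_nonneg this (mul_nonneg hc0 hc0)]
  obtain ⟨ε, hε, hCε⟩ := hex
  refine ⟨ε, hε, fun U η h hU hη hh hn y hy i j => ?_⟩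
  have hC2 : ContDiffOn ℝ (2 : ℕ) h U := hh.contDiffOn hU (by norm_num; linarith)
  have hk : ContDiff ℝ (2 : ℕ) fun y => η y * h y := hη.contDiff_mul hU hC2
  have hsq : C * hsSq s (fun y => η y * h y) ≤ ENNReal.ofReal (δ ^ 2) := by
    rw [← hsNorm_sq]
    refine le_trans ?_ hCε
    gcongr
  have e0 : (fun y => η y * h y) =ᶠ[𝓝 y] h := by
    filter_upwards [hy] with z hz
    rw [hz, one_mul]
  have e1 : pd j (fun y => η y * h y) =ᶠ[𝓝 y] pd j h := by
    filter_upwards [e0.eventuallyEq_nhds] with z hz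
    exact pd_congr hz j
  have conv : ∀ t : ℝ, ‖t‖ₑ ^ 2 ≤ C * hsSq s (fun y => η y * h y) → |t| ≤ δ := by
    intro t ht
    have := ht.trans hsq
    rw [← ofReal_norm, ← ENNReal.ofReal_pow (norm_nonneg _),
      ENNReal.ofReal_le_ofReal_iff (by positivity), Real.norm_eq_abs] at this
    exact abs_le_of_sq_le_sq (by simpa using this) hδ.le
  obtain ⟨b0, b1, b2⟩ := hb _ (by exact_mod_cast hk) (hη.compact_mul h) y i j
  exact ⟨conv _ (by simpa [e0.self_of_nhds] using b0), conv _ (by rwa [pd_congr e0] at b1),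
    conv _ (by rwa [pd_congr e1] at b2)⟩

theorem abs_sum_sum_le {K δ : ℝ} {c : Fin 6 → Fin 6 → ℝ} (h : ∀ i j, |c i j| ≤ K * δ) :
    |∑ i, ∑ j, c i j| ≤ 36 * (K * δ) := by
  calc |∑ i, ∑ j, c i j| ≤ ∑ i, ∑ j, |c i j| :=
        (Finset.abs_sum_le_sum_abs _ _).trans (Finset.sum_le_sum fun i _ =>
          Finset.abs_sum_le_sum_abs _ _)
    _ ≤ ∑ _i : Fin 6, ∑ _j : Fin 6, K * δ :=
        Finset.sum_le_sum fun i _ => Finset.sum_le_sum fun j _ => h i j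
    _ = _ := by simp; ring

section Neighbourhoods

variable {M : Type*} [TopologicalSpace M] [ChartedSpace E6 M]

theorem eventually_memHs {s : ℝ} (f₀ : M → ℝ) : ∀ᶠ f in hsNhds s f₀, MemHs s f :=
  mem_inf_of_right (mem_principal_self _)

theorem eventually_locNorm_lt {s : ℝ} (f₀ : M → ℝ) {φ : OpenPartialHomeomorph M E6}
    (hφ : φ ∈ atlas E6 M) {χ : M → ℝ} (hχ : χ ∈ Cutoff φ) {ε : ENNReal} (hε : 0 < ε) :
    ∀ᶠ f in hsNhds s f₀, locNorm s φ χ (fun y => f (φ.symm y) - f₀ (φ.symm y)) < ε := by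
  refine mem_inf_of_left ?_
  refine mem_iInf_of_mem φ (mem_iInf_of_mem hφ (mem_iInf_of_mem χ (mem_iInf_of_mem hχ
    (mem_iInf_of_mem ε (mem_iInf_of_mem hε (mem_principal_self _))))))

variable [IsManifold (𝓡 6) ∞ M] (g : Metric6 M)

/-- Expanding the divergence exhibits the Laplacian as a combination of first and second partial
derivatives with coefficients continuous on the chart, hence bounded on compact sets. -/
theorem divIn_one_eq {φ : OpenPartialHomeomorph M E6} (hφ : φ ∈ atlas E6 M) {y : E6}
    (hy : y ∈ φ.target) {u : E6 → ℝ} (hu : ContDiffAt ℝ 2 u y) :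
    divIn g φ (fun _ => 1) u y = ∑ i, ∑ j,
      ((gDensity g φ y)⁻¹ * pd i (fun z => gDensity g φ z * (gMat g φ z)⁻¹ i j) y * pd j u y +
        (gMat g φ y)⁻¹ i j * pd i (pd j u) y) := by
  have hn := φ.open_target.mem_nhds hy
  have h0 := (gDensity_pos g hφ hy).ne'
  have h1 : DifferentiableAt ℝ (gDensity g φ) y :=
    ((contDiffOn_gDensity g hφ).contDiffAt hn).differentiableAt (by simp)
  have h2 : ∀ i j, DifferentiableAt ℝ (fun y => (gMat g φ y)⁻¹ i j) y := fun i j =>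
    ((contDiffOn_gMat_inv g hφ i j).contDiffAt hn).differentiableAt (by simp)
  have h3 : ∀ j, DifferentiableAt ℝ (pd j u) y := fun j =>
    ((hu.fderiv_right (m := 1) (by norm_num)).clm_apply contDiffAt_const).differentiableAt
      one_ne_zero
  have e : ∀ i, fluxIn g φ (fun _ => 1) u i =
      fun z => ∑ j, gDensity g φ z * (gMat g φ z)⁻¹ i j * pd j u z := by
    intro i
    ext z
    simp only [fluxIn, mul_one, Finset.mul_sum, mul_assoc]
  simp only [divIn, e, Finset.mul_sum]
  refine Finset.sum_congr rfl fun i _ => ?_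
  rw [pd_sum _ (f := fun j z => gDensity g φ z * (gMat g φ z)⁻¹ i j * pd j u z)
    (fun j _ => (h1.fun_mul (h2 i j)).fun_mul (h3 j)), Finset.mul_sum]
  refine Finset.sum_congr rfl fun j _ => ?_
  rw [pd_mul (h1.fun_mul (h2 i j)) (h3 j)]
  field_simp

variable [T2Space M] [CompactSpace M]

/-- Near every point, the functions near `1` in `H^s` are `C²` close to `1`. -/
theorem exists_nhds_eventually_pd_le {s : ℝ} (hs : 5 < s) (x : M) :
    ∃ K : Set E6, IsCompact K ∧ K ⊆ (chartAt E6 x).target ∧ K ∈ 𝓝 (chartAt E6 x x) ∧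
      ∀ δ : ℝ, 0 < δ → ∀ᶠ f in hsNhds s (fun _ : M => (1 : ℝ)), ∀ y ∈ K, ∀ i j,
        |f ((chartAt E6 x).symm y) - 1| ≤ δ ∧
        |pd i (fun z => f ((chartAt E6 x).symm z)) y| ≤ δ ∧
        |pd i (pd j (fun z => f ((chartAt E6 x).symm z))) y| ≤ δ := by
  have hφ := chart_mem_atlas E6 x
  set φ := chartAt E6 x
  have hy : φ x ∈ φ.target := φ.map_source (mem_chart_source E6 x)
  obtain ⟨K, hK, hxK, hKt⟩ := exists_compact_subset φ.open_target hy
  obtain ⟨η, hη, hη1⟩ := exists_isTest φ.open_target hK hKt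
  obtain ⟨χ, hχ, hχη⟩ := hη.exists_cutoff hφ
  refine ⟨K, hK, hKt, mem_interior_iff_mem_nhds.1 hxK, fun δ hδ => ?_⟩
  obtain ⟨ε, hε, H⟩ := exists_local_bound hs hδ
  filter_upwards [eventually_memHs (s := s) (fun _ : M => (1 : ℝ)),
    eventually_locNorm_lt (s := s) (fun _ : M => (1 : ℝ)) hφ hχ hε] with f hf hlt y hyK i j
  have h1 : HLoc s φ.target fun y => f (φ.symm y) - 1 :=
    memHs_iff.1 (hf.sub (MemHs.const 1)) φ hφ
  rw [locNorm_eq, hχη] at hlt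
  obtain ⟨b0, b1, b2⟩ := H φ.target η _ φ.open_target hη h1 hlt y
    (eventually_nhdsSet_iff_forall.1 hη1 y hyK) i j
  have e : ∀ i, pd i (fun y => f (φ.symm y) - 1) = pd i fun y => f (φ.symm y) := by
    intro i
    ext z
    simp only [pd, fderiv_sub_const]
  rw [e] at b1 b2
  exact ⟨b0, b1, b2⟩

/-- `v` and `u` are `C²` close to `1` at `x`, as measured by invariant quantities. -/
def CloseAt (δ : ℝ) (v u : M → ℝ) (x : M) : Prop :=
  |v x - 1| ≤ δ ∧ |u x - 1| ≤ δ ∧ |laplace g v x| ≤ δ ∧ |laplace g u x| ≤ δ ∧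
    |gradDot g u v x| ≤ δ ∧ |gradDot g u u x| ≤ δ

theorem exists_nhds_eventually_closeAt {s : ℝ} (hs : 5 < s) (x : M) :
    ∃ V ∈ 𝓝 x, ∀ δ : ℝ, 0 < δ → ∀ᶠ w : (M → ℝ) × (M → ℝ) in
      hsNhds s (fun _ => 1) ×ˢ hsNhds s (fun _ => 1), ∀ z ∈ V, CloseAt g δ w.1 w.2 z := by
  obtain ⟨K, hK, hKt, hxK, hb⟩ := exists_nhds_eventually_pd_le hs x
  have hφ := chart_mem_atlas E6 x
  set φ := chartAt E6 x
  have hx : x ∈ φ.source := mem_chart_source E6 x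
  have hbd : ∀ c : E6 → ℝ, ContinuousOn c φ.target → ∃ B, ∀ y ∈ K, |c y| ≤ B := fun c hc => by
    simpa using hK.exists_bound_of_continuousOn (hc.mono hKt)
  choose B1 hB1 using fun i j => hbd _ (contDiffOn_gMat_inv g hφ i j).continuousOn
  have hcd : ∀ i j, ContinuousOn (fun y => (gDensity g φ y)⁻¹ *
      pd i (fun z => gDensity g φ z * (gMat g φ z)⁻¹ i j) y) φ.target := fun i j =>
    ((contDiffOn_gDensity g hφ).continuousOn.inv₀ fun y hy => (gDensity_pos g hφ hy).ne').mul
      ((((contDiffOn_gDensity g hφ).mul (contDiffOn_gMat_inv g hφ i j)).continuousOn_fderiv_of_isOpen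
        φ.open_target (by simp)).clm_apply continuousOn_const)
  choose B2 hB2 using fun i j => hbd _ (hcd i j)
  obtain ⟨B, hB0, hB⟩ : ∃ B : ℝ, 0 ≤ B ∧ ∀ i j, B1 i j ≤ B ∧ B2 i j ≤ B := by
    refine ⟨∑ i, ∑ j, (|B1 i j| + |B2 i j|), by positivity, fun i j => ?_⟩
    have : |B1 i j| + |B2 i j| ≤ ∑ i, ∑ j, (|B1 i j| + |B2 i j|) :=
      (Finset.single_le_sum (f := fun j => |B1 i j| + |B2 i j|) (fun _ _ => by positivity)
        (Finset.mem_univ j)).trans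
      (Finset.single_le_sum (f := fun i => ∑ j, (|B1 i j| + |B2 i j|))
        (fun _ _ => by positivity) (Finset.mem_univ i))
    constructor <;> linarith [le_abs_self (B1 i j), le_abs_self (B2 i j), abs_nonneg (B1 i j),
      abs_nonneg (B2 i j)]
  refine ⟨φ.source ∩ φ ⁻¹' K, inter_mem (φ.open_source.mem_nhds hx)
    ((φ.continuousAt hx).preimage_mem_nhds hxK), fun δ hδ => ?_⟩
  -- The Laplacian is a sum of `36` terms, each at most `2Bε`, whence `72`. The bound `ε ≤ 1`
  -- handles the products of two first derivatives.
  set ε : ℝ := min (min 1 δ) (δ / (72 * (B + 1))) with hε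
  have hε0 : 0 < ε := by positivity
  have hε1 : ε ≤ 1 := (min_le_left _ _).trans (min_le_left _ _)
  have hεδ : ε ≤ δ := (min_le_left _ _).trans (min_le_right _ _)
  have hε2 : 72 * (B * ε) ≤ δ := by
    have : ε ≤ δ / (72 * (B + 1)) := min_le_right _ _
    rw [le_div_iff₀ (by positivity)] at this
    nlinarith
  have hgood : ∀ᶠ f in hsNhds s (fun _ : M => (1 : ℝ)), MemHs s f ∧ ∀ y ∈ K, ∀ i j,
      |f (φ.symm y) - 1| ≤ ε ∧ |pd i (fun z => f (φ.symm z)) y| ≤ ε ∧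
        |pd i (pd j (fun z => f (φ.symm z))) y| ≤ ε :=
    (eventually_memHs _).and (hb ε hε0)
  have hgrad : ∀ f h : M → ℝ, MemHs s f → MemHs s h →
      (∀ y ∈ K, ∀ i, |pd i (fun z => f (φ.symm z)) y| ≤ ε) →
      (∀ y ∈ K, ∀ i, |pd i (fun z => h (φ.symm z)) y| ≤ ε) →
      ∀ z ∈ φ.source ∩ φ ⁻¹' K, |gradDot g f h z| ≤ δ := by
    intro f h hf hh bf bh z hz
    have hzt := φ.map_source hz.1
    have e := gradDot_symm g hφ hzt (u := f) (w := h)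
      ((hf.contDiffAt_two hs hφ hzt).differentiableAt (by norm_num))
      ((hh.contDiffAt_two hs hφ hzt).differentiableAt (by norm_num))
    rw [φ.left_inv hz.1] at e
    rw [e]
    refine (abs_sum_sum_le (K := B) (δ := ε) fun i j => ?_).trans (by
      have := mul_nonneg hB0 hε0.le; linarith)
    rw [abs_mul, abs_mul]
    calc _ ≤ B * ε * ε := by
          gcongr
          · exact (hB1 i j _ hz.2).trans (hB i j).1
          · exact bf _ hz.2 i
          · exact bh _ hz.2 j
      _ ≤ B * ε := mul_le_of_le_one_right (by positivity) hε1
  have hlap : ∀ f : M → ℝ, MemHs s f →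
      (∀ y ∈ K, ∀ i j, |f (φ.symm y) - 1| ≤ ε ∧ |pd i (fun z => f (φ.symm z)) y| ≤ ε ∧
        |pd i (pd j (fun z => f (φ.symm z))) y| ≤ ε) →
      ∀ z ∈ φ.source ∩ φ ⁻¹' K, |laplace g f z| ≤ δ := by
    intro f hf bf z hz
    have hzt := φ.map_source hz.1
    have hf2 := hf.contDiffAt_two hs hφ hzt
    have e : laplace g f z = divIn g φ (fun _ => 1) (fun z => f (φ.symm z)) (φ z) := by
      have := divGrad_symm g hφ hzt (u := f) (w := fun _ => 1) (differentiableAt_const _) hf2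
      rwa [φ.left_inv hz.1] at this
    rw [e, divIn_one_eq g hφ hzt hf2]
    refine (abs_sum_sum_le (K := 2 * B) (δ := ε) fun i j => ?_).trans (by linarith)
    refine (abs_add_le _ _).trans ?_
    rw [abs_mul, abs_mul (_⁻¹ : ℝ), abs_mul ((gMat g φ (φ z))⁻¹ i j), ← abs_mul _⁻¹]
    have h1 := (hB2 i j _ hz.2).trans (hB i j).2
    have h2 := (hB1 i j _ hz.2).trans (hB i j).1
    have h3 := (bf _ hz.2 j j).2.1
    have h4 := (bf _ hz.2 i j).2.2
    calc _ ≤ B * ε + B * ε := by gcongr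
      _ = _ := by ring
  filter_upwards [hgood.prod_mk hgood] with w hw z hz
  obtain ⟨⟨hv, bv⟩, hu, bu⟩ := hw
  have hval : ∀ f : M → ℝ, (∀ y ∈ K, ∀ i j, |f (φ.symm y) - 1| ≤ ε ∧
      |pd i (fun z => f (φ.symm z)) y| ≤ ε ∧ |pd i (pd j (fun z => f (φ.symm z))) y| ≤ ε) →
      |f z - 1| ≤ δ := by
    intro f bf
    have := (bf _ hz.2 0 0).1
    rw [φ.left_inv hz.1] at this
    exact this.trans hεδ
  exact ⟨hval _ bv, hval _ bu, hlap _ hv bv z hz, hlap _ hu bu z hz,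
    hgrad _ _ hu hv (fun y hy i => (bu y hy i i).2.1) (fun y hy i => (bv y hy i i).2.1) z hz,
    hgrad _ _ hu hu (fun y hy i => (bu y hy i i).2.1) (fun y hy i => (bu y hy i i).2.1) z hz⟩

theorem eventually_closeAt {s : ℝ} (hs : 5 < s) {δ : ℝ} (hδ : 0 < δ) :
    ∀ᶠ w : (M → ℝ) × (M → ℝ) in hsNhds s (fun _ => 1) ×ˢ hsNhds s (fun _ => 1),
      MemHs s w.1 ∧ MemHs s w.2 ∧ ∀ z, CloseAt g δ w.1 w.2 z := by
  have key : ∀ᶠ w : (M → ℝ) × (M → ℝ) in hsNhds s (fun _ => 1) ×ˢ hsNhds s (fun _ => 1),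
      ∀ z ∈ (univ : Set M), CloseAt g δ w.1 w.2 z := by
    -- The local neighbourhoods `V` do not depend on `v`, `u`, so finitely many cover `M` and the
    -- finitely many conditions intersect.
    refine isCompact_univ.induction_on (p := fun S => ∀ᶠ w : (M → ℝ) × (M → ℝ) in
      hsNhds s (fun _ => 1) ×ˢ hsNhds s (fun _ => 1), ∀ z ∈ S, CloseAt g δ w.1 w.2 z) ?_ ?_ ?_ ?_
    · exact Eventually.of_forall fun _ _ h => h.elim
    · exact fun S T hST hT => hT.mono fun w hw z hz => hw z (hST hz)
    · intro S T hS hT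
      filter_upwards [hS, hT] with w h1 h2 z hz
      exact hz.elim (h1 z) (h2 z)
    · intro x _
      obtain ⟨V, hV, h⟩ := exists_nhds_eventually_closeAt g hs x
      exact ⟨V, by simpa using hV, h δ hδ⟩
  filter_upwards [key, (eventually_memHs (s := s) (fun _ : M => (1 : ℝ))).prod_mk
    (eventually_memHs (s := s) (fun _ : M => (1 : ℝ)))] with w h1 h2
  exact ⟨h2.1, h2.2, fun z => h1 z (mem_univ z)⟩

end Neighbourhoods

/-! ### The equations of motion as definitions of `2R - |F₁|²` and `|F₃|² - 2T` -/

section Equations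

variable {M : Type*} [TopologicalSpace M] [ChartedSpace E6 M] [IsManifold (𝓡 6) ∞ M]
  (g : Metric6 M)

theorem Form.normSq_zero {p : ℕ} (x : M) : (0 : Form M p).normSq g x = 0 := by
  have : ∀ (φ : OpenPartialHomeomorph M E6) (i : Fin p → Fin 6) (y : E6),
      (0 : Form M p).comp φ i y = 0 := fun _ _ _ => rfl
  simp [Form.normSq, this]

variable {D : FieldData M}

theorem FieldData.IsTypeIIB.sum_normSq (hD : D.IsTypeIIB) (t : ℝ) (x : M) :
    ∑ p ∈ Finset.range 7, t ^ (3 - (p : ℤ)) * (D.F p).normSq g x =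
      t ^ 2 * (D.F 1).normSq g x + (D.F 3).normSq g x + t⁻¹ ^ 2 * (D.F 5).normSq g x := by
  obtain ⟨-, h0, h2, h4, h6⟩ := hD
  simp only [Finset.sum_range_succ, Finset.sum_range_zero, h0, h2, h4, h6, Form.normSq_zero]
  norm_num

theorem FieldData.IsTypeIIB.sum_deriv_normSq (hD : D.IsTypeIIB) (t : ℝ) (x : M) :
    ∑ p ∈ Finset.range 7, (3 - (p : ℝ)) * t ^ (2 - (p : ℤ)) * (D.F p).normSq g x =
      2 * t * (D.F 1).normSq g x - 2 * t⁻¹ ^ 3 * (D.F 5).normSq g x := by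
  obtain ⟨-, h0, h2, h4, h6⟩ := hD
  simp only [Finset.sum_range_succ, Finset.sum_range_zero, h0, h2, h4, h6, Form.normSq_zero]
  norm_num
  ring

/-- The value of `2R - |F₁|²` forced by the equation of motion of the conformal factor. -/
def curvatureTerm (α β : ℝ) (F : Form M 5) (v u : M → ℝ) (x : M) : ℝ :=
  (5 * laplace g (fun z => u z ^ 2 * v z) x + 5 * (u x ^ 2 * laplace g v x)
    - 6 * (v x * gradDot g u u x) - u x ^ 2 * ((v x)⁻¹ ^ 3 * F.normSq g x)
    - 6 * (α * (u x * v x ^ 2) + β * v x ^ 2)) * ((u x)⁻¹ ^ 2 * (v x)⁻¹)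

/-- The value of `|F₃|² - 2T` forced by the equation of motion of the warp factor. -/
def stringTerm (α β : ℝ) (F : Form M 5) (v u : M → ℝ) (x : M) : ℝ :=
  (2 * α * v x ^ 3 - 10 * (u x * (v x * laplace g v x)) - 6 * divGrad g (fun z => v z ^ 2) u x
    + u x * (v x ^ 2 * curvatureTerm g α β F v u x)
    - u x * ((v x)⁻¹ ^ 2 * F.normSq g x)) * (u x)⁻¹

/-- Positivity of `v` and `u` permits the two divisions. For `q = 3` the `T` term of the second
equation has coefficient zero, and in the first `T` appears with `v^0`; this makes the system
triangular in `a` and `b`. -/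
theorem isSolution_iff (hD : D.IsTypeIIB) {v u : M → ℝ}
    (hv : ContMDiff (𝓡 6) 𝓘(ℝ, ℝ) 2 v) (hu : ContMDiff (𝓡 6) 𝓘(ℝ, ℝ) 2 u)
    (hv0 : ∀ x, 0 < v x) (hu0 : ∀ x, 0 < u x) :
    IsSolution g D v u ↔
      (∀ x, 2 * D.R x - (D.F 1).normSq g x = curvatureTerm g D.α D.β (D.F 5) v u x) ∧
      (∀ x, (D.F 3).normSq g x - 2 * D.T x = stringTerm g D.α D.β (D.F 5) v u x) := by
  have hq : (D.q : ℝ) = 3 := by rw [hD.1]; norm_num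
  have eqv : ∀ x, (5 * laplace g (fun z => u z ^ 2 * v z) x + 5 * u x ^ 2 * laplace g v x
      - 2 * u x ^ 2 * v x * D.R x - 6 * v x * gradDot g u u x
      + u x ^ 2 / 2 * ∑ p ∈ Finset.range 7,
          (3 - (p : ℝ)) * v x ^ (2 - (p : ℤ)) * (D.F p).normSq g x
      - ((D.q : ℝ) - 3) / 2 * u x ^ 2 * v x ^ (((D.q : ℝ) - 5) / 2) * D.T x
      = 6 * (D.α * u x * v x ^ 2 + D.β * v x ^ 2)) ↔
      2 * D.R x - (D.F 1).normSq g x = curvatureTerm g D.α D.β (D.F 5) v u x := by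
    intro x
    have h1 := (hv0 x).ne'
    have h2 := (hu0 x).ne'
    rw [hD.sum_deriv_normSq, hq, curvatureTerm,
      show ((u x)⁻¹ ^ 2 * (v x)⁻¹) = (u x ^ 2 * v x)⁻¹ by rw [mul_inv, inv_pow],
      ← div_eq_mul_inv, eq_div_iff (by positivity)]
    constructor <;> intro h <;> linear_combination -h
  -- The first equation also involves `a`, so it determines `b` only once the second equation has
  -- fixed `a`.
  have equ : ∀ x, (2 * D.R x - (D.F 1).normSq g x = curvatureTerm g D.α D.β (D.F 5) v u x) →
      ((10 * u x * v x * laplace g v x + 6 * divGrad g (fun z => v z ^ 2) u x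
      - 2 * u x * v x ^ 2 * D.R x
      + u x * ∑ p ∈ Finset.range 7, v x ^ (3 - (p : ℤ)) * (D.F p).normSq g x
      - 2 * u x * v x ^ (((D.q : ℝ) - 3) / 2) * D.T x
      = 2 * D.α * v x ^ 3) ↔
      (D.F 3).normSq g x - 2 * D.T x = stringTerm g D.α D.β (D.F 5) v u x) := by
    intro x hx
    have h2 := (hu0 x).ne'
    rw [hD.sum_normSq, hq, stringTerm, ← hx, ← div_eq_mul_inv, eq_div_iff h2]
    norm_num
    constructor <;> intro h <;> linear_combination h
  constructor
  · intro h
    have h1 := fun x => (eqv x).1 (h.eq_v x)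
    exact ⟨h1, fun x => (equ x (h1 x)).1 (h.eq_u x)⟩
  · intro h
    exact ⟨hv, hu, hv0, hu0, fun x => (equ x (h.1 x)).2 (h.2 x), fun x => (eqv x).2 (h.1 x)⟩

variable [T2Space M] [CompactSpace M]

/-- The bound `13` is the reciprocal threshold `11` plus the two orders lost to the Laplacian: all
factors are placed in the algebra `H^(s-2)`. -/
theorem memHs_curvatureTerm {s : ℝ} (hs : 13 < s) (α β : ℝ) {F : Form M 5} (hF : F.MemHs s)
    {v u : M → ℝ} (hv : MemHs s v) (hu : MemHs s u) (hv0 : ∀ x, 0 < v x) (hu0 : ∀ x, 0 < u x) :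
    MemHs (s - 2) (curvatureTerm g α β F v u) := by
  have h3 : 3 < s - 2 := by linarith
  have hv2 := hv.mono (by linarith : s - 2 ≤ s)
  have hu2 := hu.mono (by linarith : s - 2 ≤ s)
  have hvi := hv2.inv (by linarith) fun x => (hv0 x).ne'
  have hui := hu2.inv (by linarith) fun x => (hu0 x).ne'
  have hN := (hF.normSq g (by linarith)).mono (by linarith : s - 2 ≤ s)
  have hL1 := (((hu.pow (by linarith) 2).mul (by linarith) hv).laplace g (by linarith))
  have hL2 := hv.laplace g (by linarith)
  have hG := (hu.gradDot g (by linarith) hu).mono (by linarith : s - 2 ≤ s - 1)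
  exact (((((hL1.const_mul 5).add (((hu2.pow h3 2).mul h3 hL2).const_mul 5)).sub
    ((hv2.mul h3 hG).const_mul 6)).sub ((hu2.pow h3 2).mul h3 ((hvi.pow h3 3).mul h3 hN))).sub
    ((((hu2.mul h3 (hv2.pow h3 2)).const_mul α).add ((hv2.pow h3 2).const_mul β)).const_mul 6)).mul
    h3 ((hui.pow h3 2).mul h3 hvi)

theorem memHs_stringTerm {s : ℝ} (hs : 13 < s) (α β : ℝ) {F : Form M 5} (hF : F.MemHs s)
    {v u : M → ℝ} (hv : MemHs s v) (hu : MemHs s u) (hv0 : ∀ x, 0 < v x) (hu0 : ∀ x, 0 < u x) :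
    MemHs (s - 2) (stringTerm g α β F v u) := by
  have h3 : 3 < s - 2 := by linarith
  have hv2 := hv.mono (by linarith : s - 2 ≤ s)
  have hu2 := hu.mono (by linarith : s - 2 ≤ s)
  have hvi := hv2.inv (by linarith) fun x => (hv0 x).ne'
  have hui := hu2.inv (by linarith) fun x => (hu0 x).ne'
  have hN := (hF.normSq g (by linarith)).mono (by linarith : s - 2 ≤ s)
  have hL := hv.laplace g (by linarith)
  have hDv := (hv.pow (by linarith) 2).divGrad g (by linarith) hu
  have hc := memHs_curvatureTerm g hs α β hF hv hu hv0 hu0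
  exact ((((((hv2.pow h3 3).const_mul (2 * α)).sub
    ((hu2.mul h3 (hv2.mul h3 hL)).const_mul 10)).sub (hDv.const_mul 6)).add
    (hu2.mul h3 ((hv2.pow h3 2).mul h3 hc))).sub
    (hu2.mul h3 ((hvi.pow h3 2).mul h3 hN))).mul h3 hui

theorem laplace_sq_mul {s : ℝ} (hs : 5 < s) {v u : M → ℝ} (hv : MemHs s v) (hu : MemHs s u)
    (x : M) : laplace g (fun z => u z ^ 2 * v z) x =
      u x ^ 2 * laplace g v x + v x * (2 * u x * laplace g u x + 2 * gradDot g u u x) +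
        4 * u x * gradDot g u v x := by
  have hc := chart_mem_atlas E6 x
  have hy : chartAt E6 x x ∈ (chartAt E6 x).target :=
    (chartAt E6 x).map_source (mem_chart_source E6 x)
  have cv := hv.contDiffAt_two hs hc hy
  have cu := hu.contDiffAt_two hs hc hy
  have e : (fun z => u z ^ 2 * v z) = fun z => u z * (u z * v z) := by ext z; ring
  rw [e, laplace_mul g (h := fun z => u z * v z) cu (cu.mul cv), laplace_mul g cu cv,
    gradDot_mul_right g (cu.differentiableAt (by norm_num)) (cv.differentiableAt (by norm_num))]
  ring

end Equations

/-! ### Differentiation of the effective potential -/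

section Variation

variable {M : Type*}

theorem iteratedDeriv_two_eq {f f' : ℝ → ℝ} {r c : ℝ} (hr : 0 < r)
    (hf : ∀ t, |t| < r → HasDerivAt f (f' t) t) (hf' : HasDerivAt f' c 0) :
    iteratedDeriv 2 f 0 = c := by
  have e : deriv f =ᶠ[𝓝 0] f' := by
    filter_upwards [Metric.ball_mem_nhds (0 : ℝ) hr] with t ht
    exact (hf t (by simpa using ht)).deriv
  rw [iteratedDeriv_succ, iteratedDeriv_one, e.deriv_eq, hf'.deriv]

/-- The derivative is dominated by its maximum over the compact set `[-r, r] × M`, a constant that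
is integrable because the measure is finite. -/
theorem hasDerivAt_integral_of_continuousOn [TopologicalSpace M] [CompactSpace M]
    [MeasurableSpace M] [BorelSpace M] (μ : Measure M) [IsFiniteMeasure μ] {H H' : ℝ → M → ℝ} {r : ℝ}
    (hH : ContinuousOn (fun p : ℝ × M => H p.1 p.2) (Icc (-r) r ×ˢ univ))
    (hH' : ContinuousOn (fun p : ℝ × M => H' p.1 p.2) (Icc (-r) r ×ˢ univ))
    (hd : ∀ t, |t| < r → ∀ x, HasDerivAt (fun t => H t x) (H' t x) t) {t : ℝ} (ht : |t| < r) :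
    HasDerivAt (fun t => ∫ x, H t x ∂μ) (∫ x, H' t x ∂μ) t := by
  have slice : ∀ {K : ℝ → M → ℝ}, ContinuousOn (fun p : ℝ × M => K p.1 p.2)
      (Icc (-r) r ×ˢ univ) → ∀ t, |t| < r → Continuous (K t) := by
    intro K hK t ht
    have := abs_lt.1 ht
    exact hK.comp_continuous (f := fun x : M => (t, x)) (by fun_prop)
      fun x => ⟨⟨this.1.le, this.2.le⟩, mem_univ _⟩
  obtain ⟨B, hB⟩ := (isCompact_Icc.prod isCompact_univ).exists_bound_of_continuousOn hH'
  have hnhds : {t : ℝ | |t| < r} ∈ 𝓝 t :=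
    (isOpen_lt continuous_abs continuous_const).mem_nhds ht
  refine (hasDerivAt_integral_of_dominated_loc_of_deriv_le (bound := fun _ => B) hnhds ?_ ?_ ?_ ?_
    (integrable_const B) ?_).2
  · filter_upwards [hnhds] with t ht
    exact (slice hH t ht).aestronglyMeasurable
  · exact (slice hH t ht).integrable_of_hasCompactSupport (HasCompactSupport.of_compactSpace _)
  · exact (slice hH' t ht).aestronglyMeasurable
  · refine Eventually.of_forall fun x t ht => ?_
    have := abs_lt.1 (show |t| < r from ht)
    exact hB (t, x) ⟨⟨this.1.le, this.2.le⟩, mem_univ _⟩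
  · exact Eventually.of_forall fun x t ht => hd t ht x

/-- The integrand of the effective potential at `(v + t, u)`, up to constants, in terms of
`a = 2R - |F₁|²`, `b = |F₃|² - 2T`, `N = |F₅|²`, `G = |∇u|²` and the gradient terms `A + t B`. -/
def potentialDensity (α β : ℝ) (v u a b N G A B : M → ℝ) (t : ℝ) (x : M) : ℝ :=
  1 / 2 * (-(1 / 2 * u x ^ 2 * (v x + t) ^ 2 * a x) + 1 / 2 * u x ^ 2 * b x
    - 5 * (A x + t * B x) - 3 * (v x + t) ^ 2 * G x + 1 / 2 * u x ^ 2 * (v x + t)⁻¹ ^ 2 * N x)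
  - α * (u x * (v x + t) ^ 3) - β * (v x + t) ^ 3

/-- The `t`-derivative of `potentialDensity`. -/
def potentialDensity' (α β : ℝ) (v u a N G B : M → ℝ) (t : ℝ) (x : M) : ℝ :=
  1 / 2 * (-(u x ^ 2 * (v x + t) * a x) - 5 * B x - 6 * (v x + t) * G x
    - u x ^ 2 * (v x + t)⁻¹ ^ 3 * N x)
  - 3 * α * (u x * (v x + t) ^ 2) - 3 * β * (v x + t) ^ 2

/-- The second `t`-derivative of `potentialDensity`. -/
def potentialDensity'' (α β : ℝ) (v u a N G : M → ℝ) (t : ℝ) (x : M) : ℝ :=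
  1 / 2 * (-(u x ^ 2 * a x) - 6 * G x + 3 * u x ^ 2 * (v x + t)⁻¹ ^ 4 * N x)
  - 6 * α * (u x * (v x + t)) - 6 * β * (v x + t)

variable {α β : ℝ} {v u a b N G A B : M → ℝ}

theorem hasDerivAt_potentialDensity {t : ℝ} {x : M} (h : v x + t ≠ 0) :
    HasDerivAt (fun t => potentialDensity α β v u a b N G A B t x)
      (potentialDensity' α β v u a N G B t x) t := by
  have h1 : HasDerivAt (fun t => v x + t) 1 t := (hasDerivAt_id t).const_add (v x)
  have h2 := h1.fun_inv h
  unfold potentialDensity potentialDensity'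
  have := (((((((h1.fun_pow 2).const_mul (1 / 2 * u x ^ 2)).mul_const (a x)).fun_neg.add_const
    (1 / 2 * u x ^ 2 * b x)).fun_sub
    ((((hasDerivAt_id t).mul_const (B x)).const_add (A x)).const_mul 5)).fun_sub
    (((h1.fun_pow 2).const_mul 3).mul_const (G x))).fun_add
    (((h2.fun_pow 2).const_mul (1 / 2 * u x ^ 2)).mul_const (N x))).const_mul (1 / 2)
  have h4 := (this.fun_sub (((h1.fun_pow 3).const_mul (u x)).const_mul α)).fun_sub
    ((h1.fun_pow 3).const_mul β)
  refine h4.congr_deriv ?_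
  simp only [Nat.cast_ofNat, Nat.reduceSub, pow_one, div_eq_mul_inv (-1 : ℝ), ← inv_pow]
  ring

theorem hasDerivAt_potentialDensity' {t : ℝ} {x : M} (h : v x + t ≠ 0) :
    HasDerivAt (fun t => potentialDensity' α β v u a N G B t x)
      (potentialDensity'' α β v u a N G t x) t := by
  have h1 : HasDerivAt (fun t => v x + t) 1 t := (hasDerivAt_id t).const_add (v x)
  have h2 := h1.fun_inv h
  unfold potentialDensity' potentialDensity''
  have := ((((((h1.const_mul (u x ^ 2)).mul_const (a x)).fun_neg.sub_const (5 * B x)).fun_sub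
    ((h1.const_mul 6).mul_const (G x))).fun_sub
    (((h2.fun_pow 3).const_mul (u x ^ 2)).mul_const (N x))).const_mul (1 / 2))
  have h4 := (this.fun_sub (((h1.fun_pow 2).const_mul (u x)).const_mul (3 * α))).fun_sub
    ((h1.fun_pow 2).const_mul (3 * β))
  refine h4.congr_deriv ?_
  simp only [Nat.cast_ofNat, Nat.reduceSub, pow_one, div_eq_mul_inv (-1 : ℝ), ← inv_pow]
  ring

variable [TopologicalSpace M] [CompactSpace M] [MeasurableSpace M] [BorelSpace M] (μ : Measure M)
  [IsFiniteMeasure μ]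

theorem iteratedDeriv_two_integral_potentialDensity (hv : Continuous v) (hu : Continuous u)
    (ha : Continuous a) (hb : Continuous b) (hN : Continuous N) (hG : Continuous G)
    (hA : Continuous A) (hB : Continuous B) {r : ℝ} (hr : 0 < r) (hvr : ∀ x, r < v x) {f : ℝ → ℝ}
    (c : ℝ) (hf : ∀ t, |t| < r →
      f t = c + ∫ x, potentialDensity α β v u a b N G A B t x ∂μ) :
    iteratedDeriv 2 f 0 = ∫ x, potentialDensity'' α β v u a N G 0 x ∂μ := by
  have hne : ∀ p ∈ Icc (-r) r ×ˢ (univ : Set M), v p.2 + p.1 ≠ 0 := by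
    intro p hp
    have := hvr p.2
    have := hp.1.1
    linarith
  have hne' : ∀ t, |t| < r → ∀ x, v x + t ≠ 0 := by
    intro t ht x
    have := hvr x
    have := (abs_lt.1 ht).1
    linarith
  have hinv : ContinuousOn (fun p : ℝ × M => (v p.2 + p.1)⁻¹) (Icc (-r) r ×ˢ univ) :=
    (by fun_prop : Continuous fun p : ℝ × M => v p.2 + p.1).continuousOn.inv₀ hne
  have c0 : ContinuousOn (fun p : ℝ × M => potentialDensity α β v u a b N G A B p.1 p.2)
      (Icc (-r) r ×ˢ univ) := by
    refine ContinuousOn.sub (ContinuousOn.sub (continuousOn_const.mul (ContinuousOn.add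
      (Continuous.continuousOn ?_) (ContinuousOn.mul (ContinuousOn.mul (Continuous.continuousOn ?_)
      (hinv.pow 2)) (Continuous.continuousOn ?_)))) (Continuous.continuousOn ?_))
      (Continuous.continuousOn ?_)
    all_goals fun_prop
  have c1 : ContinuousOn (fun p : ℝ × M => potentialDensity' α β v u a N G B p.1 p.2)
      (Icc (-r) r ×ˢ univ) := by
    refine ContinuousOn.sub (ContinuousOn.sub (continuousOn_const.mul (ContinuousOn.sub
      (Continuous.continuousOn ?_) (ContinuousOn.mul (ContinuousOn.mul (Continuous.continuousOn ?_)
      (hinv.pow 3)) (Continuous.continuousOn ?_)))) (Continuous.continuousOn ?_))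
      (Continuous.continuousOn ?_)
    all_goals fun_prop
  have c2 : ContinuousOn (fun p : ℝ × M => potentialDensity'' α β v u a N G p.1 p.2)
      (Icc (-r) r ×ˢ univ) := by
    refine ContinuousOn.sub (ContinuousOn.sub (continuousOn_const.mul (ContinuousOn.add
      (Continuous.continuousOn ?_) (ContinuousOn.mul (ContinuousOn.mul (Continuous.continuousOn ?_)
      (hinv.pow 4)) (Continuous.continuousOn ?_)))) (Continuous.continuousOn ?_))
      (Continuous.continuousOn ?_)
    all_goals fun_prop
  refine iteratedDeriv_two_eq (f' := fun t => ∫ x, potentialDensity' α β v u a N G B t x ∂μ) hr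
    (fun t ht => ?_) (hasDerivAt_integral_of_continuousOn μ c1 c2
      (fun t ht x => hasDerivAt_potentialDensity' (hne' t ht x)) (by simpa using hr))
  have := (hasDerivAt_integral_of_continuousOn μ c0 c1
    (fun t ht x => hasDerivAt_potentialDensity (hne' t ht x)) ht).const_add c
  refine this.congr_of_eventuallyEq ?_
  filter_upwards [(isOpen_lt continuous_abs continuous_const).mem_nhds ht] with t ht
  exact hf t ht

end Variation

/-! ### Stability -/

theorem eventually_form_memHs {M : Type*} [TopologicalSpace M] [ChartedSpace E6 M] (p : ℕ) (s : ℝ) :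
    ∀ᶠ F in formNhdsZero M p s, F.MemHs s :=
  mem_inf_of_right (mem_principal_self _)

section Stability

variable {M : Type*} [TopologicalSpace M] [ChartedSpace E6 M] [IsManifold (𝓡 6) ∞ M]
  (g : Metric6 M)

/-- The shift by a constant enters the gradient term only linearly in `t`, so this term drops out of
the second derivative. -/
theorem gradDot_add_const {v w : M → ℝ} {x : M} (t : ℝ)
    (hv : DifferentiableAt ℝ (fun y => v ((chartAt E6 x).symm y)) (chartAt E6 x x))
    (hw : DifferentiableAt ℝ (fun y => w ((chartAt E6 x).symm y)) (chartAt E6 x x)) :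
    gradDot g (fun z => v z + t) (fun z => w z * (v z + t)) x =
      gradDot g v (fun z => w z * v z) x + t * gradDot g v w x := by
  have hvt : DifferentiableAt ℝ (fun y => v ((chartAt E6 x).symm y) + t) (chartAt E6 x x) :=
    hv.add_const t
  have e := (chartAt E6 x).left_inv (mem_chart_source E6 x)
  simp only [gradDot, pd_mul hw hv, pd_mul hw hvt, e, Finset.mul_sum, ← Finset.sum_add_distrib,
    pd_add hv (differentiableAt_const t), pd_const]
  refine Finset.sum_congr rfl fun i _ => Finset.sum_congr rfl fun j _ => ?_
  ring

/-- Inserting the forced `a` cancels `|∇u|²`, halves and reverses the `α`, `β` terms, and raises the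
`|F₅|²` coefficient from `3/2` to `2`. The surviving sign condition at `v = u = 1` is `α + β < 0`.
-/
theorem potentialDensity''_curvatureTerm (α β : ℝ) (F : Form M 5) {v u : M → ℝ} {x : M}
    (hv : v x ≠ 0) (hu : u x ≠ 0) :
    potentialDensity'' α β v u (curvatureTerm g α β F v u) (F.normSq g) (gradDot g u u) 0 x =
      2 * u x ^ 2 * (v x)⁻¹ ^ 4 * F.normSq g x - 3 * v x * (α * u x + β)
      - 5 / 2 * (laplace g (fun z => u z ^ 2 * v z) x + u x ^ 2 * laplace g v x) / v x := by
  simp only [potentialDensity'', curvatureTerm, add_zero]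
  field_simp
  ring

variable [T2Space M] [CompactSpace M]

theorem le_potentialDensity'' {s : ℝ} (hs : 5 < s) {ε δ : ℝ} (hδ : δ ≤ 1 / 4)
    (hδε : δ ≤ ε / 1000) (F : Form M 5) {v u : M → ℝ} (hv : MemHs s v)
    (hu : MemHs s u) {x : M} (hx : CloseAt g δ v u x) :
    ε / 4 ≤ potentialDensity'' (ε / 4) (-(ε / 2)) v u
      (curvatureTerm g (ε / 4) (-(ε / 2)) F v u) (F.normSq g) (gradDot g u u) 0 x := by
  obtain ⟨h1, h2, h3, h4, h5, h6⟩ := hx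
  have hδ0 : 0 ≤ δ := (abs_nonneg _).trans h1
  have hε : 0 ≤ ε := by linarith
  rw [abs_le] at h1 h2
  have v1 : 3 / 4 ≤ v x := by linarith [h1.1]
  have v2 : v x ≤ 5 / 4 := by linarith [h1.2]
  have u1 : 3 / 4 ≤ u x := by linarith [h2.1]
  have u2 : u x ≤ 5 / 4 := by linarith [h2.2]
  have v0 : 0 < v x := by linarith
  have u0 : 0 < u x := by linarith
  rw [potentialDensity''_curvatureTerm g _ _ _ v0.ne' u0.ne', laplace_sq_mul g hs hv hu]
  have hN := F.normSq_nonneg g x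
  have hT : 0 ≤ 2 * u x ^ 2 * (v x)⁻¹ ^ 4 * F.normSq g x := by positivity
  -- Here `-3v(αu + β) = (3ε/4) v (2 - u)`, and both `v` and `2 - u` are at least `3/4`.
  have hM : 27 / 64 * ε ≤ -(3 * v x * (ε / 4 * u x + -(ε / 2))) := by
    have : 9 / 16 ≤ v x * (2 - u x) := by nlinarith
    nlinarith
  have hb : ∀ {c k K : ℝ}, |c| ≤ δ → 0 ≤ k → k ≤ K → k * c ≤ K * δ := fun hc hk hK =>
    (mul_le_mul_of_nonneg_left ((le_abs_self _).trans hc) hk).trans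
      (mul_le_mul_of_nonneg_right hK hδ0)
  have b1 := hb h3 (by positivity : 0 ≤ 2 * u x ^ 2) (by nlinarith : _ ≤ (4 : ℝ))
  have b2 := hb h4 (by positivity : 0 ≤ 2 * (v x * u x)) (by nlinarith : _ ≤ (4 : ℝ))
  have b3 := hb h6 (by positivity : 0 ≤ 2 * v x) (by linarith : _ ≤ (4 : ℝ))
  have b4 := hb h5 (by positivity : 0 ≤ 4 * u x) (by linarith : _ ≤ (5 : ℝ))
  -- The four bounds add up to `17δ`, and `(5/2) · 17 = 42.5 ≤ 60 · 3/4`. As `60δ ≤ 0.06 ε`, what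
  -- remains of `27ε/64` exceeds `ε/4`.
  have hL : 5 / 2 * (u x ^ 2 * laplace g v x + v x * (2 * u x * laplace g u x + 2 * gradDot g u u x)
      + 4 * u x * gradDot g u v x + u x ^ 2 * laplace g v x) / v x ≤ 60 * δ := by
    rw [div_le_iff₀ v0]
    nlinarith [mul_le_mul_of_nonneg_left v1 hδ0]
  linarith

variable [MeasurableSpace M] [BorelSpace M] {D : FieldData M}

/-- In the Type IIB setting `R`, `F₁`, `F₃`, `T` enter the potential only through `a` and `b`, so
the possibly irregular data are replaced by continuous functions and the integral splits. The factor
`t * 1` matches the direction `ψ = 1` in `massSq`. -/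
theorem Veff_add_const (hD : D.IsTypeIIB) {s : ℝ} (hs : 5 < s) {v u a b : M → ℝ} {F : Form M 5}
    (hF : D.F 5 = F) (hFs : F.MemHs s) (hv : MemHs s v) (hu : MemHs s u) (ha : Continuous a)
    (hb : Continuous b) (hDa : ∀ x, 2 * D.R x - (D.F 1).normSq g x = a x)
    (hDb : ∀ x, (D.F 3).normSq g x - 2 * D.T x = b x) {t : ℝ} (ht : ∀ x, v x + t ≠ 0) :
    Veff g D (fun x => v x + t * 1) u =
      (D.α * (1 / D.GN) + D.β * (vol g).real univ) + ∫ x, potentialDensity D.α D.β v u a b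
        (F.normSq g) (gradDot g u u) (gradDot g v fun z => u z ^ 2 * v z)
        (gradDot g v fun z => u z ^ 2) t x ∂(vol g) := by
  have hu2 := hu.pow (by linarith) 2
  have cA := (hv.gradDot g hs (hu2.mul (by linarith) hv)).1
  have cB := (hv.gradDot g hs hu2).1
  have cG := (hu.gradDot g hs hu).1
  have cN := (hFs.normSq g (by linarith)).1
  have cv := hv.1
  have cu := hu.1
  have cinv : Continuous fun x => (v x + t)⁻¹ := (by fun_prop : Continuous fun x => v x + t).inv₀ ht
  have hq : (D.q : ℝ) = 3 := by rw [hD.1]; norm_num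
  set A := gradDot g v fun z => u z ^ 2 * v z
  set B := gradDot g v fun z => u z ^ 2
  set G := gradDot g u u
  set N := F.normSq g
  let P : M → ℝ := fun x => -(1 / 2 * u x ^ 2 * (v x + t) ^ 2 * a x) + 1 / 2 * u x ^ 2 * b x
    - 5 * (A x + t * B x) - 3 * (v x + t) ^ 2 * G x + 1 / 2 * u x ^ 2 * (v x + t)⁻¹ ^ 2 * N x
  have i1 : Integrable P (vol g) := integrable_of_continuous g (by fun_prop)
  have i2 : Integrable (fun x => u x * (v x + t) ^ 3) (vol g) :=
    integrable_of_continuous g (by fun_prop)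
  have i3 : Integrable (fun x => (v x + t) ^ 3) (vol g) :=
    integrable_of_continuous g (by fun_prop)
  have e : ∀ x, -(u x ^ 2 * (v x + t) ^ 2 * D.R x)
      - 5 * gradDot g (fun z => v z + t) (fun z => u z ^ 2 * (v z + t)) x
      - 3 * (v x + t) ^ 2 * G x
      + u x ^ 2 / 2 * ∑ p ∈ Finset.range 7, (v x + t) ^ (3 - (p : ℤ)) * (D.F p).normSq g x
      - u x ^ 2 * (v x + t) ^ (((D.q : ℝ) - 3) / 2) * D.T x = P x := by
    intro x
    have hc := chart_mem_atlas E6 x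
    have hy : chartAt E6 x x ∈ (chartAt E6 x).target :=
      (chartAt E6 x).map_source (mem_chart_source E6 x)
    rw [gradDot_add_const g t ((hv.contDiffAt_two hs hc hy).differentiableAt (by norm_num))
      ((hu2.contDiffAt_two hs hc hy).differentiableAt (by norm_num)), hD.sum_normSq, hq, hF,
      sub_self, zero_div, Real.rpow_zero]
    simp only [P, ← hDa, ← hDb]
    ring
  have i4 : Integrable (fun x => 1 / 2 * P x - D.α * (u x * (v x + t) ^ 3)) (vol g) :=
    (i1.const_mul _).sub (i2.const_mul _)
  simp only [Veff, mul_one]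
  rw [integral_congr_ae (Eventually.of_forall e)]
  calc _ = (D.α * (1 / D.GN) + D.β * (vol g).real univ) + ((1 / 2 * ∫ x, P x ∂(vol g)
        - D.α * ∫ x, u x * (v x + t) ^ 3 ∂(vol g)) - D.β * ∫ x, (v x + t) ^ 3 ∂(vol g)) := by ring
    _ = _ := by
      rw [← integral_const_mul, ← integral_const_mul, ← integral_const_mul,
        ← integral_sub (i1.const_mul _) (i2.const_mul _), ← integral_sub i4 (i3.const_mul _)]
      rfl

theorem massSq_eq_integral (hD : D.IsTypeIIB) {s : ℝ} (hs : 5 < s) {v u a b : M → ℝ}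
    {F : Form M 5} (hF : D.F 5 = F) (hFs : F.MemHs s) (hv : MemHs s v) (hu : MemHs s u)
    (ha : Continuous a) (hb : Continuous b) (hDa : ∀ x, 2 * D.R x - (D.F 1).normSq g x = a x)
    (hDb : ∀ x, (D.F 3).normSq g x - 2 * D.T x = b x) {r : ℝ} (hr : 0 < r) (hvr : ∀ x, r < v x) :
    massSq g D v u = ∫ x, potentialDensity'' D.α D.β v u a (F.normSq g) (gradDot g u u) 0 x
      ∂(vol g) := by
  have hu2 := hu.pow (by linarith) 2
  refine iteratedDeriv_two_integral_potentialDensity (vol g) hv.1 hu.1 ha hb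
    (hFs.normSq g (by linarith)).1 (hu.gradDot g hs hu).1
    (hv.gradDot g hs (hu2.mul (by linarith) hv)).1 (hv.gradDot g hs hu2).1 hr hvr _ fun t ht =>
    Veff_add_const g hD hs hF hFs hv hu ha hb hDa hDb fun x => ?_
  have := hvr x
  have := (abs_lt.1 ht).1
  linarith

theorem massSq_pos [Nonempty M] (hD : D.IsTypeIIB) {s : ℝ} (hs : 13 < s) {ε δ : ℝ} (hε : 0 < ε)
    (hδ : δ ≤ 1 / 4) (hδε : δ ≤ ε / 1000) (hα : D.α = ε / 4) (hβ : D.β = -(ε / 2))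
    {v u : M → ℝ} (hF : (D.F 5).MemHs s) (hv : MemHs s v) (hu : MemHs s u)
    (hvu : ∀ x, CloseAt g δ v u x)
    (hDa : ∀ x, 2 * D.R x - (D.F 1).normSq g x = curvatureTerm g D.α D.β (D.F 5) v u x)
    (hDb : ∀ x, (D.F 3).normSq g x - 2 * D.T x = stringTerm g D.α D.β (D.F 5) v u x) :
    0 < massSq g D v u := by
  have v1 : ∀ x, 1 / 2 < v x := fun x => by linarith [(abs_le.1 (hvu x).1).1]
  have u1 : ∀ x, 1 / 2 < u x := fun x => by linarith [(abs_le.1 (hvu x).2.1).1]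
  have v0 : ∀ x, 0 < v x := fun x => by linarith [v1 x]
  have u0 : ∀ x, 0 < u x := fun x => by linarith [u1 x]
  have hs5 : 5 < s := by linarith
  have ca := (memHs_curvatureTerm g hs D.α D.β hF hv hu v0 u0).1
  have cb := (memHs_stringTerm g hs D.α D.β hF hv hu v0 u0).1
  have cv := hv.1
  have cu := hu.1
  have cN := (hF.normSq g (by linarith)).1
  have cG := (hu.gradDot g hs5 hu).1
  have ci : Continuous fun x => (v x)⁻¹ := cv.inv₀ fun x => (v0 x).ne'
  rw [massSq_eq_integral g hD hs5 rfl hF hv hu ca cb hDa hDb (by norm_num) v1]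
  have hint : Integrable (potentialDensity'' D.α D.β v u
      (curvatureTerm g D.α D.β (D.F 5) v u) ((D.F 5).normSq g) (gradDot g u u) 0) (vol g) := by
    refine integrable_of_continuous g ?_
    unfold potentialDensity''
    simp only [add_zero]
    refine Continuous.sub (Continuous.sub (continuous_const.mul (Continuous.add ?_
      (Continuous.mul (Continuous.mul ?_ (ci.pow 4)) ?_))) ?_) ?_
    all_goals fun_prop
  refine lt_of_lt_of_le (b := ∫ _, ε / 4 ∂(vol g)) ?_
    (integral_mono (integrable_const _) hint fun x => ?_)
  · rw [integral_const, smul_eq_mul]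
    have := ENNReal.toReal_pos (vol_univ_pos g).ne' (measure_ne_top _ _)
    exact mul_pos this (by positivity)
  · rw [hα, hβ]
    exact le_potentialDensity'' g hs5 hδ hδε _ hv hu (hvu x)

end Stability

end Warped

end

/-! ### The main theorem. -/

theorem mainTheorem8 {M : Type*} [TopologicalSpace M] [ChartedSpace Warped.E6 M]
    [IsManifold (𝓡 6) ∞ M] [T2Space M] [CompactSpace M] [Nonempty M]
    [MeasurableSpace M] [BorelSpace M] (g : Warped.Metric6 M) :
    ∃ s₀ : ℝ, ∀ s : ℝ, s₀ ≤ s → ∀ ε : ℝ, 0 < ε →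
      ∃ α β : ℝ, 0 < α ∧ α < ε ∧ -ε < β ∧ β < 0 ∧
        ∀ᶠ w : Warped.Form M 5 × (M → ℝ) × (M → ℝ) in
            Warped.formNhdsZero M 5 s ×ˢ (Warped.hsNhds s (fun _ => 1) ×ˢ
              Warped.hsNhds s (fun _ => 1)),
          ∃ a b : M → ℝ, Warped.MemHs (s - 2) a ∧ Warped.MemHs (s - 2) b ∧
            ∀ D : Warped.FieldData M, D.IsTypeIIB → D.α = α → D.β = β → D.F 5 = w.1 →
              (Warped.IsSolution g D w.2.1 w.2.2 ↔
                (∀ x, 2 * D.R x - (D.F 1).normSq g x = a x) ∧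
                (∀ x, (D.F 3).normSq g x - 2 * D.T x = b x)) ∧
              (Warped.IsSolution g D w.2.1 w.2.2 → Warped.IsStable g D w.2.1 w.2.2) := by
  -- Any bound above `13` would do for `s`. The choice `α = ε/4`, `β = -ε/2` has the required signs
  -- and sizes and gives `α + β = -ε/4 < 0`.
  refine ⟨20, fun s hs ε hε => ⟨ε / 4, -(ε / 2), by positivity, by linarith, by linarith,
    by linarith, ?_⟩⟩
  -- The bound `1/4` keeps `v` and `u` in `[3/4, 5/4]`; the bound `ε/1000` makes the Laplacian terms
  -- negligible against `ε`.
  have hδ : 0 < min (1 / 4) (ε / 1000) := lt_min (by norm_num) (by positivity)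
  filter_upwards [(Warped.eventually_form_memHs 5 s).prod_mk
    (Warped.eventually_closeAt g (by linarith : 5 < s) hδ)] with w hw
  obtain ⟨hF, hv, hu, hvu⟩ := hw
  have h13 : 13 < s := by linarith
  have hle := min_le_left (1 / 4) (ε / 1000)
  have v0 : ∀ x, 0 < w.2.1 x := fun x => by linarith [(abs_le.1 (hvu x).1).1]
  have u0 : ∀ x, 0 < w.2.2 x := fun x => by linarith [(abs_le.1 (hvu x).2.1).1]
  refine ⟨_, _, Warped.memHs_curvatureTerm g h13 (ε / 4) (-(ε / 2)) hF hv hu v0 u0,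
    Warped.memHs_stringTerm g h13 (ε / 4) (-(ε / 2)) hF hv hu v0 u0, ?_⟩
  intro D hD hα hβ hDF
  have hsol := Warped.isSolution_iff g hD (hv.contMDiff (n := 2) (by norm_num; linarith))
    (hu.contMDiff (n := 2) (by norm_num; linarith)) v0 u0
  rw [← hα, ← hβ, ← hDF]
  refine ⟨hsol, fun h => ⟨h, ?_⟩⟩
  exact Warped.massSq_pos g hD h13 hε hle (min_le_right _ _) hα hβ (hDF ▸ hF) hv hu hvu
    (hsol.1 h).1 (hsol.1 h).2
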